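/- Fix $\beta>2$. Let $X=\dot H^1\cap L^6\cap\dot H^2(\mathbb R^3)$ be the space of real-valued functions with norm $\|u\|_X=\|\nabla u\|_{L^2}+\|D^2u\|_{L^2}$ and, for $u\in X$, put $F(u,V)=-\Delta u-Vu+u^5$. Let $V\in C(\mathbb R^3)$ satisfy $\sup_x(1+|x|)^\beta|V(x)|<\infty$, $V\ge 0$ and $V\not\equiv 0$. Suppose that every nonzero eigenvalue of the Birman–Schwinger operator $\sqrt V(-\Delta)^{-1}\sqrt V$ on the real space $L^2(\mathbb R^3)$ is simple (its eigenspace is one-dimensional), where, for $f\in L^2$, $(-\Delta)^{-1}(\sqrt V f)$ denotes the solution $w\in X$ of $-\Delta w=\sqrt V f$. Let $\lambda_1>\lambda_2$ be its largest and second largest eigenvalues. Then there is $\varepsilon_0>0$ such that for every $\varepsilon\in(0,\varepsilon_0]$ there is $\delta>0$ such that for every $\alpha\in\left(\frac1{\lambda_2},\frac1{\lambda_2}+\delta\right)$ the equation $F(u,\alpha V)=0$ has exactly two nontrivial solutions $u$ in the ball $\{u\in X:\|u\|_X<\varepsilon\}$. These two solutions are $\phi(\alpha)$ and $-\phi(\alpha)$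 for some $\phi(\alpha)\in X$, and $\phi(\alpha)$ changes sign: it is positive on a set of positive measure and negative on a set of positive measure. -/

import Mathlib

open MeasureTheory Set
open scoped ContDiff ENNReal

noncomputable section

namespace ExcitedStates

/-- Three dimensional Euclidean space. -/
abbrev R3 : Type := EuclideanSpace ℝ (Fin 3)

/-- Real valued `L²(ℝ³)`. -/
abbrev L2 : Type := Lp ℝ 2 (volume : Measure R3)

/-- Real valued `L⁶(ℝ³)`. -/
abbrev L6 : Type := Lp ℝ 6 (volume : Measure R3)

/-- The classical partial derivative in the `i`-th coordinate direction. -/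
def partialDeriv (i : Fin 3) (η : R3 → ℝ) (x : R3) : ℝ :=
  fderiv ℝ η x (EuclideanSpace.single i 1)

/-- `g` is the weak (distributional) partial derivative `∂ᵢ u`. -/
structure HasWeakPartial (i : Fin 3) (u g : R3 → ℝ) : Prop where
  left : LocallyIntegrable u volume
  right : LocallyIntegrable g volume
  integral_eq : ∀ η : R3 → ℝ, ContDiff ℝ ∞ η → HasCompactSupport η →
    ∫ x, u x * partialDeriv i η x = -∫ x, g x * η x

open Classical in
/-- The weak partial derivative `∂ᵢ u`, as a function determined up to null sets
(and `0` if `u` has no locally integrable weak partial derivative). -/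
def weakPartial (i : Fin 3) (u : R3 → ℝ) : R3 → ℝ :=
  if h : ∃ g, HasWeakPartial i u g then h.choose else 0

/-- The weak Laplacian `∑ᵢ ∂ᵢ ∂ᵢ u`. -/
def weakLaplacian (u : R3 → ℝ) (x : R3) : ℝ :=
  ∑ i, weakPartial i (weakPartial i u) x

lemma integrable_mul_test {u η : R3 → ℝ} (hu : LocallyIntegrable u volume)
    (hη : Continuous η) (hc : HasCompactSupport η) :
    Integrable (fun x => u x * η x) volume := by
  simpa [smul_eq_mul, mul_comm] using hu.integrable_smul_left_of_hasCompactSupport hη hc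

lemma continuous_partialDeriv {η : R3 → ℝ} (i : Fin 3) (hη : ContDiff ℝ ∞ η) :
    Continuous (partialDeriv i η) :=
  (hη.continuous_fderiv (by simp)).clm_apply continuous_const

lemma hasCompactSupport_partialDeriv {η : R3 → ℝ} (i : Fin 3) (hη : HasCompactSupport η) :
    HasCompactSupport (partialDeriv i η) :=
  hη.fderiv_apply ℝ (EuclideanSpace.single i 1)

lemma HasWeakPartial.congr {i : Fin 3} {u g u' g' : R3 → ℝ} (h : HasWeakPartial i u g)
    (hu : u =ᵐ[volume] u') (hg : g =ᵐ[volume] g') : HasWeakPartial i u' g' where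
  left := h.left.congr hu
  right := h.right.congr hg
  integral_eq η h1 h2 := by
    have e1 : ∫ x, u x * partialDeriv i η x = ∫ x, u' x * partialDeriv i η x :=
      integral_congr_ae (hu.mono fun x hx => by simp only [hx])
    have e2 : ∫ x, g x * η x = ∫ x, g' x * η x :=
      integral_congr_ae (hg.mono fun x hx => by simp only [hx])
    rw [← e1, ← e2]
    exact h.integral_eq η h1 h2

lemma HasWeakPartial.add {i : Fin 3} {u g u' g' : R3 → ℝ} (h : HasWeakPartial i u g)
    (h' : HasWeakPartial i u' g') : HasWeakPartial i (u + u') (g + g') where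
  left := h.left.add h'.left
  right := h.right.add h'.right
  integral_eq η h1 h2 := by
    have c1 := continuous_partialDeriv i h1
    have c2 := hasCompactSupport_partialDeriv i h2
    simp only [Pi.add_apply, add_mul]
    rw [integral_add (integrable_mul_test h.left c1 c2) (integrable_mul_test h'.left c1 c2),
      integral_add (integrable_mul_test h.right h1.continuous h2)
        (integrable_mul_test h'.right h1.continuous h2),
      h.integral_eq η h1 h2, h'.integral_eq η h1 h2]
    ring

lemma HasWeakPartial.const_smul {i : Fin 3} {u g : R3 → ℝ} (c : ℝ) (h : HasWeakPartial i u g) :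
    HasWeakPartial i (c • u) (c • g) where
  left := h.left.smul c
  right := h.right.smul c
  integral_eq η h1 h2 := by
    simp only [Pi.smul_apply, smul_eq_mul, mul_assoc, integral_const_mul]
    rw [h.integral_eq η h1 h2, mul_neg]

/-- Weak derivatives are unique up to null sets. -/
lemma HasWeakPartial.unique {i : Fin 3} {u g g' : R3 → ℝ} (h : HasWeakPartial i u g)
    (h' : HasWeakPartial i u g') : g =ᵐ[volume] g' := by
  refine ae_eq_of_integral_contDiff_smul_eq h.right h'.right fun η h1 h2 => ?_
  have := (h.integral_eq η h1 h2).symm.trans (h'.integral_eq η h1 h2)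
  simpa [smul_eq_mul, mul_comm] using this

lemma HasWeakPartial.ae_eq {i : Fin 3} {u g : R3 → ℝ} (h : HasWeakPartial i u g) :
    weakPartial i u =ᵐ[volume] g := by
  have hex : ∃ g, HasWeakPartial i u g := ⟨g, h⟩
  rw [weakPartial, dif_pos hex]
  exact hex.choose_spec.unique h

lemma HasWeakPartial.weakPartial {i : Fin 3} {u g : R3 → ℝ} (h : HasWeakPartial i u g) :
    HasWeakPartial i u (weakPartial i u) :=
  h.congr Filter.EventuallyEq.rfl h.ae_eq.symm

/-- `u ∈ Ḣ¹ ∩ L⁶ ∩ Ḣ²(ℝ³)`: `u ∈ L⁶`, and the weak partial derivatives of `u` of first and of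
second order exist and belong to `L²`. -/
def MemX (u : R3 → ℝ) : Prop :=
  MemLp u 6 volume ∧ ∀ i, ∃ g, MemLp g 2 volume ∧ HasWeakPartial i u g ∧
    ∀ j, ∃ h, MemLp h 2 volume ∧ HasWeakPartial j g h

/-- The space `X = Ḣ¹ ∩ L⁶ ∩ Ḣ²(ℝ³)` of real valued functions, modulo equality almost
everywhere. -/
def SpaceX : Submodule ℝ L6 where
  carrier := {u | MemX u}
  zero_mem' := by
    have h0 : ∀ i, HasWeakPartial i (0 : R3 → ℝ) 0 := fun i =>
      ⟨locallyIntegrable_zero, locallyIntegrable_zero, fun η _ _ => by simp⟩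
    refine ⟨Lp.memLp _, fun i => ⟨0, MemLp.zero, ?_, fun j => ⟨0, MemLp.zero, h0 j⟩⟩⟩
    exact (h0 i).congr (Lp.coeFn_zero ℝ 6 volume).symm Filter.EventuallyEq.rfl
  add_mem' := by
    rintro u v ⟨-, hu⟩ ⟨-, hv⟩
    refine ⟨Lp.memLp _, fun i => ?_⟩
    obtain ⟨g, hg, hug, H⟩ := hu i
    obtain ⟨g', hg', hvg, H'⟩ := hv i
    refine ⟨g + g', hg.add hg', (hug.add hvg).congr (Lp.coeFn_add u v).symm
      Filter.EventuallyEq.rfl, fun j => ?_⟩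
    obtain ⟨h, hh, hgh⟩ := H j
    obtain ⟨h', hh', hgh'⟩ := H' j
    exact ⟨h + h', hh.add hh', hgh.add hgh'⟩
  smul_mem' := by
    rintro c u ⟨-, hu⟩
    refine ⟨Lp.memLp _, fun i => ?_⟩
    obtain ⟨g, hg, hug, H⟩ := hu i
    refine ⟨c • g, hg.const_smul c, (hug.const_smul c).congr (Lp.coeFn_smul c u).symm
      Filter.EventuallyEq.rfl, fun j => ?_⟩
    obtain ⟨h, hh, hgh⟩ := H j
    exact ⟨c • h, hh.const_smul c, hgh.const_smul c⟩

/-- The function represented by an element of `X`. -/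
def fn (u : SpaceX) : R3 → ℝ := ((u : L6) : R3 → ℝ)

/-- The norm `‖u‖_X = ‖∇u‖_{L²} + ‖D²u‖_{L²}` of `X`. -/
def normX (u : SpaceX) : ℝ :=
  √(∑ i, (eLpNorm (weakPartial i (fn u)) 2 volume).toReal ^ 2) +
    √(∑ i, ∑ j, (eLpNorm (weakPartial j (weakPartial i (fn u))) 2 volume).toReal ^ 2)

/-- `V ∈ Y`: `V` is continuous and `sup_x (1 + |x|)^β |V(x)| < ∞`. -/
def MemY (β : ℝ) (V : R3 → ℝ) : Prop :=
  Continuous V ∧ BddAbove (range fun x => (1 + ‖x‖) ^ β * |V x|)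

/-- `F(u, V) = -Δu - V u + u⁵`. For `u ∈ X` and `V ∈ Y` the right hand side is a function (an
element of `L²`), so that `F(u, V) = 0` means that it vanishes almost everywhere. -/
def F (u : SpaceX) (V : R3 → ℝ) (x : R3) : ℝ :=
  -weakLaplacian (fn u) x - V x * fn u x + fn u x ^ 5

lemma weakLaplacian_add (u v : SpaceX) :
    weakLaplacian (fn (u + v)) =ᵐ[volume]
      fun x => weakLaplacian (fn u) x + weakLaplacian (fn v) x := by
  have key : ∀ i, weakPartial i (weakPartial i (fn (u + v))) =ᵐ[volume]
      fun x => weakPartial i (weakPartial i (fn u)) x + weakPartial i (weakPartial i (fn v)) x := by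
    intro i
    obtain ⟨g, -, hug, H⟩ := u.2.2 i
    obtain ⟨g', -, hvg, H'⟩ := v.2.2 i
    obtain ⟨h, -, hgh⟩ := H i
    obtain ⟨h', -, hgh'⟩ := H' i
    have a1 := hgh.congr hug.ae_eq.symm Filter.EventuallyEq.rfl
    have a2 := hgh'.congr hvg.ae_eq.symm Filter.EventuallyEq.rfl
    have b := ((hug.weakPartial.add hvg.weakPartial).congr
      (Lp.coeFn_add (u : L6) (v : L6)).symm Filter.EventuallyEq.rfl).ae_eq
    exact ((a1.weakPartial.add a2.weakPartial).congr b.symm Filter.EventuallyEq.rfl).ae_eq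
  have := Filter.eventually_all.2 key
  filter_upwards [this] with x hx
  simp only [weakLaplacian, ← Finset.sum_add_distrib]
  exact Finset.sum_congr rfl fun i _ => hx i

lemma weakLaplacian_smul (c : ℝ) (u : SpaceX) :
    weakLaplacian (fn (c • u)) =ᵐ[volume] fun x => c * weakLaplacian (fn u) x := by
  have key : ∀ i, weakPartial i (weakPartial i (fn (c • u))) =ᵐ[volume]
      fun x => c * weakPartial i (weakPartial i (fn u)) x := by
    intro i
    obtain ⟨g, -, hug, H⟩ := u.2.2 i
    obtain ⟨h, -, hgh⟩ := H i
    have a1 := hgh.congr hug.ae_eq.symm Filter.EventuallyEq.rfl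
    have b := ((hug.weakPartial.const_smul c).congr
      (Lp.coeFn_smul c (u : L6)).symm Filter.EventuallyEq.rfl).ae_eq
    exact ((a1.weakPartial.const_smul c).congr b.symm Filter.EventuallyEq.rfl).ae_eq
  have := Filter.eventually_all.2 key
  filter_upwards [this] with x hx
  simp only [weakLaplacian, Finset.mul_sum]
  exact Finset.sum_congr rfl fun i _ => hx i

/-- The graph of the Birman–Schwinger operator `√V (-Δ)⁻¹ √V` on `L²`: the pair `(f, h)` belongs
to it if `h = √V w` where `w = (-Δ)⁻¹ (√V f)`, that is, where `w ∈ X` solves `-Δ w = √V f`. -/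
def birmanSchwingerGraph (V : R3 → ℝ) : Submodule ℝ (L2 × L2) where
  carrier := {p | ∃ w : SpaceX,
    (∀ᵐ x, -weakLaplacian (fn w) x = √(V x) * p.1 x) ∧ ∀ᵐ x, p.2 x = √(V x) * fn w x}
  zero_mem' := by
    refine ⟨0, ?_, ?_⟩
    · filter_upwards [weakLaplacian_smul 0 (0 : SpaceX), Lp.coeFn_zero ℝ 2 (volume : Measure R3)]
        with x h1 h2
      rw [smul_zero, zero_mul] at h1
      have h3 : (((0 : L2 × L2).1 : L2) : R3 → ℝ) x = 0 := h2
      rw [h1, h3, mul_zero, neg_zero]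
    · filter_upwards [Lp.coeFn_zero ℝ 6 (volume : Measure R3),
        Lp.coeFn_zero ℝ 2 (volume : Measure R3)] with x h1 h2
      have h3 : fn 0 x = 0 := h1
      have h4 : (((0 : L2 × L2).2 : L2) : R3 → ℝ) x = 0 := h2
      rw [h3, h4, mul_zero]
  add_mem' := by
    rintro p q ⟨w, hw, hw'⟩ ⟨z, hz, hz'⟩
    refine ⟨w + z, ?_, ?_⟩
    · filter_upwards [weakLaplacian_add w z, hw, hz, Lp.coeFn_add p.1 q.1] with x h1 h2 h3 h4
      simp only [Prod.fst_add, h1, h4, Pi.add_apply, mul_add, ← h2, ← h3, neg_add]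
    · filter_upwards [Lp.coeFn_add (w : L6) (z : L6), hw', hz', Lp.coeFn_add p.2 q.2]
        with x h1 h2 h3 h4
      simp only [fn] at h2 h3
      simp only [Prod.snd_add, fn, Submodule.coe_add, h1, h4, Pi.add_apply, mul_add,
        ← h2, ← h3]
  smul_mem' := by
    rintro c p ⟨w, hw, hw'⟩
    refine ⟨c • w, ?_, ?_⟩
    · filter_upwards [weakLaplacian_smul c w, hw, Lp.coeFn_smul c p.1] with x h1 h2 h3
      simp only [Prod.smul_fst, h1, h3, Pi.smul_apply, smul_eq_mul]
      linear_combination c * h2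
    · filter_upwards [Lp.coeFn_smul c (w : L6), hw', Lp.coeFn_smul c p.2] with x h1 h2 h3
      simp only [fn] at h2
      simp only [Prod.smul_snd, fn, Submodule.coe_smul, h1, h3, Pi.smul_apply, smul_eq_mul]
      linear_combination c * h2

/-- The eigenspace `{f ∈ L² : √V (-Δ)⁻¹ √V f = μ f}`. -/
def birmanSchwingerEigenspace (V : R3 → ℝ) (μ : ℝ) : Submodule ℝ L2 :=
  (birmanSchwingerGraph V).comap (LinearMap.id.prod (μ • LinearMap.id))

lemma mem_birmanSchwingerEigenspace {V : R3 → ℝ} {μ : ℝ} {f : L2} :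
    f ∈ birmanSchwingerEigenspace V μ ↔ (f, μ • f) ∈ birmanSchwingerGraph V := Iff.rfl

/-- The set of eigenvalues of the Birman–Schwinger operator `√V (-Δ)⁻¹ √V` on `L²`. -/
def birmanSchwingerEigenvalues (V : R3 → ℝ) : Set ℝ :=
  {μ | birmanSchwingerEigenspace V μ ≠ ⊥}

/-- The nontrivial solutions `u` of `F(u, V) = 0` in the ball `B_ε(0)` of `X`. -/
def smallSolutions (V : R3 → ℝ) (ε : ℝ) : Set SpaceX :=
  {u | u ≠ 0 ∧ normX u < ε ∧ F u V =ᵐ[volume] 0}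

/-- `u` takes positive values on a set of positive measure, and negative ones too. -/
def ChangesSign (u : SpaceX) : Prop :=
  0 < volume {x | 0 < fn u x} ∧ 0 < volume {x | fn u x < 0}

end ExcitedStates

end

noncomputable section

namespace ExcitedStates

/-! ### Hölder exponents -/

/-! The problem is moved from `X` to the Hilbert space `Energy`, the completion of the test
functions in the Dirichlet norm, which embeds in `L⁶`. There it reads `G = α T G - N G`. Here `T =
newtonMul` is `(-Δ)⁻¹V = A*A`, with `A` multiplication by `√V`, and `N = newtonPow` is `(-Δ)⁻¹u⁵`,
locally Lipschitz and homogeneous of degree five. The nonzero eigenvalues of `T = A*A` are those of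
the Birman–Schwinger operator `AA*`, and `A` carries eigenspaces to eigenspaces
(`mem_birmanSchwingerEigenspace_iff`). Decay faster than `|x|⁻²` makes `T` compact
(`isCompactOperator_newtonMul`), and `λ₂ > 0` because `T` does not have rank at most one
(`pos_of_isGreatest_diff`).

The count is a Lyapunov–Schmidt argument (`exists_bifurcation`). With `e` a unit eigenvector for
`λ₂`, put `u = t(e + y)`, `y ⊥ e`, and `σ = αλ₂ - 1`. The component along `e` gives `σ = t⁴⟨N(e +
y), e⟩`, and eliminating `t⁴` from the orthogonal component leaves `y = σ H(y)`, a contraction for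
small `σ`. Hence `y` is unique and `t` is determined up to sign. Since `⟨N e, e⟩ = ∫ u⁶ > 0`, where
`u` is the function of `e`, the branch lies over `α > 1/λ₂`. An a priori bound shows that every
small solution has this form, in a ball independent of `α`.

The two norms are compared by regularity. The energy norm is at most `normX`; conversely, difference
quotients applied to `-Δu + u⁵ = αVu` bound second derivatives linearly by the energy norm, because
the monotone term `u⁵` contributes with a favourable sign (`norm_shiftE_sub_le`,
`exists_spaceX_of_eq`).

For the sign, `(-Δ)⁻¹` is positivity improving (`integral_mul_embL6_pos`), so there is an
eigenfunction for `λ₁` which is nonnegative where `V > 0`. An eigenfunction for `λ₂` is orthogonal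
to it, so neither `e` nor `-e` is nonnegative. The nonnegative cone of `L⁶` is closed, so this
persists for `e + y` with `y` small. -/

instance factSixFifths : Fact ((1 : ℝ≥0∞) ≤ 6 / 5) := ⟨by
  rw [ENNReal.le_div_iff_mul_le (by simp) (by simp)]; norm_num⟩

instance factSix : Fact ((1 : ℝ≥0∞) ≤ 6) := ⟨by norm_num⟩

instance holderTriple_sixFifths_six : ENNReal.HolderTriple (6 / 5) 6 1 := ⟨by
  rw [ENNReal.inv_div (by simp) (by simp), inv_one, ← one_div, ENNReal.div_add_div_same]
  norm_num
  exact ENNReal.div_self (by simp) (by simp)⟩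

instance holderTriple_three_six : ENNReal.HolderTriple 3 6 2 := ⟨by
  rw [← ENNReal.toReal_eq_toReal_iff' (by simp) (by simp),
    ENNReal.toReal_add (by simp) (by simp)]
  norm_num⟩

instance holderTriple_six_six : ENNReal.HolderTriple 6 6 3 := ⟨by
  rw [← ENNReal.toReal_eq_toReal_iff' (by simp) (by simp),
    ENNReal.toReal_add (by simp) (by simp)]
  norm_num⟩

instance holderTriple_three_three : ENNReal.HolderTriple 3 3 (3 / 2) := ⟨by
  rw [ENNReal.inv_div (by simp) (by simp), ← one_div, ENNReal.div_add_div_same]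
  norm_num⟩

instance holderTriple_threeHalves_six : ENNReal.HolderTriple (3 / 2) 6 (6 / 5) := ⟨by
  rw [ENNReal.inv_div (by simp) (by simp), ENNReal.inv_div (by simp) (by simp),
    ← ENNReal.toReal_eq_toReal_iff'
      (ENNReal.add_ne_top.2 ⟨ENNReal.div_ne_top (by simp) (by simp), by simp⟩)
      (ENNReal.div_ne_top (by simp) (by simp)),
    ENNReal.toReal_add (ENNReal.div_ne_top (by simp) (by simp)) (by simp)]
  norm_num⟩

instance holderTriple_three_two : ENNReal.HolderTriple 3 2 (6 / 5) := ⟨by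
  rw [ENNReal.inv_div (by simp) (by simp),
    ← ENNReal.toReal_eq_toReal_iff' (by simp) (ENNReal.div_ne_top (by simp) (by simp)),
    ENNReal.toReal_add (by simp) (by simp)]
  norm_num⟩

lemma abs_integral_mul_le {α : Type*} [MeasurableSpace α] {μ : Measure α} (p q : ℝ≥0∞)
    [ENNReal.HolderTriple p q 1] {f g : α → ℝ} (hf : MemLp f p μ) (hg : MemLp g q μ) :
    |∫ x, f x * g x ∂μ| ≤ (eLpNorm f p μ).toReal * (eLpNorm g q μ).toReal := by
  have h := eLpNorm_smul_le_mul_eLpNorm (p := p) (q := q) (r := 1) hg.1 hf.1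
  have hi : Integrable (fun x => f x * g x) μ := hf.integrable_mul hg
  rw [← ENNReal.toReal_mul]
  calc |∫ x, f x * g x ∂μ| ≤ ∫ x, ‖f x * g x‖ ∂μ := by
        simpa using norm_integral_le_integral_norm (fun x => f x * g x)
    _ = (eLpNorm (fun x => f x * g x) 1 μ).toReal := by
        rw [integral_norm_eq_lintegral_enorm hi.1, eLpNorm_one_eq_lintegral_enorm]
    _ ≤ _ := ENNReal.toReal_mono (ENNReal.mul_ne_top hf.2.ne hg.2.ne) h

lemma integrable_mul_of_memLp {α : Type*} [MeasurableSpace α] {μ : Measure α} (p q : ℝ≥0∞)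
    [ENNReal.HolderTriple p q 1] {f g : α → ℝ} (hf : MemLp f p μ) (hg : MemLp g q μ) :
    Integrable (fun x => f x * g x) μ := hf.integrable_mul hg

/-! ### Test functions -/

/-- The space of test functions. -/
def TestFn : Submodule ℝ (R3 → ℝ) where
  carrier := {η | ContDiff ℝ ∞ η ∧ HasCompactSupport η}
  zero_mem' := ⟨contDiff_const, HasCompactSupport.zero⟩
  add_mem' := fun h h' => ⟨h.1.add h'.1, h.2.add h'.2⟩
  smul_mem' := fun c _ h => ⟨contDiff_const.smul h.1, h.2.smul_left (f := fun _ => c)⟩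

lemma contDiff_partialDeriv {η : R3 → ℝ} (i : Fin 3) (hη : ContDiff ℝ ∞ η) :
    ContDiff ℝ ∞ (partialDeriv i η) :=
  (hη.fderiv_right (m := ∞) (by simp)).clm_apply contDiff_const

lemma partialDeriv_mem {η : R3 → ℝ} (i : Fin 3) (hη : η ∈ TestFn) : partialDeriv i η ∈ TestFn :=
  ⟨contDiff_partialDeriv i hη.1, hasCompactSupport_partialDeriv i hη.2⟩

lemma memLp_of_mem_testFn {η : R3 → ℝ} (hη : η ∈ TestFn) (p : ℝ≥0∞) : MemLp η p volume :=
  hη.1.continuous.memLp_of_hasCompactSupport hη.2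

lemma fderiv_eq_sum_partialDeriv (η : R3 → ℝ) (x v : R3) :
    fderiv ℝ η x v = ∑ i, v i * partialDeriv i η x := by
  have hv : v = ∑ i, v i • EuclideanSpace.single i (1 : ℝ) := by
    ext j; simp [Finset.sum_apply, Pi.single_apply]
  conv_lhs => rw [hv]
  simp [partialDeriv]

lemma integral_partialDeriv_mul {φ η : R3 → ℝ} (i : Fin 3) (hφ : ContDiff ℝ ∞ φ)
    (hη : η ∈ TestFn) :
    ∫ x, φ x * partialDeriv i η x = -∫ x, partialDeriv i φ x * η x := by
  have hη' := partialDeriv_mem i hη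
  refine integral_mul_fderiv_eq_neg_fderiv_mul_of_integrable ?_ ?_ ?_
    (fun x _ => hφ.differentiable (by simp) x) (fun x _ => hη.1.differentiable (by simp) x)
  · exact integrable_mul_test ((contDiff_partialDeriv i hφ).continuous.locallyIntegrable)
      hη.1.continuous hη.2
  · exact integrable_mul_test hφ.continuous.locallyIntegrable hη'.1.continuous hη'.2
  · exact integrable_mul_test hφ.continuous.locallyIntegrable hη.1.continuous hη.2

lemma hasWeakPartial_of_contDiff {φ : R3 → ℝ} (i : Fin 3) (hφ : ContDiff ℝ ∞ φ) :
    HasWeakPartial i φ (partialDeriv i φ) where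
  left := hφ.continuous.locallyIntegrable
  right := (contDiff_partialDeriv i hφ).continuous.locallyIntegrable
  integral_eq _ h1 h2 := integral_partialDeriv_mul i hφ ⟨h1, h2⟩

lemma partialDeriv_add {η ζ : R3 → ℝ} (i : Fin 3) (hη : ContDiff ℝ ∞ η) (hζ : ContDiff ℝ ∞ ζ) :
    partialDeriv i (η + ζ) = partialDeriv i η + partialDeriv i ζ := by
  ext x
  simp [partialDeriv, fderiv_add (hη.differentiable (by simp) x) (hζ.differentiable (by simp) x)]

lemma partialDeriv_smul {η : R3 → ℝ} (i : Fin 3) (c : ℝ) (hη : ContDiff ℝ ∞ η) :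
    partialDeriv i (c • η) = c • partialDeriv i η := by
  ext x
  simp [partialDeriv, fderiv_const_smul (hη.differentiable (by simp) x)]

/-! ### The energy space -/

/-- A test function as an element of `L⁶`. -/
def testToL6 : TestFn →ₗ[ℝ] L6 where
  toFun η := (memLp_of_mem_testFn η.2 6).toLp _
  map_add' _ _ := rfl
  map_smul' _ _ := rfl

/-- The ambient Hilbert space of vector fields in `L²`. -/
abbrev Fields : Type := PiLp 2 (fun _ : Fin 3 => L2)

/-- The gradient of a test function. -/
def testGrad : TestFn →ₗ[ℝ] Fields where
  toFun η := WithLp.toLp 2 fun i => (memLp_of_mem_testFn (partialDeriv_mem i η.2) 2).toLp _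
  map_add' η ζ := by
    ext1 i
    simp only [PiLp.add_apply, ← MemLp.toLp_add]
    congr 1
    exact partialDeriv_add i η.2.1 ζ.2.1
  map_smul' c η := by
    ext1 i
    simp only [PiLp.smul_apply, RingHom.id_apply, ← MemLp.toLp_const_smul]
    congr 1
    exact partialDeriv_smul i c η.2.1

/-- The closure of the gradients of test functions, a model of the completion of the space of test
functions in the norm `‖∇η‖_{L²}`. -/
def energySubmodule : Submodule ℝ Fields := (LinearMap.range testGrad).topologicalClosure

/-- The homogeneous Sobolev space `Ḣ¹(ℝ³)`. -/
abbrev Energy : Type := energySubmodule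

instance : CompleteSpace Energy :=
  (Submodule.isClosed_topologicalClosure (LinearMap.range testGrad)).completeSpace_coe

/-- A test function as an element of the energy space. -/
def testToEnergy : TestFn →ₗ[ℝ] Energy :=
  testGrad.codRestrict energySubmodule fun η =>
    (LinearMap.range testGrad).le_topologicalClosure ⟨η, rfl⟩

lemma denseRange_testToEnergy : DenseRange testToEnergy := by
  intro G
  have hG : (G : Fields) ∈ closure (range testGrad) := G.2
  rw [closure_subtype]
  convert hG
  ext x
  constructor
  · rintro ⟨_, ⟨η, rfl⟩, rfl⟩; exact ⟨η, rfl⟩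
  · rintro ⟨η, rfl⟩; exact ⟨_, ⟨η, rfl⟩, rfl⟩

/-- Identities between continuous functionals on the energy space are reduced by this to integration
by parts against smooth functions. -/
lemma energy_clm_ext {F : Type*} [NormedAddCommGroup F] [NormedSpace ℝ F] {f g : Energy →L[ℝ] F}
    (h : ∀ η, f (testToEnergy η) = g (testToEnergy η)) : f = g :=
  ContinuousLinearMap.ext fun H =>
    congrFun (denseRange_testToEnergy.equalizer f.continuous g.continuous (funext h)) H

/-- The component `∂ᵢ` of an element of the energy space. -/
def gradE (i : Fin 3) : Energy →L[ℝ] L2 :=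
  (PiLp.proj 2 (fun _ : Fin 3 => L2) i).comp energySubmodule.subtypeL

lemma coeFn_gradE_test (i : Fin 3) (η : TestFn) :
    gradE i (testToEnergy η) =ᵐ[volume] partialDeriv i η :=
  MemLp.coeFn_toLp (memLp_of_mem_testFn (partialDeriv_mem i η.2) 2)

lemma coeFn_testToL6 (η : TestFn) : testToL6 η =ᵐ[volume] (η : R3 → ℝ) :=
  MemLp.coeFn_toLp (memLp_of_mem_testFn η.2 6)

lemma norm_gradE_le (i : Fin 3) (G : Energy) : ‖gradE i G‖ ≤ ‖G‖ :=
  PiLp.norm_apply_le (G : Fields) i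

lemma inner_energy (G H : Energy) : inner ℝ G H = ∑ i, inner ℝ (gradE i G) (gradE i H) :=
  PiLp.inner_apply (G : Fields) (H : Fields)

lemma norm_sq_energy (G : Energy) : ‖G‖ ^ 2 = ∑ i, ‖gradE i G‖ ^ 2 :=
  PiLp.norm_sq_eq_of_L2 _ (G : Fields)

lemma energy_ext {G H : Energy} (h : ∀ i, gradE i G = gradE i H) : G = H := by
  apply Subtype.ext
  ext1 i
  exact h i

/-- This is the Gagliardo–Nirenberg–Sobolev inequality in dimension three with exponents `2` and
`6`. The factor `3` comes from bounding the operator norm of the derivative by the sum of the three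
partial derivatives. -/
lemma exists_sobolev : ∃ C : ℝ, ∀ η : TestFn, ‖testToL6 η‖ ≤ C * ‖testToEnergy η‖ := by
  let K := SNormLESNormFDerivOfEqConst ℝ (volume : Measure R3) (2 : NNReal)
  refine ⟨K * 3, fun η => ?_⟩
  have h1 : eLpNorm (η : R3 → ℝ) 6 volume ≤ K * eLpNorm (fderiv ℝ (η : R3 → ℝ)) 2 volume := by
    have := eLpNorm_le_eLpNorm_fderiv_of_eq (volume : Measure R3) (u := (η : R3 → ℝ))
      (η.2.1.of_le (by exact_mod_cast le_top)) η.2.2 (p := 2) (p' := 6) (by norm_num)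
      (by simp) (by simp; norm_num)
    exact_mod_cast this
  have hp : ∀ i, MemLp (partialDeriv i η) 2 volume := fun i =>
    memLp_of_mem_testFn (partialDeriv_mem i η.2) 2
  have h2 : eLpNorm (fderiv ℝ (η : R3 → ℝ)) 2 volume ≤ ∑ i, eLpNorm (partialDeriv i η) 2 volume := by
    calc eLpNorm (fderiv ℝ (η : R3 → ℝ)) 2 volume
        ≤ eLpNorm (∑ i, fun x => ‖partialDeriv i η x‖) 2 volume := by
          refine eLpNorm_mono fun x => ?_
          have hnn : 0 ≤ ∑ i, ‖partialDeriv i η x‖ := Finset.sum_nonneg fun i _ => norm_nonneg _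
          rw [Finset.sum_apply, Real.norm_of_nonneg hnn]
          refine ContinuousLinearMap.opNorm_le_bound _ hnn fun v => ?_
          rw [fderiv_eq_sum_partialDeriv, Finset.sum_mul]
          refine (norm_sum_le _ _).trans (Finset.sum_le_sum fun i _ => ?_)
          rw [norm_mul, mul_comm]
          gcongr
          exact PiLp.norm_apply_le v i
      _ ≤ ∑ i, eLpNorm (fun x => ‖partialDeriv i η x‖) 2 volume :=
          eLpNorm_sum_le (fun i _ => (hp i).1.norm) (by norm_num)
      _ = _ := by simp only [eLpNorm_norm]
  have h3 : ∀ i, eLpNorm (partialDeriv i η) 2 volume ≤ ENNReal.ofReal ‖testToEnergy η‖ := by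
    intro i
    rw [← eLpNorm_congr_ae (coeFn_gradE_test i η),
      ← ENNReal.ofReal_toReal (Lp.memLp (gradE i (testToEnergy η))).2.ne]
    exact ENNReal.ofReal_le_ofReal (norm_gradE_le i _)
  have h4 : eLpNorm (η : R3 → ℝ) 6 volume ≤ ENNReal.ofReal (K * 3 * ‖testToEnergy η‖) := by
    refine h1.trans ?_
    rw [mul_assoc, ENNReal.ofReal_mul (by positivity), ENNReal.ofReal_coe_nnreal]
    gcongr
    refine h2.trans ((Finset.sum_le_sum fun i _ => h3 i).trans ?_)
    rw [ENNReal.ofReal_mul (by positivity)]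
    simp
  rw [Lp.norm_def, eLpNorm_congr_ae (coeFn_testToL6 η)]
  exact ENNReal.toReal_le_of_le_ofReal
    (mul_nonneg (by positivity) (norm_nonneg _)) h4

/-- The Sobolev embedding `Ḣ¹ ⊆ L⁶`. -/
def embL6 : Energy →L[ℝ] L6 := testToL6.extendOfNorm testToEnergy

lemma embL6_test (η : TestFn) : embL6 (testToEnergy η) = testToL6 η :=
  LinearMap.extendOfNorm_eq denseRange_testToEnergy exists_sobolev η

attribute [irreducible] embL6

lemma memLp_embL6 (G : Energy) : MemLp (embL6 G) 6 volume := Lp.memLp _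

lemma memLp_gradE (i : Fin 3) (G : Energy) : MemLp (gradE i G) 2 volume := Lp.memLp _

lemma coeFn_embL6_test (η : TestFn) : embL6 (testToEnergy η) =ᵐ[volume] (η : R3 → ℝ) := by
  rw [embL6_test]; exact coeFn_testToL6 η

/-- Integration of `L^q` functions against a fixed `L^p` function, for conjugate exponents. -/
def integralCLM (p q : ℝ≥0∞) [Fact (1 ≤ q)] [ENNReal.HolderTriple p q 1] {f : R3 → ℝ}
    (hf : MemLp f p volume) : Lp ℝ q (volume : Measure R3) →L[ℝ] ℝ :=
  LinearMap.mkContinuous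
    { toFun := fun u => ∫ x, f x * u x
      map_add' := fun u v => by
        rw [← integral_add (integrable_mul_of_memLp p q hf (Lp.memLp u))
          (integrable_mul_of_memLp p q hf (Lp.memLp v))]
        refine integral_congr_ae ?_
        filter_upwards [Lp.coeFn_add u v] with x hx
        rw [hx, Pi.add_apply, mul_add]
      map_smul' := fun c u => by
        rw [RingHom.id_apply, smul_eq_mul, ← integral_const_mul]
        refine integral_congr_ae ?_
        filter_upwards [Lp.coeFn_smul c u] with x hx
        rw [hx, Pi.smul_apply, smul_eq_mul]
        ring }
    (eLpNorm f p volume).toReal fun u => abs_integral_mul_le p q hf (Lp.memLp u)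

@[simp]
lemma integralCLM_apply (p q : ℝ≥0∞) [Fact (1 ≤ q)] [ENNReal.HolderTriple p q 1] {f : R3 → ℝ}
    (hf : MemLp f p volume) (u : Lp ℝ q (volume : Measure R3)) :
    integralCLM p q hf u = ∫ x, f x * u x := rfl

lemma inner_L2_eq_integral (f g : L2) : inner ℝ f g = ∫ x, f x * g x := by
  rw [MeasureTheory.L2.inner_def]
  exact integral_congr_ae (.of_forall fun x => by simp [mul_comm])

lemma inner_energy_eq_integral (G H : Energy) :
    inner ℝ G H = ∑ i, ∫ x, gradE i G x * gradE i H x := by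
  simp only [inner_energy, inner_L2_eq_integral]

/-- For fixed `η` both sides of the defining identity are continuous in `G`, so classical
integration by parts on the dense set of test functions suffices. -/
lemma hasWeakPartial_embL6 (i : Fin 3) (G : Energy) :
    HasWeakPartial i (embL6 G) (gradE i G) where
  left := (memLp_embL6 G).locallyIntegrable (by norm_num)
  right := (memLp_gradE i G).locallyIntegrable (by norm_num)
  integral_eq η h1 h2 := by
    have hη : η ∈ TestFn := ⟨h1, h2⟩
    have m1 := memLp_of_mem_testFn (partialDeriv_mem i hη) (6 / 5)
    have m2 := memLp_of_mem_testFn hη 2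
    have key : ((integralCLM (6 / 5) 6 m1).comp embL6) = -((integralCLM 2 2 m2).comp (gradE i)) := by
      refine energy_clm_ext fun ζ => ?_
      have e1 : ∫ x, partialDeriv i η x * embL6 (testToEnergy ζ) x =
          ∫ x, (ζ : R3 → ℝ) x * partialDeriv i η x :=
        integral_congr_ae ((coeFn_embL6_test ζ).mono fun x hx => by simp only [hx, mul_comm])
      have e2 : ∫ x, η x * gradE i (testToEnergy ζ) x =
          ∫ x, partialDeriv i (ζ : R3 → ℝ) x * η x :=
        integral_congr_ae ((coeFn_gradE_test i ζ).mono fun x hx => by simp only [hx, mul_comm])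
      change ∫ x, partialDeriv i η x * embL6 (testToEnergy ζ) x =
        -∫ x, η x * gradE i (testToEnergy ζ) x
      rw [e1, e2]
      exact integral_partialDeriv_mul i ζ.2.1 hη
    have := congrArg (fun L => L G) key
    simpa [mul_comm] using this

/-! ### Correlations with test functions -/

/-- The correlation `x ↦ ∫ w(t) ρ(t + x) dt`. -/
def correl (w ρ : R3 → ℝ) (x : R3) : ℝ := ∫ t, w t * ρ (t + x)

lemma correl_zero (w ρ : R3 → ℝ) : correl w ρ 0 = ∫ t, w t * ρ t := by simp [correl]

lemma locallyIntegrable_comp_neg {w : R3 → ℝ} (hw : LocallyIntegrable w volume) :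
    LocallyIntegrable (fun t => w (-t)) volume := by
  rw [locallyIntegrable_iff] at hw ⊢
  intro K hK
  have h := hw (-K) hK.neg
  have := (Measure.measurePreserving_neg (volume : Measure R3)).integrableOn_comp_preimage
    (Homeomorph.neg R3).measurableEmbedding (f := w) (s := -K)
  simpa [Function.comp_def] using this.2 h

/-- Reflecting `w` turns the correlation into a convolution, from which continuity and
differentiability are inherited. -/
lemma correl_eq_convolution (w ρ : R3 → ℝ) :
    correl w ρ = MeasureTheory.convolution (fun t => w (-t)) ρ (ContinuousLinearMap.mul ℝ ℝ) volume := by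
  ext x
  rw [MeasureTheory.convolution_mul, correl,
    ← integral_neg_eq_self (fun t => w t * ρ (t + x)) volume]
  refine integral_congr_ae (.of_forall fun t => ?_)
  simp only [neg_add_eq_sub]

lemma continuous_correl {w ρ : R3 → ℝ} (hw : LocallyIntegrable w volume) (hρ : ρ ∈ TestFn) :
    Continuous (correl w ρ) := by
  rw [correl_eq_convolution]
  exact hρ.2.continuous_convolution_right _ (locallyIntegrable_comp_neg hw) hρ.1.continuous

lemma translate_mem_testFn {ρ : R3 → ℝ} (hρ : ρ ∈ TestFn) (x : R3) :
    (fun t => ρ (t + x)) ∈ TestFn :=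
  ⟨hρ.1.comp (contDiff_id.add contDiff_const), hρ.2.comp_homeomorph (Homeomorph.addRight x)⟩

lemma partialDeriv_translate (i : Fin 3) (ρ : R3 → ℝ) (x : R3) :
    partialDeriv i (fun t => ρ (t + x)) = fun t => partialDeriv i ρ (t + x) := by
  ext t
  simp only [partialDeriv]
  rw [fderiv_comp_add_right]

lemma exists_hasFDerivAt_correl {w ρ : R3 → ℝ} (hw : LocallyIntegrable w volume)
    (hρ : ρ ∈ TestFn) (x : R3) :
    ∃ L : R3 →L[ℝ] ℝ, HasFDerivAt (correl w ρ) L x ∧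
      ∀ v, L v = ∑ i, v i * correl w (partialDeriv i ρ) x := by
  have h := hρ.2.hasFDerivAt_convolution_right (ContinuousLinearMap.mul ℝ ℝ)
    (locallyIntegrable_comp_neg hw) (hρ.1.of_le (by exact_mod_cast le_top)) x
  rw [← correl_eq_convolution] at h
  refine ⟨_, h, fun v => ?_⟩
  have hint : ∀ i, Integrable (fun t => w t * partialDeriv i ρ (t + x)) volume := fun i =>
    have hi := translate_mem_testFn (partialDeriv_mem i hρ) x
    integrable_mul_test hw hi.1.continuous hi.2
  rw [MeasureTheory.convolution_precompR_apply _ (locallyIntegrable_comp_neg hw) (hρ.2.fderiv ℝ)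
    (hρ.1.continuous_fderiv (by simp)), MeasureTheory.convolution_mul,
    ← integral_neg_eq_self]
  simp only [neg_neg, sub_neg_eq_add, fderiv_eq_sum_partialDeriv, Finset.mul_sum, correl]
  rw [integral_finsetSum]
  · refine Finset.sum_congr rfl fun i _ => ?_
    rw [← integral_const_mul]
    refine integral_congr_ae (.of_forall fun t => ?_)
    simp only [add_comm x t]
    ring
  · intro i _
    refine ((hint i).const_mul (v i)).congr (.of_forall fun t => ?_)
    simp only [add_comm x t]
    ring

lemma hasDerivAt_correl {w ρ : R3 → ℝ} (hw : LocallyIntegrable w volume)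
    (hρ : ρ ∈ TestFn) (x : R3) (i : Fin 3) (s : ℝ) :
    HasDerivAt (fun s : ℝ => correl w ρ (x + s • EuclideanSpace.single i 1))
      (correl w (partialDeriv i ρ) (x + s • EuclideanSpace.single i 1)) s := by
  obtain ⟨L, hL, hL'⟩ := exists_hasFDerivAt_correl hw hρ (x + s • EuclideanSpace.single i 1)
  have h1 : HasDerivAt (fun s : ℝ => x + s • (EuclideanSpace.single i 1 : R3))
      (EuclideanSpace.single i 1) s := by
    simpa using ((hasDerivAt_id s).smul_const (EuclideanSpace.single i 1 : R3)).const_add x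
  have := hL.comp_hasDerivAt s h1
  rw [hL'] at this
  refine this.congr_deriv ?_
  simp

lemma abs_correl_le (p q : ℝ≥0∞) [ENNReal.HolderTriple p q 1] {w ρ : R3 → ℝ}
    (hw : MemLp w p volume) (hρ : MemLp ρ q volume) (x : R3) :
    |correl w ρ x| ≤ (eLpNorm w p volume).toReal * (eLpNorm ρ q volume).toReal := by
  have hmp := measurePreserving_add_right (volume : Measure R3) x
  have := abs_integral_mul_le p q hw (hρ.comp_measurePreserving hmp)
  rwa [eLpNorm_comp_measurePreserving hρ.1 hmp] at this

/-- Approximate `w` in `L⁶` by a compactly supported `g`. The correlation of `g` with `ρ` has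
bounded support, and the error is uniformly small by Hölder. This decay is what excludes nonzero
constants in Liouville's theorem. -/
lemma tendsto_correl_cocompact {w ρ : R3 → ℝ} (hw : MemLp w 6 volume) (hρ : ρ ∈ TestFn) :
    Filter.Tendsto (correl w ρ) (Filter.cocompact R3) (nhds 0) := by
  have hρp := memLp_of_mem_testFn hρ (6 / 5)
  have : ENNReal.HolderTriple 6 (6 / 5) 1 := ENNReal.HolderTriple.symm
  set A := (eLpNorm ρ (6 / 5) volume).toReal
  rw [Metric.tendsto_nhds]
  intro ε hε
  obtain ⟨g, hg, hgn, hgc, hgp⟩ := hw.exists_hasCompactSupport_eLpNorm_sub_le (by norm_num)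
    (ε := ENNReal.ofReal (ε / (A + 1))) (by
      have : 0 < ε / (A + 1) := div_pos hε (by positivity)
      simpa using this)
  obtain ⟨r, hr⟩ := hg.isBounded.exists_norm_le
  obtain ⟨r', hr'⟩ := hρ.2.isBounded.exists_norm_le
  have hev : ∀ᶠ x in Filter.cocompact R3, r + r' < ‖x‖ :=
    (tendsto_norm_cocompact_atTop (E := R3)).eventually_gt_atTop _
  filter_upwards [hev] with x hx
  have h0 : correl g ρ x = 0 := by
    rw [correl, ← integral_zero R3 ℝ (μ := volume)]
    refine integral_congr_ae (.of_forall fun t => ?_)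
    by_contra hne
    simp only [mul_eq_zero, not_or] at hne
    have h1 := hr t (subset_tsupport _ hne.1)
    have h2 := hr' (t + x) (subset_tsupport _ hne.2)
    have : ‖x‖ ≤ ‖t + x‖ + ‖t‖ := by simpa using norm_sub_le (t + x) t
    linarith
  have hsub : correl w ρ x = correl (w - g) ρ x := by
    have hi := translate_mem_testFn hρ x
    rw [← sub_zero (correl w ρ x), ← h0]
    simp only [correl, Pi.sub_apply, sub_mul]
    rw [integral_sub (integrable_mul_test (hw.locallyIntegrable (by norm_num)) hi.1.continuous hi.2)
      (integrable_mul_test hgc.locallyIntegrable hi.1.continuous hi.2)]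
  have h2 := abs_correl_le 6 (6 / 5) (hw.sub hgp) hρp x
  have h3 : (eLpNorm (w - g) 6 volume).toReal ≤ ε / (A + 1) :=
    ENNReal.toReal_le_of_le_ofReal (by positivity) hgn
  rw [Real.dist_eq, sub_zero, hsub]
  calc _ ≤ ε / (A + 1) * A := h2.trans (by gcongr)
    _ < ε := by
      rw [div_mul_eq_mul_div, div_lt_iff₀ (by positivity)]
      nlinarith

/-! ### The maximum principle and Liouville's theorem -/

/-- If `c > 0`, the second derivative test makes `a` a local minimum as well. Then `φ` is locally
constant, which forces `c = 0`. -/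
lemma nonpos_of_isLocalMax_of_hasDerivAt {φ φ' : ℝ → ℝ} {c a : ℝ} (hmax : IsLocalMax φ a)
    (h1 : ∀ s, HasDerivAt φ (φ' s) s) (h2 : HasDerivAt φ' c a) : c ≤ 0 := by
  by_contra! hc
  have e1 : deriv φ = φ' := funext fun s => (h1 s).deriv
  have hmin : IsLocalMin φ a := by
    refine isLocalMin_of_deriv_deriv_pos ?_ ?_ (h1 a).continuousAt
    · rwa [e1, h2.deriv]
    · exact hmax.deriv_eq_zero
  have hconst : φ =ᶠ[nhds a] fun _ => φ a := by
    filter_upwards [hmax, hmin] with s hs hs'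
    exact le_antisymm hs hs'
  have e2 : φ' =ᶠ[nhds a] fun _ => 0 := by
    rw [← e1]
    refine hconst.deriv.trans (.of_forall fun s => ?_)
    simp
  have := e2.deriv_eq
  rw [h2.deriv, deriv_const] at this
  exact hc.ne' this

/-- The maximum principle for harmonic functions which vanish at infinity. -/
lemma nonpos_of_harmonic_of_tendsto {W : R3 → ℝ} {W' W'' : Fin 3 → R3 → ℝ} (hc : Continuous W)
    (h1 : ∀ i x (s : ℝ), HasDerivAt (fun s : ℝ => W (x + s • EuclideanSpace.single i 1))
      (W' i (x + s • EuclideanSpace.single i 1)) s)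
    (h2 : ∀ i x (s : ℝ), HasDerivAt (fun s : ℝ => W' i (x + s • EuclideanSpace.single i 1))
      (W'' i (x + s • EuclideanSpace.single i 1)) s)
    (h3 : ∀ x, ∑ i, W'' i x = 0) (h4 : Filter.Tendsto W (Filter.cocompact R3) (nhds 0)) (x₀ : R3) :
    W x₀ ≤ 0 := by
  by_contra! hpos
  have hev : ∀ᶠ x in Filter.cocompact R3, W x < W x₀ / 2 :=
    h4.eventually_lt_const (by positivity)
  obtain ⟨R, hR⟩ : ∃ R : ℝ, ∀ x, R < ‖x‖ → W x < W x₀ / 2 := by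
    rw [← Metric.cobounded_eq_cocompact, ← comap_norm_atTop] at hev
    obtain ⟨s, hs, hs'⟩ := Filter.eventually_comap.1 hev |>.exists_mem
    obtain ⟨R, hR⟩ := Filter.mem_atTop_sets.1 hs
    exact ⟨R, fun x hx => hs' _ (hR _ hx.le) x rfl⟩
  set r := |R| + ‖x₀‖ + 1
  have hr : 0 < r := by positivity
  -- Adding `δ‖x - x₀‖²` makes the Laplacian strictly positive. The sphere of radius `r` about `x₀`
  -- lies where `W < W x₀ / 2`, and `δ r² = W x₀ / 2`, so the perturbed function stays below its
  -- central value there and its maximum is interior.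
  set δ := W x₀ / (2 * r ^ 2)
  have hδ : 0 < δ := by positivity
  let f : R3 → ℝ := fun x => W x + δ * ‖x - x₀‖ ^ 2
  have hf : Continuous f := by fun_prop
  obtain ⟨x₁, hx₁, hmax⟩ := (isCompact_closedBall x₀ r).exists_isMaxOn
    ⟨x₀, Metric.mem_closedBall_self hr.le⟩ hf.continuousOn
  have hx₁' : ‖x₁ - x₀‖ < r := by
    rw [Metric.mem_closedBall, dist_eq_norm] at hx₁
    refine lt_of_le_of_ne hx₁ fun heq => ?_
    have a1 : f x₀ ≤ f x₁ := hmax (Metric.mem_closedBall_self hr.le)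
    have a2 : R < ‖x₁‖ := by
      have : ‖x₁ - x₀‖ ≤ ‖x₁‖ + ‖x₀‖ := norm_sub_le _ _
      have := le_abs_self R
      simp only [r] at heq
      linarith
    have a3 := hR x₁ a2
    have a4 : δ * r ^ 2 = W x₀ / 2 := by simp only [δ]; field_simp
    simp only [f, heq, sub_self, norm_zero] at a1
    linarith
  have hloc : IsLocalMax f x₁ := hmax.isLocalMax
    (Metric.closedBall_mem_nhds_of_mem (by rwa [Metric.mem_ball, dist_eq_norm]))
  -- The second derivative test along each axis; summing over the axes gives `6δ ≤ 0` because the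
  -- Laplacian of `W` vanishes.
  have hi : ∀ i, W'' i x₁ + 2 * δ ≤ 0 := by
    intro i
    set e : R3 := EuclideanSpace.single i 1
    have hnorm : ∀ s : ℝ, ‖x₁ + s • e - x₀‖ ^ 2 = ‖x₁ - x₀‖ ^ 2 + 2 * s * (x₁ - x₀) i + s ^ 2 := by
      intro s
      have : x₁ + s • e - x₀ = (x₁ - x₀) + s • e := by abel
      rw [this, norm_add_sq_real, inner_smul_right, norm_smul]
      simp [e, EuclideanSpace.inner_single_right]
      ring
    have hm : IsLocalMax (fun s : ℝ => f (x₁ + s • e)) 0 := by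
      have hct : ContinuousAt (fun s : ℝ => x₁ + s • e) 0 := by fun_prop
      have h0 : x₁ + (0 : ℝ) • e = x₁ := by simp
      rw [← h0] at hloc
      exact IsMaxFilter.comp_tendsto (g := fun s : ℝ => x₁ + s • e) hloc hct
    refine nonpos_of_isLocalMax_of_hasDerivAt hm
      (φ' := fun s => W' i (x₁ + s • e) + δ * (2 * (x₁ - x₀) i + 2 * s)) (fun s => ?_) ?_
    · simp only [f, hnorm]
      refine (h1 i x₁ s).add (HasDerivAt.const_mul δ ?_)
      have a := ((hasDerivAt_id s).const_mul 2).mul_const ((x₁ - x₀) i)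
      have b := (hasDerivAt_id s).pow 2
      have := (a.const_add (‖x₁ - x₀‖ ^ 2)).add b
      refine this.congr_deriv ?_
      simp
    · have a := h2 i x₁ 0
      simp only [zero_smul, add_zero] at a
      refine a.add ?_
      have b := (((hasDerivAt_id (0 : ℝ)).const_mul 2).const_add (2 * (x₁ - x₀) i)).const_mul δ
      refine b.congr_deriv ?_
      ring
  have := Finset.sum_le_sum fun i (_ : i ∈ Finset.univ) => hi i
  rw [Finset.sum_add_distrib, h3] at this
  simp at this
  linarith

/-- Liouville's theorem in `L⁶`. -/
lemma ae_eq_zero_of_harmonic {w : R3 → ℝ} (hw : MemLp w 6 volume)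
    (h : ∀ η ∈ TestFn, ∫ x, w x * ∑ i, partialDeriv i (partialDeriv i η) x = 0) :
    w =ᵐ[volume] 0 := by
  have hwl := hw.locallyIntegrable (by norm_num)
  -- Correlating with `ρ` produces a classical harmonic function tending to zero at infinity. The
  -- maximum principle bounds its value at the origin, which is `∫ w ρ`; using it for `w` and `-w`
  -- gives equality with zero.
  have key : ∀ w : R3 → ℝ, MemLp w 6 volume →
      (∀ η ∈ TestFn, ∫ x, w x * ∑ i, partialDeriv i (partialDeriv i η) x = 0) →
      ∀ ρ ∈ TestFn, ∫ x, w x * ρ x ≤ 0 := by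
    intro w hw h ρ hρ
    have hwl := hw.locallyIntegrable (by norm_num)
    rw [← correl_zero]
    refine nonpos_of_harmonic_of_tendsto (W' := fun i => correl w (partialDeriv i ρ))
      (W'' := fun i => correl w (partialDeriv i (partialDeriv i ρ))) (continuous_correl hwl hρ)
      (fun i x s => hasDerivAt_correl hwl hρ x i s)
      (fun i x s => hasDerivAt_correl hwl (partialDeriv_mem i hρ) x i s)
      (fun x => ?_) (tendsto_correl_cocompact hw hρ) 0
    rw [← h _ (translate_mem_testFn hρ x)]
    simp only [correl, partialDeriv_translate, Finset.mul_sum]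
    rw [integral_finsetSum]
    intro i _
    have hi := translate_mem_testFn (partialDeriv_mem i (partialDeriv_mem i hρ)) x
    exact integrable_mul_test hwl hi.1.continuous hi.2
  refine ae_eq_zero_of_integral_contDiff_smul_eq_zero hwl fun ρ h1 h2 => ?_
  have hρ : ρ ∈ TestFn := ⟨h1, h2⟩
  simp only [smul_eq_mul, mul_comm (ρ _)]
  refine le_antisymm (key w hw h ρ hρ) ?_
  have := key (-w) hw.neg (fun η hη => by
    simp only [Pi.neg_apply, neg_mul, integral_neg, h η hη, neg_zero]) ρ hρ
  simp only [Pi.neg_apply, neg_mul, integral_neg] at this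
  linarith

/-! ### Characterization of the energy space -/

/-- A function in `L⁶` with weak partial derivatives in `L²` belongs to the energy space. -/
lemma exists_energy_of_hasWeakPartial {u : R3 → ℝ} {g : Fin 3 → R3 → ℝ} (hu : MemLp u 6 volume)
    (hg : ∀ i, MemLp (g i) 2 volume) (hug : ∀ i, HasWeakPartial i u (g i)) :
    ∃ G : Energy, embL6 G =ᵐ[volume] u ∧ ∀ i, gradE i G =ᵐ[volume] g i := by
  let g' : Fields := WithLp.toLp 2 fun i => (hg i).toLp _
  -- Project the weak gradient onto the closure of the gradients of test functions. The residual is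
  -- orthogonal to all such gradients, so `u - embL6 G` is weakly harmonic and in `L⁶`, hence zero
  -- by Liouville.
  let G : Energy := energySubmodule.orthogonalProjectionOnto g'
  have horth : ∀ H : Energy, inner ℝ (g' - (G : Fields)) (H : Fields) = 0 := fun H =>
    energySubmodule.starProjection_inner_eq_zero g' H H.2
  have hg' : ∀ i, g' i =ᵐ[volume] g i := fun i => MemLp.coeFn_toLp (hg i)
  have hw : (fun x => u x - embL6 G x) =ᵐ[volume] 0 := by
    refine ae_eq_zero_of_harmonic (hu.sub (memLp_embL6 G)) fun η hη => ?_
    have hpp := fun i => partialDeriv_mem i (partialDeriv_mem i hη)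
    have hwp : ∀ i, HasWeakPartial i (u + (-1 : ℝ) • (embL6 G : R3 → ℝ))
        (g i + (-1 : ℝ) • (gradE i G : R3 → ℝ)) := fun i =>
      (hug i).add ((hasWeakPartial_embL6 i G).const_smul (-1))
    have hwl := (hwp 0).left
    have e1 : ∫ x, (u x - embL6 G x) * ∑ i, partialDeriv i (partialDeriv i η) x =
        ∑ i, ∫ x, (u + (-1 : ℝ) • (embL6 G : R3 → ℝ)) x * partialDeriv i (partialDeriv i η) x := by
      rw [← integral_finsetSum _ fun i _ => integrable_mul_test hwl (hpp i).1.continuous (hpp i).2]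
      refine integral_congr_ae (.of_forall fun x => ?_)
      simp only [Finset.mul_sum, Pi.add_apply, Pi.smul_apply, smul_eq_mul]
      refine Finset.sum_congr rfl fun i _ => by ring
    rw [e1]
    have e2 := horth (testToEnergy ⟨η, hη⟩)
    rw [PiLp.inner_apply] at e2
    rw [← neg_eq_zero, ← Finset.sum_neg_distrib, ← e2]
    refine Finset.sum_congr rfl fun i _ => ?_
    rw [(hwp i).integral_eq _ (partialDeriv_mem i hη).1 (partialDeriv_mem i hη).2, neg_neg,
      inner_L2_eq_integral]
    refine integral_congr_ae ?_
    have e3 : ((g' - (G : Fields)) i : L2) = g' i - gradE i G := rfl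
    rw [e3]
    filter_upwards [Lp.coeFn_sub (g' i) (gradE i G), hg' i, coeFn_gradE_test i ⟨η, hη⟩]
      with x h1 h2 h3
    have h3' : (((testToEnergy ⟨η, hη⟩ : Energy) : Fields) i : L2) x = partialDeriv i η x := h3
    rw [h1, h3', Pi.sub_apply, h2]
    simp only [Pi.add_apply, Pi.smul_apply, smul_eq_mul]
    ring
  have hw' : embL6 G =ᵐ[volume] u := by
    filter_upwards [hw] with x hx
    simp only [Pi.zero_apply] at hx
    linarith
  exact ⟨G, hw', fun i => ((hasWeakPartial_embL6 i G).congr hw' .rfl).unique (hug i)⟩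

/-- By uniqueness of weak derivatives the function determines its gradient, so the Sobolev embedding
is injective. -/
lemma energy_eq_of_embL6_ae_eq {G H : Energy}
    (h : (embL6 G : R3 → ℝ) =ᵐ[volume] (embL6 H : R3 → ℝ)) : G = H :=
  energy_ext fun i => Lp.ext
    (((hasWeakPartial_embL6 i G).congr h .rfl).unique (hasWeakPartial_embL6 i H))

/-! ### Translations -/

lemma memLp_translate {p : ℝ≥0∞} {f : R3 → ℝ} (hf : MemLp f p volume) (h : R3) :
    MemLp (fun x => f (x + h)) p volume :=
  hf.comp_measurePreserving (measurePreserving_add_right volume h)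

lemma eLpNorm_translate {p : ℝ≥0∞} {f : R3 → ℝ} (hf : AEStronglyMeasurable f volume) (h : R3) :
    eLpNorm (fun x => f (x + h)) p volume = eLpNorm f p volume :=
  eLpNorm_comp_measurePreserving hf (measurePreserving_add_right volume h)

lemma ae_eq_translate {f g : R3 → ℝ} (hfg : f =ᵐ[volume] g) (h : R3) :
    (fun x => f (x + h)) =ᵐ[volume] fun x => g (x + h) :=
  (measurePreserving_add_right volume h).quasiMeasurePreserving.ae_eq_comp hfg

lemma correl_neg_right (f g : R3 → ℝ) (h : R3) : correl f g (-h) = correl g f h := by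
  rw [correl, ← integral_add_right_eq_self _ h, correl]
  simp [mul_comm]

lemma correl_congr {f g g' : R3 → ℝ} (hg : g =ᵐ[volume] g') (h : R3) :
    correl f g h = correl f g' h :=
  integral_congr_ae ((ae_eq_translate hg h).mono fun x hx => by simp only at hx; simp only [hx])

lemma correl_sub_correl_zero (p q : ℝ≥0∞) [ENNReal.HolderTriple p q 1] {f g : R3 → ℝ}
    (hf : MemLp f p volume) (hg : MemLp g q volume) (h : R3) :
    correl f g h - correl f g 0 = ∫ x, f x * (g (x + h) - g x) := by
  rw [correl_zero, correl, ← integral_sub (integrable_mul_of_memLp p q hf (memLp_translate hg h))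
    (integrable_mul_of_memLp p q hf hg)]
  simp only [mul_sub]

lemma HasWeakPartial.translate {i : Fin 3} {u g : R3 → ℝ} {p : ℝ≥0∞} (hp : 1 ≤ p)
    (hu : MemLp u p volume) {q : ℝ≥0∞} (hq : 1 ≤ q) (hg : MemLp g q volume)
    (h : HasWeakPartial i u g) (v : R3) :
    HasWeakPartial i (fun x => u (x + v)) (fun x => g (x + v)) where
  left := (memLp_translate hu v).locallyIntegrable hp
  right := (memLp_translate hg v).locallyIntegrable hq
  integral_eq η h1 h2 := by
    have hη := translate_mem_testFn (ρ := η) ⟨h1, h2⟩ (-v)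
    have := h.integral_eq _ hη.1 hη.2
    rw [partialDeriv_translate] at this
    rw [← integral_add_right_eq_self _ v,
      ← integral_add_right_eq_self (fun x => g x * η (x + -v)) v] at this
    simpa using this

lemma exists_shift (v : R3) (G : Energy) : ∃ H : Energy,
    embL6 H =ᵐ[volume] (fun x => embL6 G (x + v)) ∧
      ∀ i, gradE i H =ᵐ[volume] fun x => gradE i G (x + v) :=
  exists_energy_of_hasWeakPartial (memLp_translate (memLp_embL6 G) v)
    (fun i => memLp_translate (memLp_gradE i G) v)
    fun i => (hasWeakPartial_embL6 i G).translate (by norm_num) (memLp_embL6 G) (by norm_num)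
      (memLp_gradE i G) v

/-- Translation of an element of the energy space. -/
def shiftE (v : R3) (G : Energy) : Energy := (exists_shift v G).choose

lemma embL6_shiftE (v : R3) (G : Energy) :
    embL6 (shiftE v G) =ᵐ[volume] (fun x => embL6 G (x + v)) := (exists_shift v G).choose_spec.1

lemma gradE_shiftE (i : Fin 3) (v : R3) (G : Energy) :
    gradE i (shiftE v G) =ᵐ[volume] (fun x => gradE i G (x + v)) :=
  (exists_shift v G).choose_spec.2 i

lemma inner_shiftE (v : R3) (G H : Energy) :
    inner ℝ (shiftE v G) H = inner ℝ G (shiftE (-v) H) := by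
  simp only [inner_energy_eq_integral]
  refine Finset.sum_congr rfl fun i _ => ?_
  rw [integral_congr_ae (g := fun x => gradE i H x * gradE i G (x + v)),
    integral_congr_ae (f := fun x => gradE i G x * gradE i (shiftE (-v) H) x)
      (g := fun x => gradE i G x * gradE i H (x + -v))]
  · exact (correl_neg_right (gradE i G) (gradE i H) v).symm
  · filter_upwards [gradE_shiftE i (-v) H] with x hx
    rw [hx]
  · filter_upwards [gradE_shiftE i v G] with x hx
    rw [hx, mul_comm]

/-- Mean value inequality: the gradient of the correlation has components `correl g (partialDeriv i
η)`, each controlled by Cauchy–Schwarz. The `3` counts the components. -/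
lemma abs_correl_test_sub_le {g : R3 → ℝ} (hg : MemLp g 2 volume) (η : TestFn) (h : R3) :
    |correl g η h - correl g η 0| ≤ 3 * (eLpNorm g 2 volume).toReal * ‖testToEnergy η‖ * ‖h‖ := by
  choose L hL hL' using
    exists_hasFDerivAt_correl (hg.locallyIntegrable (by norm_num)) η.2
  have hbound : ∀ x, ‖L x‖ ≤ 3 * (eLpNorm g 2 volume).toReal * ‖testToEnergy η‖ := by
    intro x
    refine ContinuousLinearMap.opNorm_le_bound _ (by positivity) fun v => ?_
    rw [hL']
    have h1 : ∀ i, ‖v i * correl g (partialDeriv i η) x‖ ≤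
        (eLpNorm g 2 volume).toReal * ‖testToEnergy η‖ * ‖v‖ := by
      intro i
      rw [norm_mul, mul_comm]
      have a := abs_correl_le 2 2 hg (memLp_of_mem_testFn (partialDeriv_mem i η.2) 2) x
      rw [← eLpNorm_congr_ae (coeFn_gradE_test i η)] at a
      have b := norm_gradE_le i (testToEnergy η)
      rw [Lp.norm_def] at b
      have c := PiLp.norm_apply_le v i
      rw [Real.norm_eq_abs]
      gcongr
      exact a.trans (by gcongr)
    refine (norm_sum_le _ _).trans ((Finset.sum_le_sum fun i _ => h1 i).trans ?_)
    simp
    linarith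
  have := convex_univ.norm_image_sub_le_of_norm_hasFDerivWithin_le
    (f := correl g (η : R3 → ℝ)) (f' := L) (x := 0) (y := h)
    (fun x _ => (hL x).hasFDerivWithinAt) (fun x _ => hbound x) (mem_univ _) (mem_univ _)
  simpa using this

/-- Density extends the bound from test functions. Membership of `g` in `L^{6/5}` only serves to
make the pairing with `L⁶` continuous; the constant involves the `L²` norm alone. -/
lemma abs_correl_sub_le {g : R3 → ℝ} (hg : MemLp g 2 volume) (hg' : MemLp g (6 / 5) volume)
    (G : Energy) (h : R3) :
    |correl g (embL6 G) h - correl g (embL6 G) 0| ≤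
      3 * (eLpNorm g 2 volume).toReal * ‖G‖ * ‖h‖ := by
  let S : L6 →L[ℝ] L6 := (Lp.compMeasurePreservingₗᵢ ℝ (fun x => x + h)
    (measurePreserving_add_right (volume : Measure R3) h)).toContinuousLinearMap
  have hS : ∀ u : L6, S u =ᵐ[volume] fun x => u (x + h) := fun u =>
    Lp.coeFn_compMeasurePreserving u (measurePreserving_add_right (volume : Measure R3) h)
  let Λ : Energy →L[ℝ] ℝ := (integralCLM (6 / 5) 6 hg' ∘L S ∘L embL6) -
    (integralCLM (6 / 5) 6 hg' ∘L embL6)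
  have hΛ : ∀ G : Energy, Λ G = correl g (embL6 G) h - correl g (embL6 G) 0 := by
    intro G
    change (∫ x, g x * S (embL6 G) x) - ∫ x, g x * embL6 G x = _
    rw [correl_zero, correl]
    congr 1
    refine integral_congr_ae ?_
    filter_upwards [hS (embL6 G)] with x hx
    rw [hx]
  rw [← hΛ]
  refine denseRange_testToEnergy.induction_on (p := fun G =>
    |Λ G| ≤ 3 * (eLpNorm g 2 volume).toReal * ‖G‖ * ‖h‖) G ?_ fun η => ?_
  · exact isClosed_le Λ.continuous.abs ((continuous_const.mul continuous_norm).mul continuous_const)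
  · rw [hΛ, correl_congr (coeFn_embL6_test η), correl_congr (coeFn_embL6_test η)]
    exact abs_correl_test_sub_le hg η h

/-! ### Regularity by difference quotients -/

lemma memLp_pow_five {u : R3 → ℝ} (hu : MemLp u 6 volume) :
    MemLp (fun x => u x ^ 5) (6 / 5) volume := by
  have h2 : MemLp (fun x => u x * u x) 3 volume := hu.mul hu
  have h4 : MemLp (fun x => (u x * u x) * (u x * u x)) (3 / 2) volume := h2.mul h2
  have h5 : MemLp (fun x => ((u x * u x) * (u x * u x)) * u x) (6 / 5) volume := hu.mul h4
  refine h5.ae_eq (.of_forall fun x => ?_)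
  ring

/-- With `D` the difference of `G` and its translate, testing the equation against the translate of
`D` by `-v` minus `D` gives `‖D‖²`. The quintic term can be dropped by its sign, and the `g` term is
at most a multiple of `‖g‖ ‖D‖ ‖v‖`; then divide by `‖D‖`. Since monotonicity replaces any estimate
of `u⁵`, the bound is linear in `g`. -/
lemma norm_shiftE_sub_le {G : Energy} {g : R3 → ℝ} (hg : MemLp g 2 volume)
    (hg' : MemLp g (6 / 5) volume) {κ : ℝ} (hκ : 0 ≤ κ)
    (h : ∀ Φ : Energy, inner ℝ G Φ =
      (∫ x, g x * embL6 Φ x) - κ * ∫ x, embL6 G x ^ 5 * embL6 Φ x) (v : R3) :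
    ‖shiftE v G - G‖ ≤ 3 * (eLpNorm g 2 volume).toReal * ‖v‖ := by
  set D := shiftE v G - G with hD
  have hDx : embL6 D =ᵐ[volume] fun x => embL6 G (x + v) - embL6 G x := by
    rw [hD, map_sub]
    filter_upwards [Lp.coeFn_sub (embL6 (shiftE v G)) (embL6 G), embL6_shiftE v G] with x h1 h2
    rw [h1, Pi.sub_apply, h2]
  have hu5 := memLp_pow_five (memLp_embL6 G)
  have e0 : ∀ f : R3 → ℝ, ∫ x, f x * embL6 (shiftE (-v) D) x = correl f (embL6 D) (-v) := fun f =>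
    integral_congr_ae ((embL6_shiftE (-v) D).mono fun x hx => by simp only [hx])
  have e1 : inner ℝ D D = (correl g (embL6 D) (-v) - correl g (embL6 D) 0) -
      κ * (correl (fun x => embL6 G x ^ 5) (embL6 D) (-v) -
        correl (fun x => embL6 G x ^ 5) (embL6 D) 0) := by
    conv_lhs => rw [hD, inner_sub_left, inner_shiftE]
    rw [← hD, h, h, e0, e0, correl_zero, correl_zero]
    ring
  -- Moving the translation onto `u⁵` leaves the integral of `(u(x+v) - u(x)) (u(x+v)⁵ - u(x)⁵)`,
  -- whose two factors have the same sign.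
  have e2 : 0 ≤ correl (fun x => embL6 G x ^ 5) (embL6 D) (-v) -
      correl (fun x => embL6 G x ^ 5) (embL6 D) 0 := by
    rw [correl_neg_right, correl_zero]
    have e3 : ∫ x, embL6 G x ^ 5 * embL6 D x = correl (embL6 D) (fun x => embL6 G x ^ 5) 0 := by
      rw [correl_zero]; exact integral_congr_ae (.of_forall fun x => mul_comm _ _)
    have : ENNReal.HolderTriple 6 (6 / 5) 1 := ENNReal.HolderTriple.symm
    rw [e3, correl_sub_correl_zero 6 (6 / 5) (memLp_embL6 D) hu5]
    refine integral_nonneg_of_ae ?_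
    filter_upwards [hDx] with x hx
    rw [hx, Pi.zero_apply]
    have hmono : StrictMono fun t : ℝ => t ^ 5 := Odd.strictMono_pow (by decide)
    rcases le_total (embL6 G (x + v)) (embL6 G x) with hle | hle
    · exact mul_nonneg_of_nonpos_of_nonpos (by linarith) (by linarith [hmono.monotone hle])
    · exact mul_nonneg (by linarith) (by linarith [hmono.monotone hle])
  have e3 := abs_correl_sub_le hg hg' D (-v)
  rw [norm_neg] at e3
  have e4 : ‖D‖ * ‖D‖ ≤ (3 * (eLpNorm g 2 volume).toReal * ‖v‖) * ‖D‖ := by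
    rw [← real_inner_self_eq_norm_mul_norm, e1]
    have := le_abs_self (correl g (embL6 D) (-v) - correl g (embL6 D) 0)
    have := mul_nonneg hκ e2
    linarith
  rcases (norm_nonneg D).eq_or_lt with h0 | h0
  · rw [← h0]; positivity
  · exact le_of_mul_le_mul_right e4 h0

/-- By the bound, `f` factors through `e` and extends to the closure of its range with the same
constant. Riesz representation applies on that closed subspace. -/
lemma exists_riesz {V H : Type*} [AddCommGroup V] [Module ℝ V] [NormedAddCommGroup H]
    [InnerProductSpace ℝ H] [CompleteSpace H] (f : V →ₗ[ℝ] ℝ) (e : V →ₗ[ℝ] H) {C : ℝ}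
    (hC : 0 ≤ C) (h : ∀ v, |f v| ≤ C * ‖e v‖) :
    ∃ x : H, ‖x‖ ≤ C ∧ ∀ v, f v = inner ℝ x (e v) := by
  let P := (LinearMap.range e).topologicalClosure
  have : CompleteSpace P :=
    (Submodule.isClosed_topologicalClosure (LinearMap.range e)).completeSpace_coe
  let e' : V →ₗ[ℝ] P := e.codRestrict P fun v => (LinearMap.range e).le_topologicalClosure ⟨v, rfl⟩
  have hd : DenseRange e' := by
    intro G
    have hG : (G : H) ∈ closure (range e) := G.2
    rw [closure_subtype]
    convert hG
    ext x
    constructor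
    · rintro ⟨_, ⟨η, rfl⟩, rfl⟩; exact ⟨η, rfl⟩
    · rintro ⟨η, rfl⟩; exact ⟨_, ⟨η, rfl⟩, rfl⟩
  have hb : ∀ v, ‖f v‖ ≤ C * ‖e' v‖ := h
  let F : P →L[ℝ] ℝ := f.extendOfNorm e'
  let x := (InnerProductSpace.toDual ℝ P).symm F
  refine ⟨x, ?_, fun v => ?_⟩
  · change ‖x‖ ≤ C
    rw [LinearIsometryEquiv.norm_map]
    exact F.opNorm_le_bound hC (LinearMap.norm_extendOfNorm_apply_le hd C hb)
  · rw [← LinearMap.extendOfNorm_eq hd ⟨C, hb⟩ v]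
    exact (InnerProductSpace.toDual_symm_apply (𝕜 := ℝ) (x := e' v) (y := F)).symm

/-- A function in `L²` with bounded difference quotients has weak derivatives in `L²`. -/
lemma exists_hasWeakPartial_of_translate {g : R3 → ℝ} (hg : MemLp g 2 volume) {C : ℝ} (hC : 0 ≤ C)
    (h : ∀ v, (eLpNorm (fun x => g (x + v) - g x) 2 volume).toReal ≤ C * ‖v‖) (j : Fin 3) :
    ∃ k, MemLp k 2 volume ∧ HasWeakPartial j g k ∧ (eLpNorm k 2 volume).toReal ≤ C := by
  have hgl := hg.locallyIntegrable (by norm_num)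
  let e : TestFn →ₗ[ℝ] L2 :=
    { toFun := fun η => (memLp_of_mem_testFn η.2 2).toLp _
      map_add' := fun _ _ => rfl
      map_smul' := fun _ _ => rfl }
  have he : ∀ η : TestFn, e η =ᵐ[volume] (η : R3 → ℝ) := fun η =>
    MemLp.coeFn_toLp (memLp_of_mem_testFn η.2 2)
  let f : TestFn →ₗ[ℝ] ℝ :=
    { toFun := fun η => -∫ x, g x * partialDeriv j η x
      map_add' := fun η ζ => by
        have a := partialDeriv_mem j η.2
        have b := partialDeriv_mem j ζ.2
        simp only [Submodule.coe_add, partialDeriv_add j η.2.1 ζ.2.1, Pi.add_apply, mul_add]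
        rw [integral_add (integrable_mul_test hgl a.1.continuous a.2)
          (integrable_mul_test hgl b.1.continuous b.2), neg_add]
      map_smul' := fun c η => by
        simp only [Submodule.coe_smul, partialDeriv_smul j c η.2.1, Pi.smul_apply, smul_eq_mul,
          RingHom.id_apply, mul_left_comm _ c, integral_const_mul, mul_neg] }
  have hf : ∀ η : TestFn, |f η| ≤ C * ‖e η‖ := by
    intro η
    have hη2 := memLp_of_mem_testFn η.2 2
    have hd := hasDerivAt_correl hgl η.2 0 j 0
    rw [zero_smul, add_zero, correl_zero] at hd
    -- The pairing `∫ g ∂ⱼη` is the derivative at zero of the correlation. Moving the translation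
    -- from `η` to `g` bounds its increments by the hypothesis on difference quotients.
    have hlip := hd.le_of_lip' (C := C * ‖e η‖) (by positivity) (.of_forall fun s => ?_)
    · simpa [f] using hlip
    · simp only [zero_add, sub_zero, zero_smul]
      have e1 : ∀ v : R3, correl g η v = correl η g (-v) := fun v => (correl_neg_right _ _ v).symm
      rw [e1, e1, neg_zero, correl_sub_correl_zero 2 2 hη2 hg]
      refine (abs_integral_mul_le 2 2 hη2 ((memLp_translate hg _).sub hg)).trans ?_
      have e2 := h (-(s • (EuclideanSpace.single j 1 : R3)))
      rw [norm_neg, norm_smul, PiLp.norm_single, norm_one, mul_one] at e2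
      have e3 : ‖e η‖ = (eLpNorm (η : R3 → ℝ) 2 volume).toReal := by
        rw [Lp.norm_def, eLpNorm_congr_ae (he η)]
      rw [e3]
      calc _ ≤ (eLpNorm (η : R3 → ℝ) 2 volume).toReal * (C * ‖s‖) := by gcongr; exact e2
        _ = _ := by ring
  obtain ⟨k, hk, hk'⟩ := exists_riesz f e hC hf
  refine ⟨k, Lp.memLp k, ⟨hgl, (Lp.memLp k).locallyIntegrable (by norm_num), fun η h1 h2 => ?_⟩, hk⟩
  have := hk' ⟨η, h1, h2⟩
  rw [inner_L2_eq_integral] at this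
  have e4 : ∫ x, k x * e ⟨η, h1, h2⟩ x = ∫ x, k x * η x :=
    integral_congr_ae ((he ⟨η, h1, h2⟩).mono fun x hx => by simp only [hx])
  rw [e4] at this
  change -∫ x, g x * partialDeriv j η x = _ at this
  rw [← this, neg_neg]

/-- `Ḣ²` regularity of weak solutions of `-Δu + κ u⁵ = g`. -/
lemma exists_hasWeakPartial_gradE {G : Energy} {g : R3 → ℝ} (hg : MemLp g 2 volume)
    (hg' : MemLp g (6 / 5) volume) {κ : ℝ} (hκ : 0 ≤ κ)
    (h : ∀ Φ : Energy, inner ℝ G Φ =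
      (∫ x, g x * embL6 Φ x) - κ * ∫ x, embL6 G x ^ 5 * embL6 Φ x) (i j : Fin 3) :
    ∃ k, MemLp k 2 volume ∧ HasWeakPartial j (gradE i G) k ∧
      (eLpNorm k 2 volume).toReal ≤ 3 * (eLpNorm g 2 volume).toReal := by
  refine exists_hasWeakPartial_of_translate (memLp_gradE i G) (by positivity) (fun v => ?_) j
  refine le_trans ?_ (norm_shiftE_sub_le hg hg' hκ h v)
  refine le_trans (le_of_eq ?_) (norm_gradE_le i (shiftE v G - G))
  rw [Lp.norm_def, map_sub]
  congr 1
  refine eLpNorm_congr_ae ?_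
  filter_upwards [Lp.coeFn_sub (gradE i (shiftE v G)) (gradE i G), gradE_shiftE i v G]
    with x h1 h2
  rw [h1, Pi.sub_apply, h2]

/-! ### Averages of correlations -/

section Fubini

variable {ρ g : R3 → ℝ} (u : L6)

/-- For each `h` the inner integral is bounded by `‖g‖_{6/5} ‖u‖₆`, independently of `h` because
translations preserve the `L⁶` norm. -/
lemma integrable_prod_correl (hρ : Integrable ρ volume) (hg : MemLp g (6 / 5) volume) :
    Integrable (fun z : R3 × R3 => ρ z.1 * (g z.2 * u (z.2 + z.1))) (volume.prod volume) := by
  have hu : StronglyMeasurable (u : R3 → ℝ) := Lp.stronglyMeasurable u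
  have hm : AEStronglyMeasurable (fun z : R3 × R3 => ρ z.1 * (g z.2 * u (z.2 + z.1)))
      (volume.prod volume) :=
    hρ.1.comp_fst.mul (hg.1.comp_snd.mul
      (hu.comp_measurable (measurable_snd.add measurable_fst)).aestronglyMeasurable)
  rw [integrable_prod_iff hm]
  refine ⟨.of_forall fun h => (integrable_mul_of_memLp (6 / 5) 6 hg
    (memLp_translate (Lp.memLp u) h)).const_mul (ρ h), ?_⟩
  refine Integrable.mono' (g := fun h => ‖ρ h‖ *
    ((eLpNorm g (6 / 5) volume).toReal * (eLpNorm u 6 volume).toReal)) (hρ.norm.mul_const _)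
    hm.norm.integral_prod_right' (.of_forall fun h => ?_)
  rw [Real.norm_of_nonneg (integral_nonneg fun _ => norm_nonneg _)]
  simp only [norm_mul]
  rw [integral_const_mul]
  gcongr
  have := abs_integral_mul_le (6 / 5) 6 hg.norm (memLp_translate (Lp.memLp u) h).norm
  rw [eLpNorm_norm, eLpNorm_norm, eLpNorm_translate (Lp.aestronglyMeasurable u)] at this
  exact (le_abs_self _).trans this

lemma integrable_mul_correl (hρ : Integrable ρ volume) (hg : MemLp g (6 / 5) volume) :
    Integrable (fun h => ρ h * correl g u h) volume := by
  refine (integrable_prod_correl u hρ hg).integral_prod_left.congr (.of_forall fun h => ?_)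
  simp only [integral_const_mul, correl]

lemma integral_correl_eq (ρ g : R3 → ℝ) (x : R3) :
    ∫ h, ρ h * (g x * u (x + h)) = g x * correl ρ u x := by
  rw [correl, ← integral_const_mul]
  refine integral_congr_ae (.of_forall fun h => ?_)
  simp only [add_comm x h]
  ring

lemma integrable_mul_correl_swap (hρ : Integrable ρ volume) (hg : MemLp g (6 / 5) volume) :
    Integrable (fun x => g x * correl ρ u x) volume := by
  refine (integrable_prod_correl u hρ hg).integral_prod_right.congr (.of_forall fun x => ?_)
  exact integral_correl_eq u ρ g x

lemma integral_mul_correl_swap (hρ : Integrable ρ volume) (hg : MemLp g (6 / 5) volume) :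
    ∫ x, g x * correl ρ u x = ∫ h, ρ h * correl g u h := by
  have h1 := integral_integral_swap (f := fun h x => ρ h * (g x * u (x + h)))
    (integrable_prod_correl u hρ hg)
  simp only [integral_correl_eq] at h1
  rw [← h1]
  simp only [integral_const_mul, correl]

end Fubini

/-- Averaging `abs_correl_sub_le` against `ρ`. The error of mollification is governed by the first
moment of `ρ`, uniformly on bounded sets of the energy space; both positivity and compactness rest
on this. -/
lemma abs_integral_mul_correl_sub_le {ρ g : R3 → ℝ} (hρ0 : ∀ h, 0 ≤ ρ h)
    (hρ : Integrable ρ volume) (hρ1 : Integrable (fun h => ρ h * ‖h‖) volume)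
    (hg : MemLp g 2 volume) (hg' : MemLp g (6 / 5) volume) (G : Energy) :
    |(∫ x, g x * correl ρ (embL6 G) x) - (∫ h, ρ h) * ∫ x, g x * embL6 G x| ≤
      3 * (eLpNorm g 2 volume).toReal * ‖G‖ * ∫ h, ρ h * ‖h‖ := by
  have e : (∫ x, g x * correl ρ (embL6 G) x) - (∫ h, ρ h) * ∫ x, g x * embL6 G x =
      ∫ h, (ρ h * correl g (embL6 G) h - ρ h * correl g (embL6 G) 0) := by
    rw [integral_sub (integrable_mul_correl _ hρ hg') (hρ.mul_const _), integral_mul_const,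
      integral_mul_correl_swap _ hρ hg', correl_zero]
  rw [e, ← integral_const_mul, ← Real.norm_eq_abs]
  refine norm_integral_le_of_norm_le (hρ1.const_mul (3 * (eLpNorm g 2 volume).toReal * ‖G‖))
    (.of_forall fun h => ?_)
  rw [← mul_sub, norm_mul, Real.norm_of_nonneg (hρ0 h), Real.norm_eq_abs]
  have := mul_le_mul_of_nonneg_left (abs_correl_sub_le hg hg' G h) (hρ0 h)
  linarith

/-! ### The regularized Newtonian kernel -/

/-- Powers of `|x|² + ε²`. -/
def bracket (ε s : ℝ) (x : R3) : ℝ := (‖x‖ ^ 2 + ε ^ 2) ^ s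

section Bracket

variable {ε : ℝ}

lemma bracket_base_pos (hε : 0 < ε) (x : R3) : 0 < ‖x‖ ^ 2 + ε ^ 2 := by positivity

lemma bracket_pos (hε : 0 < ε) (s : ℝ) (x : R3) : 0 < bracket ε s x :=
  Real.rpow_pos_of_pos (bracket_base_pos hε x) s

lemma contDiff_bracket (hε : 0 < ε) (s : ℝ) : ContDiff ℝ ∞ (bracket ε s) :=
  ((contDiff_norm_sq ℝ).add contDiff_const).rpow_const_of_ne
    fun x => (bracket_base_pos hε x).ne'

lemma partialDeriv_bracket (hε : 0 < ε) (s : ℝ) (i : Fin 3) :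
    partialDeriv i (bracket ε s) = fun x => 2 * s * (x i * bracket ε (s - 1) x) := by
  ext x
  have h1 : HasFDerivAt (fun x : R3 => ‖x‖ ^ 2 + ε ^ 2) (2 • innerSL ℝ x) x :=
    (hasStrictFDerivAt_norm_sq x).hasFDerivAt.add_const _
  have h2 := h1.rpow_const (p := s) (Or.inl (bracket_base_pos hε x).ne')
  have h3 : fderiv ℝ (bracket ε s) x = _ := h2.fderiv
  rw [partialDeriv, h3]
  simp [bracket, EuclideanSpace.inner_single_right]
  ring

lemma bracket_mul (hε : 0 < ε) (s t : ℝ) (x : R3) :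
    bracket ε s x * bracket ε t x = bracket ε (s + t) x :=
  (Real.rpow_add (bracket_base_pos hε x) s t).symm

lemma norm_sq_add_mul_bracket (hε : 0 < ε) (s : ℝ) (x : R3) :
    (‖x‖ ^ 2 + ε ^ 2) * bracket ε s x = bracket ε (s + 1) x := by
  rw [bracket, bracket, Real.rpow_add_one (bracket_base_pos hε x).ne', mul_comm]

lemma norm_mul_bracket_le (hε : 0 < ε) (s : ℝ) (x : R3) :
    ‖x‖ * bracket ε s x ≤ bracket ε (s + 1 / 2) x := by
  rw [← bracket_mul hε, mul_comm]
  refine mul_le_mul_of_nonneg_left ?_ (bracket_pos hε s x).le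
  rw [bracket, ← Real.sqrt_eq_rpow]
  exact Real.le_sqrt_of_sq_le (by nlinarith [sq_nonneg ε])

lemma bracket_smul (hε : 0 < ε) (s : ℝ) (x : R3) :
    bracket ε s (ε • x) = (ε ^ 2) ^ s * bracket 1 s x := by
  rw [bracket, bracket, ← Real.mul_rpow (by positivity) (by positivity), norm_smul,
    Real.norm_of_nonneg hε.le]
  congr 1
  ring

lemma integrable_bracket (hε : 0 < ε) {s : ℝ} (hs : 3 < -2 * s) :
    Integrable (bracket ε s) volume := by
  rw [← integrable_comp_smul_iff volume (bracket ε s) hε.ne']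
  have h := integrable_rpow_neg_one_add_norm_sq (E := R3) (μ := volume) (r := -2 * s)
    (by simpa using hs)
  refine (h.const_mul ((ε ^ 2) ^ s)).congr (.of_forall fun x => ?_)
  simp only [bracket_smul hε]
  congr 1
  rw [bracket, one_pow, add_comm]
  congr 1
  ring

lemma memLp_bracket (hε : 0 < ε) {s p : ℝ} (hp : 0 < p) (hs : 3 < -2 * s * p) :
    MemLp (bracket ε s) (ENNReal.ofReal p) volume := by
  have hc := (contDiff_bracket hε s).continuous
  rw [← integrable_norm_rpow_iff hc.aestronglyMeasurable (by simpa using hp) (by simp),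
    ENNReal.toReal_ofReal hp.le]
  refine (integrable_bracket hε (s := s * p) (by linarith)).congr (.of_forall fun x => ?_)
  simp only [Real.norm_of_nonneg (bracket_pos hε s x).le]
  simp only [bracket, Real.rpow_mul (bracket_base_pos hε x).le]

end Bracket

/-- The mollifier `-Δ (|x|² + ε²)^(-1/2) = 3ε² (|x|² + ε²)^(-5/2)`. -/
def moll (ε : ℝ) (x : R3) : ℝ := 3 * ε ^ 2 * bracket ε (-5 / 2) x

section Moll

variable {ε : ℝ}

lemma moll_pos (hε : 0 < ε) (x : R3) : 0 < moll ε x :=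
  mul_pos (by positivity) (bracket_pos hε _ x)

lemma integrable_moll (hε : 0 < ε) : Integrable (moll ε) volume :=
  (integrable_bracket hε (by norm_num)).const_mul _

lemma memLp_moll (hε : 0 < ε) : MemLp (moll ε) (6 / 5) volume := by
  have h := (memLp_bracket hε (s := -5 / 2) (p := 6 / 5) (by norm_num) (by norm_num)).const_mul
    (3 * ε ^ 2)
  have e : ENNReal.ofReal (6 / 5) = 6 / 5 := by
    rw [ENNReal.ofReal_div_of_pos (by norm_num)]; norm_num
  rwa [e] at h

lemma integrable_moll_mul_norm (hε : 0 < ε) : Integrable (fun x => moll ε x * ‖x‖) volume := by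
  refine Integrable.mono' ((integrable_bracket hε (s := -2) (by norm_num)).const_mul (3 * ε ^ 2))
    ((integrable_moll hε).1.mul continuous_norm.aestronglyMeasurable) (.of_forall fun x => ?_)
  rw [Real.norm_of_nonneg (mul_nonneg (moll_pos hε x).le (norm_nonneg x)), moll, mul_assoc]
  refine mul_le_mul_of_nonneg_left ?_ (by positivity)
  have h := norm_mul_bracket_le hε (-5 / 2) x
  have e : (-5 / 2 : ℝ) + 1 / 2 = -2 := by norm_num
  rwa [e, mul_comm] at h

lemma moll_smul (hε : 0 < ε) (x : R3) : moll ε (ε • x) = (ε ^ 3)⁻¹ * moll 1 x := by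
  rw [moll, bracket_smul hε, moll, one_pow]
  have h5 : ((ε ^ 2) ^ (-5 / 2 : ℝ)) = (ε ^ 5)⁻¹ := by
    rw [← Real.rpow_natCast ε 2, ← Real.rpow_mul hε.le, ← Real.rpow_natCast ε 5,
      ← Real.rpow_neg hε.le]
    norm_num
  rw [h5]
  field_simp

lemma integral_moll (hε : 0 < ε) : ∫ x, moll ε x = ∫ x, moll 1 x := by
  have h := Measure.integral_comp_smul (volume : Measure R3) (moll ε) ε
  simp only [moll_smul hε, integral_const_mul, finrank_euclideanSpace, Fintype.card_fin,
    smul_eq_mul] at h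
  rw [abs_of_pos (by positivity)] at h
  exact (mul_left_cancel₀ (by positivity) h).symm

lemma integral_moll_mul_norm (hε : 0 < ε) :
    ∫ x, moll ε x * ‖x‖ = ε * ∫ x, moll 1 x * ‖x‖ := by
  have h := Measure.integral_comp_smul (volume : Measure R3) (fun x => moll ε x * ‖x‖) ε
  have e : ∀ x : R3, moll ε (ε • x) * ‖ε • x‖ = (ε ^ 3)⁻¹ * (ε * (moll 1 x * ‖x‖)) := by
    intro x
    rw [moll_smul hε, norm_smul, Real.norm_of_nonneg hε.le]
    ring
  simp only [e, integral_const_mul, finrank_euclideanSpace, Fintype.card_fin,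
    smul_eq_mul] at h
  rw [abs_of_pos (by positivity)] at h
  exact (mul_left_cancel₀ (by positivity) h).symm

lemma integral_moll_pos (hε : 0 < ε) : 0 < ∫ x, moll ε x := by
  rw [integral_pos_iff_support_of_nonneg (fun x => (moll_pos hε x).le) (integrable_moll hε)]
  have : Function.support (moll ε) = univ := by
    ext x; simp [(moll_pos hε x).ne']
  rw [this]
  exact Measure.measure_univ_pos.2 (NeZero.ne _)

/-- The regularized Newtonian kernel as an element of the energy space. -/
lemma exists_newton (hε : 0 < ε) : ∃ K : Energy, embL6 K =ᵐ[volume] bracket ε (-1 / 2) ∧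
    ∀ G : Energy, inner ℝ K G = correl (moll ε) (embL6 G) 0 := by
  have hc := contDiff_bracket hε (-1 / 2)
  have hd : ∀ i, partialDeriv i (bracket ε (-1 / 2)) = fun x => -(x i * bracket ε (-3 / 2) x) := by
    intro i
    rw [partialDeriv_bracket hε]
    ext x
    norm_num
  have hm : ∀ i, MemLp (partialDeriv i (bracket ε (-1 / 2))) 2 volume := by
    intro i
    have h1 := memLp_bracket hε (s := -1) (p := 2) (by norm_num) (by norm_num)
    have e : ENNReal.ofReal 2 = 2 := by norm_num
    rw [e] at h1
    refine h1.of_le (contDiff_partialDeriv i hc).continuous.aestronglyMeasurable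
      (.of_forall fun x => ?_)
    rw [hd, norm_neg, norm_mul, Real.norm_of_nonneg (bracket_pos hε _ x).le,
      Real.norm_of_nonneg (bracket_pos hε _ x).le]
    have h2 := norm_mul_bracket_le hε (-3 / 2) x
    have e2 : (-3 / 2 : ℝ) + 1 / 2 = -1 := by norm_num
    rw [e2] at h2
    exact (mul_le_mul_of_nonneg_right (PiLp.norm_apply_le x i) (bracket_pos hε _ x).le).trans h2
  have h6 : MemLp (bracket ε (-1 / 2)) 6 volume := by
    have h1 := memLp_bracket hε (s := -1 / 2) (p := 6) (by norm_num) (by norm_num)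
    have e : ENNReal.ofReal 6 = 6 := by norm_num
    rwa [e] at h1
  obtain ⟨K, hK, hK'⟩ := exists_energy_of_hasWeakPartial h6 hm
    fun i => hasWeakPartial_of_contDiff i hc
  refine ⟨K, hK, fun G => ?_⟩
  have key : innerSL ℝ K = integralCLM (6 / 5) 6 (memLp_moll hε) ∘L embL6 := by
    refine energy_clm_ext fun η => ?_
    change inner ℝ K (testToEnergy η) = ∫ x, moll ε x * embL6 (testToEnergy η) x
    have e0 : ∫ x, moll ε x * embL6 (testToEnergy η) x = ∫ x, moll ε x * (η : R3 → ℝ) x :=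
      integral_congr_ae ((coeFn_embL6_test η).mono fun x hx => by simp only [hx])
    have e1 : ∀ i, ∫ x, gradE i K x * gradE i (testToEnergy η) x =
        -∫ x, partialDeriv i (partialDeriv i (bracket ε (-1 / 2))) x * (η : R3 → ℝ) x := by
      intro i
      rw [← integral_partialDeriv_mul i (contDiff_partialDeriv i hc) η.2]
      refine integral_congr_ae ?_
      filter_upwards [hK' i, coeFn_gradE_test i η] with x h1 h2
      rw [h1, h2]
    rw [e0, inner_energy_eq_integral, Finset.sum_congr rfl fun i _ => e1 i,
      Finset.sum_neg_distrib, ← integral_finsetSum, ← integral_neg]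
    · refine integral_congr_ae (.of_forall fun x => ?_)
      have hdd : ∀ i, partialDeriv i (partialDeriv i (bracket ε (-1 / 2))) x =
          -bracket ε (-3 / 2) x + 3 * (x i) ^ 2 * bracket ε (-5 / 2) x := by
        intro i
        rw [hd]
        have a1 : HasFDerivAt (fun x : R3 => x i) (EuclideanSpace.proj i : R3 →L[ℝ] ℝ) x :=
          (EuclideanSpace.proj i : R3 →L[ℝ] ℝ).hasFDerivAt
        have a2 := ((contDiff_bracket hε (-3 / 2)).differentiable (by simp) x).hasFDerivAt
        have a3 := congrFun (partialDeriv_bracket hε (-3 / 2) i) x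
        have a4 : fderiv ℝ (fun x : R3 => -(x i * bracket ε (-3 / 2) x)) x = _ :=
          (a1.mul a2).neg.fderiv
        rw [partialDeriv, a4]
        rw [partialDeriv] at a3
        simp only [neg_apply, add_apply, smul_apply, smul_eq_mul, a3]
        simp
        norm_num
        ring
      simp only [hdd]
      rw [← Finset.sum_mul, ← neg_mul]
      congr 1
      -- The sum of the second derivatives is `-3(|x|²+ε²)^(-3/2) + 3|x|²(|x|²+ε²)^(-5/2)`, which
      -- equals `-3ε²(|x|²+ε²)^(-5/2)`.
      have h3 := norm_sq_add_mul_bracket hε (-5 / 2) x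
      have h4 : (-5 / 2 : ℝ) + 1 = -3 / 2 := by norm_num
      rw [h4] at h3
      rw [Finset.sum_add_distrib, ← Finset.sum_mul, ← Finset.mul_sum, ← h3,
        EuclideanSpace.real_norm_sq_eq, moll]
      simp
      ring
    · intro i _
      exact integrable_mul_test (contDiff_partialDeriv i
        (contDiff_partialDeriv i hc)).continuous.locallyIntegrable η.2.1.continuous η.2.2
  have h5 := congrArg (fun L => L G) key
  rw [correl_zero]
  exact h5

end Moll

/-! ### Strict positivity of `(-Δ)⁻¹` -/

section Positivity

variable {W : Energy} {f : R3 → ℝ}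

/-- Testing the equation of `W` with a translated regularized kernel represents the mollification of
`W` as a potential of `f` with a strictly positive kernel. -/
lemma correl_moll_eq (hW : ∀ Φ : Energy, inner ℝ W Φ = ∫ x, f x * embL6 Φ x)
    {ε : ℝ} (hε : 0 < ε) (x₀ : R3) :
    correl (moll ε) (embL6 W) x₀ = ∫ x, f x * bracket ε (-1 / 2) (x - x₀) := by
  obtain ⟨K, hK, hK'⟩ := exists_newton hε
  have h1 : inner ℝ (shiftE (-x₀) K) W = correl (moll ε) (embL6 W) x₀ := by
    rw [inner_shiftE, neg_neg, hK', correl_congr (embL6_shiftE x₀ W)]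
    simp [correl]
  rw [← h1, real_inner_comm, hW]
  refine integral_congr_ae ?_
  filter_upwards [embL6_shiftE (-x₀) K, ae_eq_translate hK (-x₀)] with x h2 h3
  rw [h2, h3, ← sub_eq_add_neg]

lemma integrable_mul_bracket (hf : MemLp f (6 / 5) volume) {ε : ℝ} (hε : 0 < ε) (x₀ : R3) :
    Integrable (fun x => f x * bracket ε (-1 / 2) (x - x₀)) volume := by
  have h1 := memLp_bracket hε (s := -1 / 2) (p := 6) (by norm_num) (by norm_num)
  have e : ENNReal.ofReal 6 = 6 := by norm_num
  rw [e] at h1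
  simp only [sub_eq_add_neg]
  exact integrable_mul_of_memLp (6 / 5) 6 hf (memLp_translate h1 (-x₀))

lemma integral_mul_pos {μ : Measure R3} {f k : R3 → ℝ} (hf : 0 ≤ᵐ[μ] f)
    (hf' : ¬ f =ᵐ[μ] 0) (hk : ∀ x, 0 < k x) (hi : Integrable (fun x => f x * k x) μ) :
    0 < ∫ x, f x * k x ∂μ := by
  have h0 : 0 ≤ᵐ[μ] fun x => f x * k x := hf.mono fun x hx => mul_nonneg hx (hk x).le
  refine lt_of_le_of_ne (integral_nonneg_of_ae h0) fun h => hf' ?_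
  have := (integral_eq_zero_iff_of_nonneg_ae h0 hi).1 h.symm
  filter_upwards [this] with x hx
  simpa [(hk x).ne'] using hx

/-- `(-Δ)⁻¹` is positivity improving. -/
lemma integral_mul_embL6_pos (hW : ∀ Φ : Energy, inner ℝ W Φ = ∫ x, f x * embL6 Φ x)
    (hf : MemLp f (6 / 5) volume) (hf0 : 0 ≤ᵐ[volume] f) (hf' : ¬ f =ᵐ[volume] 0) {g : R3 → ℝ}
    (hg2 : MemLp g 2 volume) (hg : MemLp g (6 / 5) volume) (hg0 : 0 ≤ᵐ[volume] g)
    (hg' : ¬ g =ᵐ[volume] 0) : 0 < ∫ x, g x * embL6 W x := by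
  have hpos : ∀ x, 0 < correl (moll 1) (embL6 W) x := fun x => by
    rw [correl_moll_eq hW one_pos]
    exact integral_mul_pos hf0 hf' (fun _ => bracket_pos one_pos _ _)
      (integrable_mul_bracket hf one_pos x)
  -- The kernel `(|x|²+ε²)^(-1/2)` grows as `ε` decreases, so the strictly positive value `I`
  -- obtained at `ε = 1` is a lower bound for all smaller `ε`.
  have hmono : ∀ ε : ℝ, 0 < ε → ε ≤ 1 → ∀ x,
      correl (moll 1) (embL6 W) x ≤ correl (moll ε) (embL6 W) x := by
    intro ε hε hε1 x
    rw [correl_moll_eq hW one_pos, correl_moll_eq hW hε]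
    refine integral_mono_ae (integrable_mul_bracket hf one_pos x)
      (integrable_mul_bracket hf hε x) ?_
    filter_upwards [hf0] with y hy
    refine mul_le_mul_of_nonneg_left ?_ hy
    refine Real.rpow_le_rpow_of_nonpos (bracket_base_pos hε _) ?_ (by norm_num)
    gcongr
  set I := ∫ x, g x * correl (moll 1) (embL6 W) x with hI
  have hIpos : 0 < I :=
    integral_mul_pos hg0 hg' hpos (integrable_mul_correl_swap _ (integrable_moll one_pos) hg)
  set c := ∫ x, moll 1 x
  set A := 3 * (eLpNorm g 2 volume).toReal * ‖W‖ * ∫ h, moll 1 h * ‖h‖ with hA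
  -- The first moment of `moll ε` is proportional to `ε`, so removing the mollification costs only
  -- `A ε`; positivity then survives the limit `ε → 0`.
  have key : ∀ ε : ℝ, 0 < ε → ε ≤ 1 → I ≤ c * (∫ x, g x * embL6 W x) + A * ε := by
    intro ε hε hε1
    have h1 := abs_integral_mul_correl_sub_le (fun h => (moll_pos hε h).le) (integrable_moll hε)
      (integrable_moll_mul_norm hε) hg2 hg W
    rw [integral_moll hε, integral_moll_mul_norm hε] at h1
    have h2 : I ≤ ∫ x, g x * correl (moll ε) (embL6 W) x := by
      refine integral_mono_ae (integrable_mul_correl_swap _ (integrable_moll one_pos) hg)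
        (integrable_mul_correl_swap _ (integrable_moll hε) hg) ?_
      filter_upwards [hg0] with x hx
      exact mul_le_mul_of_nonneg_left (hmono ε hε hε1 x) hx
    have h3 := (le_abs_self _).trans h1
    have h4 : A * ε = 3 * (eLpNorm g 2 volume).toReal * ‖W‖ *
        (ε * ∫ h, moll 1 h * ‖h‖) := by rw [hA]; ring
    linarith
  have hlim : I ≤ c * ∫ x, g x * embL6 W x := by
    refine ge_of_tendsto (x := nhdsWithin (0 : ℝ) (Ioi 0))
      (f := fun ε => c * (∫ x, g x * embL6 W x) + A * ε) ?_ ?_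
    · have : ContinuousAt (fun ε : ℝ => c * (∫ x, g x * embL6 W x) + A * ε) 0 := by fun_prop
      have h := this.tendsto.mono_left (nhdsWithin_le_nhds (s := Ioi (0 : ℝ)))
      simpa using h
    · filter_upwards [Ioc_mem_nhdsGT (zero_lt_one (α := ℝ))] with ε hε
      exact key ε hε.1 hε.2
  exact pos_of_mul_pos_right (hIpos.trans_le hlim) (integral_moll_pos one_pos).le

end Positivity

/-! ### Hölder's inequality for products. -/

instance factThree : Fact ((1 : ℝ≥0∞) ≤ 3) := ⟨by norm_num⟩

instance holderTriple_threeHalves_three : ENNReal.HolderTriple (3 / 2) 3 1 := ⟨by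
  rw [ENNReal.inv_div (by simp) (by simp), inv_one, ← one_div, ENNReal.div_add_div_same]
  norm_num
  exact ENNReal.div_self (by simp) (by simp)⟩

lemma toReal_eLpNorm_mul_le {α : Type*} [MeasurableSpace α] {μ : Measure α} (p q r : ℝ≥0∞)
    [ENNReal.HolderTriple p q r] {f g : α → ℝ} (hf : MemLp f p μ) (hg : MemLp g q μ) :
    (eLpNorm (fun x => f x * g x) r μ).toReal ≤
      (eLpNorm f p μ).toReal * (eLpNorm g q μ).toReal := by
  have h := eLpNorm_smul_le_mul_eLpNorm (p := p) (q := q) (r := r) hg.1 hf.1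
  rw [← ENNReal.toReal_mul]
  exact ENNReal.toReal_mono (ENNReal.mul_ne_top hf.2.ne hg.2.ne) h

/-! ### Potentials -/

/-- The integrability properties of a potential which are used below. -/
structure Admissible (V : R3 → ℝ) : Prop where
  continuous : Continuous V
  nonneg : ∀ x, 0 ≤ V x
  memLp_threeHalves : MemLp V (3 / 2) volume
  memLp_three : MemLp V 3 volume
  memLp_sqrt : MemLp (fun x => √(V x)) 3 volume

lemma memLp_of_decay {f : R3 → ℝ} (hf : Continuous f) {M γ p : ℝ} (hp : 0 < p) (hγ : 3 < γ * p)
    (h : ∀ x, |f x| ≤ M * (1 + ‖x‖) ^ (-γ)) : MemLp f (ENNReal.ofReal p) volume := by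
  have hb : ∀ x : R3, 0 < 1 + ‖x‖ := fun x => by positivity
  have hc : Continuous fun x : R3 => (1 + ‖x‖) ^ (-γ) :=
    (continuous_const.add continuous_norm).rpow_const fun x => Or.inl (hb x).ne'
  have h1 : MemLp (fun x : R3 => (1 + ‖x‖) ^ (-γ)) (ENNReal.ofReal p) volume := by
    rw [← integrable_norm_rpow_iff hc.aestronglyMeasurable (by simpa using hp) (by simp),
      ENNReal.toReal_ofReal hp.le]
    refine (integrable_one_add_norm (E := R3) (μ := volume) (r := γ * p) (by simpa using hγ)).congr
      (.of_forall fun x => ?_)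
    simp only [Real.norm_of_nonneg (Real.rpow_nonneg (hb x).le _)]
    rw [← Real.rpow_mul (hb x).le, neg_mul]
  exact (h1.const_mul M).of_le hf.aestronglyMeasurable
    (.of_forall fun x => (h x).trans (le_abs_self _))

/-- Here `β > 2` enters: `V ∈ L^{3/2}` and `√V ∈ L³` both come down to `3β/2 > 3`, the integrability
of `(1+|x|)^(-3β/2)` in dimension three. -/
lemma MemY.admissible {β : ℝ} {V : R3 → ℝ} (hβ : 2 < β) (hV : MemY β V) (h0 : ∀ x, 0 ≤ V x) :
    Admissible V := by
  obtain ⟨hc, M, hM⟩ := hV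
  have hb : ∀ x : R3, 0 < 1 + ‖x‖ := fun x => by positivity
  have h1 : ∀ x, |V x| ≤ M * (1 + ‖x‖) ^ (-β) := by
    intro x
    rw [Real.rpow_neg (hb x).le, ← div_eq_mul_inv, le_div_iff₀ (Real.rpow_pos_of_pos (hb x) _),
      mul_comm]
    exact hM ⟨x, rfl⟩
  have hM0 : 0 ≤ M := (mul_nonneg (Real.rpow_nonneg (hb 0).le _) (abs_nonneg _)).trans (hM ⟨0, rfl⟩)
  have h2 : ∀ x, |√(V x)| ≤ √M * (1 + ‖x‖) ^ (-(β / 2)) := by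
    intro x
    rw [abs_of_nonneg (Real.sqrt_nonneg _), Real.sqrt_le_left (by positivity), mul_pow,
      Real.sq_sqrt hM0, ← Real.rpow_natCast ((1 + ‖x‖) ^ _), ← Real.rpow_mul (hb x).le]
    have e : -(β / 2) * ((2 : ℕ) : ℝ) = -β := by push_cast; ring
    rw [e]
    exact (le_abs_self _).trans (h1 x)
  have a := memLp_of_decay hc (p := 3 / 2) (by norm_num) (by linarith) h1
  have b := memLp_of_decay hc (p := 3) (by norm_num) (by linarith) h1
  have c := memLp_of_decay hc.sqrt (p := 3) (by norm_num) (by linarith) h2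
  have e1 : ENNReal.ofReal (3 / 2) = 3 / 2 := by
    rw [ENNReal.ofReal_div_of_pos (by norm_num)]; norm_num
  have e2 : ENNReal.ofReal 3 = 3 := by norm_num
  rw [e1] at a
  rw [e2] at b c
  exact ⟨hc, h0, a, b, c⟩

section Potential

variable {V : R3 → ℝ} (hV : Admissible V)

include hV

lemma Admissible.memLp_mul_six {u : R3 → ℝ} (hu : MemLp u 6 volume) :
    MemLp (fun x => V x * u x) (6 / 5) volume := hu.mul hV.memLp_threeHalves

lemma Admissible.memLp_mul_two {u : R3 → ℝ} (hu : MemLp u 6 volume) :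
    MemLp (fun x => V x * u x) 2 volume := hu.mul hV.memLp_three

lemma Admissible.memLp_sqrt_mul_six {u : R3 → ℝ} (hu : MemLp u 6 volume) :
    MemLp (fun x => √(V x) * u x) 2 volume := hu.mul hV.memLp_sqrt

lemma Admissible.memLp_sqrt_mul_two {u : R3 → ℝ} (hu : MemLp u 2 volume) :
    MemLp (fun x => √(V x) * u x) (6 / 5) volume := hu.mul hV.memLp_sqrt

end Potential

/-- The operator `G ↦ √V u` from the energy space to `L²`. -/
def sqrtMul {V : R3 → ℝ} (hV : Admissible V) : Energy →L[ℝ] L2 :=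
  (ContinuousLinearMap.mul ℝ ℝ).holderL volume 3 6 2 (hV.memLp_sqrt.toLp _) ∘L embL6

lemma coeFn_sqrtMul {V : R3 → ℝ} (hV : Admissible V) (G : Energy) :
    sqrtMul hV G =ᵐ[volume] fun x => √(V x) * embL6 G x := by
  have h := (ContinuousLinearMap.mul ℝ ℝ).coeFn_holder (r := 2) (hV.memLp_sqrt.toLp _) (embL6 G)
  filter_upwards [h, hV.memLp_sqrt.coeFn_toLp] with x h1 h2
  have h1' : sqrtMul hV G x = _ := h1
  rw [h1', h2]
  rfl

/-- The operator `(-Δ)⁻¹ V` on the energy space. -/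
def newtonMul {V : R3 → ℝ} (hV : Admissible V) : Energy →L[ℝ] Energy :=
  (sqrtMul hV).adjoint ∘L sqrtMul hV

section Potential

variable {V : R3 → ℝ} (hV : Admissible V)

lemma inner_newtonMul' (G H : Energy) :
    inner ℝ (newtonMul hV G) H = inner ℝ (sqrtMul hV G) (sqrtMul hV H) := by
  rw [newtonMul, ContinuousLinearMap.comp_apply, ContinuousLinearMap.adjoint_inner_left]

/-- This identifies `A*A` with the weak solution operator of `-Δw = Vu`. -/
lemma inner_newtonMul (G H : Energy) :
    inner ℝ (newtonMul hV G) H = ∫ x, (V x * embL6 G x) * embL6 H x := by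
  rw [inner_newtonMul', inner_L2_eq_integral]
  refine integral_congr_ae ?_
  filter_upwards [coeFn_sqrtMul hV G, coeFn_sqrtMul hV H] with x h1 h2
  rw [h1, h2]
  linear_combination (embL6 G x * embL6 H x) * Real.mul_self_sqrt (hV.nonneg x)

lemma isSymmetric_newtonMul : (newtonMul hV).IsSymmetric := fun G H => by
  change inner ℝ (newtonMul hV G) H = inner ℝ G (newtonMul hV H)
  exact (inner_newtonMul' hV G H).trans ((real_inner_comm _ _).trans
    ((inner_newtonMul' hV H G).symm.trans (real_inner_comm _ _)))

/-! ### Compactness -/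

/-- At each point the mollification of `z n` is its inner product with one fixed element, a
translated kernel. Weak convergence therefore gives pointwise convergence, and dominated convergence
on the support of `U` gives convergence in `L^{6/5}`. -/
lemma tendsto_integral_mul_correl {z : ℕ → Energy} {M : ℝ} (hM : ∀ n, ‖z n‖ ≤ M)
    (hz : ∀ H : Energy, Filter.Tendsto (fun n => inner ℝ H (z n)) Filter.atTop (nhds 0))
    {U : R3 → ℝ} (hU : Continuous U) (hU' : HasCompactSupport U) {ε : ℝ} (hε : 0 < ε) :
    Filter.Tendsto (fun n => ∫ x, (U x * embL6 (z n) x) * correl (moll ε) (embL6 (z n)) x)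
      Filter.atTop (nhds 0) := by
  set φ : ℕ → R3 → ℝ := fun n => correl (moll ε) (embL6 (z n))
  set C := (eLpNorm (moll ε) (6 / 5) volume).toReal * (‖embL6‖ * M)
  have hn6 : ∀ n, (eLpNorm (embL6 (z n)) 6 volume).toReal ≤ ‖embL6‖ * M := fun n => by
    rw [← Lp.norm_def]
    exact (embL6.le_opNorm _).trans (by gcongr; exact hM n)
  have hφC : ∀ n x, |φ n x| ≤ C := fun n x =>
    (abs_correl_le (6 / 5) 6 (memLp_moll hε) (memLp_embL6 (z n)) x).trans
      (mul_le_mul_of_nonneg_left (hn6 n) ENNReal.toReal_nonneg)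
  have hφ0 : ∀ x, Filter.Tendsto (fun n => φ n x) Filter.atTop (nhds 0) := by
    intro x
    obtain ⟨K, -, hK⟩ := exists_newton hε
    refine (hz (shiftE (-x) K)).congr fun n => ?_
    rw [inner_shiftE, neg_neg, hK, correl_congr (embL6_shiftE x (z n))]
    simp [φ, correl]
  have hm : ∀ n, AEStronglyMeasurable (fun x => U x * φ n x) volume := fun n =>
    (integrable_mul_correl_swap (embL6 (z n)) (integrable_moll hε)
      (hU.memLp_of_hasCompactSupport hU')).1
  have hle : ∀ n x, ‖U x * φ n x‖ ≤ ‖C * U x‖ := fun n x => by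
    have hC : 0 ≤ C := (abs_nonneg _).trans (hφC n x)
    rw [norm_mul, norm_mul, mul_comm, Real.norm_eq_abs (φ n x), Real.norm_of_nonneg hC]
    gcongr
    exact hφC n x
  have hCU : MemLp (fun x => C * U x) (6 / 5) volume :=
    (hU.memLp_of_hasCompactSupport hU').const_mul C
  have hmem : ∀ n, MemLp (fun x => U x * φ n x) (6 / 5) volume := fun n =>
    hCU.of_le (hm n) (.of_forall (hle n))
  have h65 : (6 / 5 : ℝ≥0∞) ≠ 0 := (zero_lt_one.trans_le factSixFifths.out).ne'
  have h65' : (6 / 5 : ℝ≥0∞) ≠ ⊤ := ENNReal.div_ne_top (by simp) (by simp)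
  have h65r : (6 / 5 : ℝ≥0∞).toReal = 6 / 5 := by simp
  have hlim : Filter.Tendsto (fun n => ∫ x, ‖U x * φ n x‖ ^ (6 / 5 : ℝ)) Filter.atTop (nhds 0) := by
    have h0 : (0 : ℝ) = ∫ _ : R3, (0 : ℝ) := by simp
    rw [h0]
    refine tendsto_integral_of_dominated_convergence (fun x => ‖C * U x‖ ^ (6 / 5 : ℝ))
      (fun n => ?_) ?_ (fun n => .of_forall fun x => ?_) (.of_forall fun x => ?_)
    · exact ((hm n).norm.aemeasurable.pow_const _).aestronglyMeasurable
    · have := hCU.integrable_norm_rpow h65 h65'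
      rwa [h65r] at this
    · rw [Real.norm_of_nonneg (by positivity)]
      exact Real.rpow_le_rpow (norm_nonneg _) (hle n x) (by norm_num)
    · have h1 : Filter.Tendsto (fun n => ‖U x * φ n x‖) Filter.atTop (nhds 0) := by
        simpa using ((hφ0 x).const_mul (U x)).norm
      have h2 := h1.rpow_const (p := 6 / 5) (Or.inr (by norm_num))
      rwa [Real.zero_rpow (by norm_num)] at h2
  have hlim2 : Filter.Tendsto (fun n => (eLpNorm (fun x => U x * φ n x) (6 / 5) volume).toReal)
      Filter.atTop (nhds 0) := by
    have h2 := hlim.rpow_const (p := (6 / 5 : ℝ)⁻¹) (Or.inr (by norm_num))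
    rw [Real.zero_rpow (by norm_num)] at h2
    refine h2.congr fun n => ?_
    rw [(hmem n).eLpNorm_eq_integral_rpow_norm h65 h65', h65r,
      ENNReal.toReal_ofReal (by positivity)]
  have hlim3 := hlim2.mul_const (‖embL6‖ * M)
  rw [zero_mul] at hlim3
  refine squeeze_zero_norm (fun n => ?_) hlim3
  have e : ∫ x, (U x * embL6 (z n) x) * correl (moll ε) (embL6 (z n)) x =
      ∫ x, (U x * φ n x) * embL6 (z n) x := by
    refine integral_congr_ae (.of_forall fun x => ?_)
    simp only [φ]
    ring
  rw [e]
  exact (abs_integral_mul_le (6 / 5) 6 (hmem n) (memLp_embL6 (z n))).trans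
    (by gcongr; exact hn6 n)

/-- Replacing one factor by its mollification costs `B ε` uniformly in `n`, so `ε` can be fixed
before `n` tends to infinity. The mollifier has total mass `c`, not one, which accounts for the
factors `c`. -/
lemma tendsto_integral_mul_sq {z : ℕ → Energy} {M : ℝ} (hM : ∀ n, ‖z n‖ ≤ M)
    (hz : ∀ H : Energy, Filter.Tendsto (fun n => inner ℝ H (z n)) Filter.atTop (nhds 0))
    {U : R3 → ℝ} (hU : Continuous U) (hU' : HasCompactSupport U) :
    Filter.Tendsto (fun n => ∫ x, (U x * embL6 (z n) x) * embL6 (z n) x)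
      Filter.atTop (nhds 0) := by
  have hM0 : 0 ≤ M := (norm_nonneg _).trans (hM 0)
  set c := ∫ x, moll 1 x
  have hc : 0 < c := integral_moll_pos one_pos
  set B := 3 * ((eLpNorm U 3 volume).toReal * (‖embL6‖ * M)) * M * ∫ h, moll 1 h * ‖h‖
  have hB : 0 ≤ B := mul_nonneg (by positivity)
    (integral_nonneg fun h => mul_nonneg (moll_pos one_pos h).le (norm_nonneg h))
  have hn6 : ∀ n, (eLpNorm (embL6 (z n)) 6 volume).toReal ≤ ‖embL6‖ * M := fun n => by
    rw [← Lp.norm_def]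
    exact (embL6.le_opNorm _).trans (by gcongr; exact hM n)
  have hU3 : MemLp U 3 volume := hU.memLp_of_hasCompactSupport hU'
  have hU32 : MemLp U (3 / 2) volume := hU.memLp_of_hasCompactSupport hU'
  have key : ∀ ε : ℝ, 0 < ε → ∀ n,
      |(∫ x, (U x * embL6 (z n) x) * correl (moll ε) (embL6 (z n)) x) -
        c * ∫ x, (U x * embL6 (z n) x) * embL6 (z n) x| ≤ B * ε := by
    intro ε hε n
    have g2 : MemLp (fun x => U x * embL6 (z n) x) 2 volume := (memLp_embL6 (z n)).mul hU3
    have g65 : MemLp (fun x => U x * embL6 (z n) x) (6 / 5) volume := (memLp_embL6 (z n)).mul hU32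
    have h1 := abs_integral_mul_correl_sub_le (fun h => (moll_pos hε h).le) (integrable_moll hε)
      (integrable_moll_mul_norm hε) g2 g65 (z n)
    rw [integral_moll hε, integral_moll_mul_norm hε] at h1
    refine h1.trans ?_
    have h2 : (eLpNorm (fun x => U x * embL6 (z n) x) 2 volume).toReal ≤
        (eLpNorm U 3 volume).toReal * (‖embL6‖ * M) :=
      (toReal_eLpNorm_mul_le 3 6 2 hU3 (memLp_embL6 (z n))).trans (by gcongr; exact hn6 n)
    have h3 : 0 ≤ ∫ h, moll 1 h * ‖h‖ :=
      integral_nonneg fun h => mul_nonneg (moll_pos one_pos h).le (norm_nonneg h)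
    calc _ ≤ 3 * ((eLpNorm U 3 volume).toReal * (‖embL6‖ * M)) * M *
          (ε * ∫ h, moll 1 h * ‖h‖) := by gcongr; exact hM n
      _ = B * ε := by simp only [B]; ring
  rw [Metric.tendsto_atTop]
  intro δ hδ
  set ε := c * δ / (2 * (B + 1))
  have hε : 0 < ε := by positivity
  have hεB : B * ε < c * δ / 2 := by
    have : (B + 1) * ε = c * δ / 2 := by simp only [ε]; field_simp
    nlinarith
  obtain ⟨n₀, hn₀⟩ := Metric.tendsto_atTop.1 (tendsto_integral_mul_correl hM hz hU hU' hε)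
    (c * δ / 2) (by positivity)
  refine ⟨n₀, fun n hn => ?_⟩
  have h1 := hn₀ n hn
  have h2 := key ε hε n
  rw [Real.dist_eq, sub_zero] at h1 ⊢
  rw [← mul_lt_mul_iff_right₀ hc, ← abs_of_pos hc, ← abs_mul, abs_of_pos hc]
  rw [abs_lt] at h1 ⊢
  rw [abs_le] at h2
  constructor <;> linarith [h1.1, h1.2, h2.1, h2.2]

/-- Approximate `V` in `L^{3/2}` by a continuous `U` of compact support: the squares of the
functions are bounded in the dual space `L³`, so the error is uniform in `n`. -/
lemma tendsto_sqrtMul {z : ℕ → Energy} {M : ℝ} (hM : ∀ n, ‖z n‖ ≤ M)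
    (hz : ∀ H : Energy, Filter.Tendsto (fun n => inner ℝ H (z n)) Filter.atTop (nhds 0)) :
    Filter.Tendsto (fun n => sqrtMul hV (z n)) Filter.atTop (nhds 0) := by
  have hM0 : 0 ≤ M := (norm_nonneg _).trans (hM 0)
  have hsq : Filter.Tendsto (fun n => ‖sqrtMul hV (z n)‖ ^ 2) Filter.atTop (nhds 0) := by
    have e : ∀ n, ‖sqrtMul hV (z n)‖ ^ 2 = ∫ x, (V x * embL6 (z n) x) * embL6 (z n) x := fun n => by
      rw [← real_inner_self_eq_norm_sq, ← inner_newtonMul', inner_newtonMul]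
    simp only [e]
    set B := (‖embL6‖ * M) * (‖embL6‖ * M)
    have hB : 0 ≤ B := by positivity
    have hn6 : ∀ n, (eLpNorm (embL6 (z n)) 6 volume).toReal ≤ ‖embL6‖ * M := fun n => by
      rw [← Lp.norm_def]
      exact (embL6.le_opNorm _).trans (by gcongr; exact hM n)
    rw [Metric.tendsto_atTop]
    intro δ hδ
    obtain ⟨U, hU', hUn, hU, hUp⟩ := hV.memLp_threeHalves.exists_hasCompactSupport_eLpNorm_sub_le
      (ENNReal.div_ne_top (by simp) (by simp)) (ε := ENNReal.ofReal (δ / (2 * (B + 1)))) (by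
        have : 0 < δ / (2 * (B + 1)) := by positivity
        simpa using this)
    have hUn' : (eLpNorm (V - U) (3 / 2) volume).toReal ≤ δ / (2 * (B + 1)) :=
      ENNReal.toReal_le_of_le_ofReal (by positivity) hUn
    obtain ⟨n₀, hn₀⟩ := Metric.tendsto_atTop.1 (tendsto_integral_mul_sq hM hz hU hU') (δ / 2)
      (by positivity)
    refine ⟨n₀, fun n hn => ?_⟩
    have h1 := hn₀ n hn
    have hu2 : MemLp (fun x => embL6 (z n) x * embL6 (z n) x) 3 volume :=
      (memLp_embL6 (z n)).mul (memLp_embL6 (z n))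
    have h2 := abs_integral_mul_le (3 / 2) 3 (hV.memLp_threeHalves.sub hUp) hu2
    have h3 := toReal_eLpNorm_mul_le 6 6 3 (memLp_embL6 (z n)) (memLp_embL6 (z n))
    have h4 : (eLpNorm (fun x => embL6 (z n) x * embL6 (z n) x) 3 volume).toReal ≤ B :=
      h3.trans (mul_le_mul (hn6 n) (hn6 n) (by positivity) (by positivity))
    have h5 : |∫ x, (V - U) x * (embL6 (z n) x * embL6 (z n) x)| < δ / 2 := by
      refine (h2.trans (mul_le_mul hUn' h4 (by positivity) (by positivity))).trans_lt ?_
      have : δ / (2 * (B + 1)) * (B + 1) = δ / 2 := by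
        have : B + 1 ≠ 0 := by positivity
        field_simp
      have : 0 < δ / (2 * (B + 1)) := by positivity
      linarith
    have h6 : ∫ x, (V - U) x * (embL6 (z n) x * embL6 (z n) x) =
        (∫ x, (V x * embL6 (z n) x) * embL6 (z n) x) -
          ∫ x, (U x * embL6 (z n) x) * embL6 (z n) x := by
      rw [← integral_sub]
      · refine integral_congr_ae (.of_forall fun x => ?_)
        simp only [Pi.sub_apply]
        ring
      · exact integrable_mul_of_memLp (6 / 5) 6 (hV.memLp_mul_six (memLp_embL6 _)) (memLp_embL6 _)
      · exact integrable_mul_of_memLp (6 / 5) 6 ((memLp_embL6 (z n)).mul hUp) (memLp_embL6 _)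
    rw [h6] at h5
    rw [Real.dist_eq, sub_zero] at h1 ⊢
    rw [abs_lt] at h1 h5 ⊢
    constructor <;> linarith [h1.1, h1.2, h5.1, h5.2]
  have h := hsq.sqrt
  simp only [Real.sqrt_sq (norm_nonneg _), Real.sqrt_zero] at h
  exact tendsto_zero_iff_norm_tendsto_zero.2 h

/-- Separability permits the sequential form of Banach–Alaoglu in `isCompactOperator_sqrtMul`. -/
instance : TopologicalSpace.SeparableSpace Energy := by
  have : Fact ((2 : ℝ≥0∞) ≠ ⊤) := ⟨by norm_num⟩
  have : SecondCountableTopology L2 := inferInstance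
  have : SecondCountableTopology Fields := inferInstance
  infer_instance

/-- A sequence in the unit ball has a weakly convergent subsequence; the differences from its limit
are weakly null and bounded by `2`, so `tendsto_sqrtMul` makes their images converge to zero in
norm. -/
lemma isCompactOperator_sqrtMul : IsCompactOperator (sqrtMul hV) := by
  refine (isCompactOperator_iff_image_closedBall_subset_compact
    (sqrtMul hV : Energy →ₗ[ℝ] L2) one_pos).2 ?_
  refine ⟨_, IsSeqCompact.isCompact ?_, subset_rfl⟩
  intro y hy
  choose x hx hxy using hy
  have hmem : ∀ n, StrongDual.toWeakDual (InnerProductSpace.toDual ℝ Energy (x n)) ∈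
      WeakDual.toStrongDual ⁻¹' Metric.closedBall (0 : StrongDual ℝ Energy) 1 := fun n => by
    have h1 := mem_closedBall_zero_iff.1 (hx n)
    refine (mem_closedBall_zero_iff (E := StrongDual ℝ Energy)).2 ?_
    rw [← LinearIsometryEquiv.norm_map (InnerProductSpace.toDual ℝ Energy)] at h1
    exact h1
  obtain ⟨f, hf, φ, hφ, hlim⟩ := WeakDual.isSeqCompact_closedBall ℝ Energy 0 1 hmem
  set x' := (InnerProductSpace.toDual ℝ Energy).symm (WeakDual.toStrongDual f)
  have hx' : ‖x'‖ ≤ 1 := by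
    rw [LinearIsometryEquiv.norm_map]
    exact (mem_closedBall_zero_iff (E := StrongDual ℝ Energy)).1 hf
  refine ⟨sqrtMul hV x', ⟨x', by simpa using hx', rfl⟩, φ, hφ, ?_⟩
  have h0 : Filter.Tendsto (fun n => sqrtMul hV (x (φ n) - x')) Filter.atTop (nhds 0) := by
    refine tendsto_sqrtMul hV (M := 2) (fun n => ?_) fun H => ?_
    · have := hx (φ n)
      rw [mem_closedBall_zero_iff] at this
      exact (norm_sub_le _ _).trans (by linarith)
    · have h1 := ((WeakDual.eval_continuous (𝕜 := ℝ) H).tendsto f).comp hlim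
      have h2 : f H = inner ℝ x' H :=
        (InnerProductSpace.toDual_symm_apply (𝕜 := ℝ) (x := H)
          (y := WeakDual.toStrongDual f)).symm
      have h3 := h1.sub_const (f H)
      rw [sub_self] at h3
      refine h3.congr fun n => ?_
      rw [h2, inner_sub_right, real_inner_comm (x (φ n)) H, real_inner_comm x' H]
      rfl
  have h1 := h0.add_const (sqrtMul hV x')
  rw [zero_add] at h1
  refine h1.congr fun n => ?_
  rw [map_sub, sub_add_cancel, Function.comp, ← hxy]
  rfl

lemma isCompactOperator_newtonMul : IsCompactOperator (newtonMul hV) :=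
  (isCompactOperator_sqrtMul hV).clm_comp (sqrtMul hV).adjoint

end Potential

/-! ### The nonlinearity -/

/-- The operator `(-Δ)⁻¹ u⁵` on the energy space. -/
def newtonPow (G : Energy) : Energy :=
  (InnerProductSpace.toDual ℝ Energy).symm
    (integralCLM (6 / 5) 6 (memLp_pow_five (memLp_embL6 G)) ∘L embL6)

lemma inner_newtonPow (G H : Energy) :
    inner ℝ (newtonPow G) H = ∫ x, embL6 G x ^ 5 * embL6 H x :=
  InnerProductSpace.toDual_symm_apply (𝕜 := ℝ) (x := H)
    (y := integralCLM (6 / 5) 6 (memLp_pow_five (memLp_embL6 G)) ∘L embL6)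

lemma newtonPow_smul (s : ℝ) (G : Energy) : newtonPow (s • G) = s ^ 5 • newtonPow G := by
  refine ext_inner_right ℝ fun H => ?_
  refine Eq.trans ?_ (real_inner_smul_left (newtonPow G) H (s ^ 5)).symm
  rw [inner_newtonPow, inner_newtonPow, map_smul, ← integral_const_mul]
  refine integral_congr_ae ?_
  filter_upwards [Lp.coeFn_smul s (embL6 G)] with x hx
  rw [hx, Pi.smul_apply, smul_eq_mul]
  ring

/-- The pairing is `∫ u⁶`. Its sign decides that the branch bifurcates towards larger `α`. -/
lemma inner_newtonPow_self_pos {G : Energy} (hG : G ≠ 0) : 0 < inner ℝ (newtonPow G) G := by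
  have e : ∀ x, embL6 G x ^ 5 * embL6 G x = (embL6 G x ^ 2) ^ 3 := fun x => by ring
  rw [inner_newtonPow]
  have h0 : ∀ x, 0 ≤ embL6 G x ^ 5 * embL6 G x := fun x => by rw [e]; positivity
  refine lt_of_le_of_ne (integral_nonneg h0) fun h => hG ?_
  have h1 := (integral_eq_zero_iff_of_nonneg h0 (integrable_mul_of_memLp (6 / 5) 6
    (memLp_pow_five (memLp_embL6 G)) (memLp_embL6 G))).1 h.symm
  refine energy_eq_of_embL6_ae_eq ?_
  rw [map_zero]
  filter_upwards [h1, Lp.coeFn_zero ℝ 6 (volume : Measure R3)] with x h2 h3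
  rw [h3]
  rw [e] at h2
  simpa using h2

lemma abs_pow_five_sub_le (a b : ℝ) : |a ^ 5 - b ^ 5| ≤ 5 * ((|a| + |b|) ^ 4 * |a - b|) := by
  have e : a ^ 5 - b ^ 5 = (a ^ 4 + a ^ 3 * b + a ^ 2 * b ^ 2 + a * b ^ 3 + b ^ 4) * (a - b) := by
    ring
  rw [e, abs_mul, ← mul_assoc]
  gcongr
  have ha := abs_nonneg a
  have hb := abs_nonneg b
  have h : ∀ k l : ℕ, k + l = 4 → |a ^ k * b ^ l| ≤ (|a| + |b|) ^ 4 := by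
    intro k l hkl
    rw [abs_mul, abs_pow, abs_pow, ← hkl, pow_add]
    gcongr <;> linarith
  have h1 := h 4 0 rfl
  have h2 := h 3 1 rfl
  have h3 := h 2 2 rfl
  have h4 := h 1 3 rfl
  have h5 := h 0 4 rfl
  simp only [pow_zero, mul_one, one_mul, pow_one] at h1 h2 h4 h5
  rw [abs_le] at *
  constructor <;> linarith [h1.1, h1.2, h2.1, h2.2, h3.1, h3.2, h4.1, h4.2, h5.1, h5.2]

/-- Hölder puts `(|u|+|v|)⁴ |u-v|` in `L^{6/5}`, the dual of `L⁶`, after which the difference `D` is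
tested against itself. Of the six factors `‖embL6‖`, five come from the integrand and one from the
test function. -/
lemma exists_norm_newtonPow_sub_le : ∃ C : ℝ, 0 ≤ C ∧ ∀ G H : Energy,
    ‖newtonPow G - newtonPow H‖ ≤ C * (‖G‖ + ‖H‖) ^ 4 * ‖G - H‖ := by
  set k := ‖embL6‖
  refine ⟨5 * k ^ 6, by positivity, fun G H => ?_⟩
  set u : R3 → ℝ := ⇑(embL6 G)
  set v : R3 → ℝ := ⇑(embL6 H)
  set D := newtonPow G - newtonPow H
  have hn : ∀ G : Energy, (eLpNorm (embL6 G) 6 volume).toReal ≤ k * ‖G‖ := fun G => by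
    rw [← Lp.norm_def]; exact embL6.le_opNorm G
  have hu : MemLp u 6 volume := memLp_embL6 G
  have hv : MemLp v 6 volume := memLp_embL6 H
  have hd : MemLp (fun x => u x - v x) 6 volume := hu.sub hv
  have hw : MemLp (fun x => |u x| + |v x|) 6 volume := hu.norm.add hv.norm
  have hwn : (eLpNorm (fun x => |u x| + |v x|) 6 volume).toReal ≤ k * (‖G‖ + ‖H‖) := by
    have h1 : eLpNorm (fun x => |u x| + |v x|) 6 volume ≤
        eLpNorm (fun x => ‖u x‖) 6 volume + eLpNorm (fun x => ‖v x‖) 6 volume :=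
      eLpNorm_add_le hu.norm.1 hv.norm.1 (by norm_num)
    rw [eLpNorm_norm, eLpNorm_norm] at h1
    refine (ENNReal.toReal_mono (ENNReal.add_ne_top.2 ⟨hu.2.ne, hv.2.ne⟩) h1).trans ?_
    rw [ENNReal.toReal_add hu.2.ne hv.2.ne, mul_add]
    exact add_le_add (hn G) (hn H)
  have hdn : (eLpNorm (fun x => u x - v x) 6 volume).toReal ≤ k * ‖G - H‖ := by
    refine le_trans (le_of_eq ?_) (hn (G - H))
    rw [map_sub]
    congr 1
    exact eLpNorm_congr_ae (Lp.coeFn_sub (embL6 G) (embL6 H)).symm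
  have hw2 : MemLp (fun x => (|u x| + |v x|) * (|u x| + |v x|)) 3 volume := hw.mul hw
  have hw4 : MemLp (fun x => ((|u x| + |v x|) * (|u x| + |v x|)) *
    ((|u x| + |v x|) * (|u x| + |v x|))) (3 / 2) volume := hw2.mul hw2
  have hw5 : MemLp (fun x => (((|u x| + |v x|) * (|u x| + |v x|)) *
    ((|u x| + |v x|) * (|u x| + |v x|))) * (u x - v x)) (6 / 5) volume := hd.mul hw4
  have n2 := toReal_eLpNorm_mul_le 6 6 3 hw hw
  have n4 := toReal_eLpNorm_mul_le 3 3 (3 / 2) hw2 hw2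
  have n5 := toReal_eLpNorm_mul_le (3 / 2) 6 (6 / 5) hw4 hd
  have m2 := n2.trans (mul_le_mul hwn hwn (by positivity) (by positivity))
  have m4 := n4.trans (mul_le_mul m2 m2 (by positivity) (by positivity))
  have m5 := n5.trans (mul_le_mul m4 hdn (by positivity) (by positivity))
  have hp : MemLp (fun x => u x ^ 5 - v x ^ 5) (6 / 5) volume :=
    (memLp_pow_five hu).sub (memLp_pow_five hv)
  have n6 : (eLpNorm (fun x => u x ^ 5 - v x ^ 5) (6 / 5) volume).toReal ≤
      5 * (k ^ 5 * (‖G‖ + ‖H‖) ^ 4 * ‖G - H‖) := by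
    have h5 : MemLp (fun x => (5 : ℝ) * ((((|u x| + |v x|) * (|u x| + |v x|)) *
      ((|u x| + |v x|) * (|u x| + |v x|))) * (u x - v x))) (6 / 5) volume := hw5.const_mul 5
    refine (ENNReal.toReal_mono h5.2.ne (eLpNorm_mono fun x => ?_)).trans ?_
    · have habs : ∀ a d : ℝ, |5 * ((a * a * (a * a)) * d)| = 5 * (a ^ 4 * |d|) := by
        intro a d
        rw [abs_mul, abs_mul, abs_of_nonneg (by norm_num : (0 : ℝ) ≤ 5),
          abs_of_nonneg (mul_nonneg (mul_self_nonneg a) (mul_self_nonneg a))]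
        ring
      rw [Real.norm_eq_abs, Real.norm_eq_abs, habs]
      exact abs_pow_five_sub_le (u x) (v x)
    · have : eLpNorm (fun x => (5 : ℝ) * ((((|u x| + |v x|) * (|u x| + |v x|)) *
          ((|u x| + |v x|) * (|u x| + |v x|))) * (u x - v x))) (6 / 5) volume = 5 *
          eLpNorm (fun x => (((|u x| + |v x|) * (|u x| + |v x|)) *
          ((|u x| + |v x|) * (|u x| + |v x|))) * (u x - v x)) (6 / 5) volume := by
        have := eLpNorm_const_smul (5 : ℝ) (fun x => (((|u x| + |v x|) * (|u x| + |v x|)) *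
          ((|u x| + |v x|) * (|u x| + |v x|))) * (u x - v x)) (6 / 5) volume
        have e5 : ‖(5 : ℝ)‖ₑ = 5 := by
          rw [Real.enorm_of_nonneg (by norm_num)]; norm_num
        rw [e5] at this
        exact this
      rw [this, ENNReal.toReal_mul]
      refine (mul_le_mul_of_nonneg_left m5 (by positivity)).trans (le_of_eq ?_)
      simp
      ring
  have hD : ‖D‖ * ‖D‖ ≤ (5 * k ^ 6 * (‖G‖ + ‖H‖) ^ 4 * ‖G - H‖) * ‖D‖ := by
    rw [← real_inner_self_eq_norm_mul_norm]
    have e : inner ℝ D D = ∫ x, (u x ^ 5 - v x ^ 5) * embL6 D x := by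
      conv_lhs => rw [show D = newtonPow G - newtonPow H from rfl, inner_sub_left]
      rw [inner_newtonPow, inner_newtonPow, ← integral_sub]
      · simp only [sub_mul]; rfl
      · exact integrable_mul_of_memLp (6 / 5) 6 (memLp_pow_five hu) (memLp_embL6 _)
      · exact integrable_mul_of_memLp (6 / 5) 6 (memLp_pow_five hv) (memLp_embL6 _)
    rw [e]
    refine (le_abs_self _).trans ((abs_integral_mul_le (6 / 5) 6 hp (memLp_embL6 D)).trans
      ((mul_le_mul n6 (hn D) (by positivity) (by positivity)).trans (le_of_eq ?_)))
    ring
  rcases (norm_nonneg D).eq_or_lt with h0 | h0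
  · rw [← h0]; positivity
  · exact le_of_mul_le_mul_right hD h0

/-! ### Bifurcation from a simple eigenvalue for homogeneous perturbations -/

section Bifurcation

variable {E : Type*} [NormedAddCommGroup E]

/-- A small factor `σ` turns a bounded Lipschitz map into a contraction of the ball. The bound `σ *
M` on the fixed point records that it shrinks with `σ`. -/
lemma exists_fixedPoint_smul [NormedSpace ℝ E] [CompleteSpace E] {H : E → E} {r M L σ : ℝ}
    (hr : 0 ≤ r)
    (hM : ∀ y, ‖y‖ ≤ r → ‖H y‖ ≤ M)
    (hL : ∀ y y', ‖y‖ ≤ r → ‖y'‖ ≤ r → ‖H y - H y'‖ ≤ L * ‖y - y'‖)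
    (hσ : 0 ≤ σ) (hσM : σ * M ≤ r) (hσL : σ * L ≤ 1 / 2) :
    ∃ y, ‖y‖ ≤ r ∧ ‖y‖ ≤ σ * M ∧ y = σ • H y ∧ ∀ y', ‖y'‖ ≤ r → y' = σ • H y' → y' = y := by
  have hnorm : ∀ y, ‖y‖ ≤ r → ‖σ • H y‖ ≤ σ * M := fun y hy => by
    rw [norm_smul, Real.norm_of_nonneg hσ]
    exact mul_le_mul_of_nonneg_left (hM y hy) hσ
  have hlip : ∀ y y', ‖y‖ ≤ r → ‖y'‖ ≤ r → ‖σ • H y - σ • H y'‖ ≤ 1 / 2 * ‖y - y'‖ := by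
    intro y y' hy hy'
    rw [← smul_sub, norm_smul, Real.norm_of_nonneg hσ]
    calc σ * ‖H y - H y'‖ ≤ σ * (L * ‖y - y'‖) := mul_le_mul_of_nonneg_left (hL y y' hy hy') hσ
      _ = (σ * L) * ‖y - y'‖ := by ring
      _ ≤ _ := mul_le_mul_of_nonneg_right hσL (norm_nonneg _)
  set B : Set E := Metric.closedBall 0 r
  have hmaps : MapsTo (fun y => σ • H y) B B := fun y hy => by
    rw [mem_closedBall_zero_iff] at hy ⊢
    exact (hnorm y hy).trans hσM
  have hcontr : ContractingWith (1 / 2 : NNReal) (hmaps.restrict (fun y => σ • H y) B B) := by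
    refine ⟨by rw [← NNReal.coe_lt_coe]; norm_num, LipschitzWith.of_dist_le_mul fun x y => ?_⟩
    have hx := mem_closedBall_zero_iff.1 x.2
    have hy := mem_closedBall_zero_iff.1 y.2
    have := hlip x y hx hy
    rw [Subtype.dist_eq, Subtype.dist_eq, dist_eq_norm, dist_eq_norm]
    simpa using this
  obtain ⟨y, hyB, hfix, -⟩ := ContractingWith.exists_fixedPoint'
    (Metric.isClosed_closedBall.isComplete) hmaps hcontr (x := (0 : E))
    (Metric.mem_closedBall_self hr) (edist_ne_top _ _)
  have hy := mem_closedBall_zero_iff.1 hyB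
  have hfix' : σ • H y = y := hfix
  refine ⟨y, hy, ?_, hfix'.symm, fun y' hy' hfy' => ?_⟩
  · conv_lhs => rw [← hfix']
    exact hnorm y hy
  · have := hlip y' y hy' hy
    rw [← hfy', hfix'] at this
    have h0 := norm_nonneg (y' - y)
    exact sub_eq_zero.1 (norm_eq_zero.1 (by linarith))

variable [InnerProductSpace ℝ E] [CompleteSpace E]

/-- `S` inverts `1 - λ⁻¹T` on the complement of `e`. Subtracting `λ` times the projection onto `e`
from `T` removes the eigenvalue: an eigenvector of the difference for `λ` is orthogonal to `e`,
hence an eigenvector of `T`, hence zero by simplicity. The Fredholm alternative then gives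
invertibility. -/
lemma exists_reducedResolvent {T : E →L[ℝ] E} (hT : IsCompactOperator T) (hT' : T.IsSymmetric)
    {e : E} (he : ‖e‖ = 1) {lam : ℝ} (hlam : lam ≠ 0) (hTe : T e = lam • e)
    (hsimple : ∀ z, T z = lam • z → ∃ c : ℝ, z = c • e) :
    ∃ S : E →L[ℝ] E, S e = 0 ∧ (∀ z, inner ℝ e z = 0 → S (z - lam⁻¹ • T z) = z) ∧
      ∀ g, inner ℝ e (S g) = 0 ∧ S g - lam⁻¹ • T (S g) = g - (inner ℝ e g : ℝ) • e := by
  have hee : inner ℝ e e = 1 := by rw [real_inner_self_eq_norm_sq, he, one_pow]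
  have hsym : ∀ x, inner ℝ e (T x) = lam * inner ℝ e x := fun x => by
    have h := hT' e x
    change inner ℝ (T e) x = inner ℝ e (T x) at h
    rw [← h, hTe, real_inner_smul_left]
  let P : E →L[ℝ] E := (ContinuousLinearMap.toSpanSingleton ℝ e) ∘L (innerSL ℝ e)
  have hP : ∀ x, P x = (inner ℝ e x : ℝ) • e := fun x => rfl
  have hPc : IsCompactOperator P :=
    IsCompactOperator.clm_comp (f := innerSL ℝ e)
      (isCompactOperator_of_locallyCompactSpace_dom (innerSL ℝ e : E →L[ℝ] ℝ))
      (ContinuousLinearMap.toSpanSingleton ℝ e)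
  let T' : E →L[ℝ] E := T - lam • P
  have hT'x : ∀ x, T' x = T x - (lam * inner ℝ e x) • e := fun x => by
    change T x - lam • P x = _
    rw [hP, smul_smul]
  have hT'c : IsCompactOperator T' := hT.sub (hPc.smul lam)
  have hne : ¬ Module.End.HasEigenvalue (T' : Module.End ℝ E) lam := by
    intro h
    obtain ⟨z, hz⟩ := h.exists_hasEigenvector
    have h1 : T' z = lam • z := hz.apply_eq_smul
    have h2 : inner ℝ e z = 0 := by
      have h3 := congrArg (fun w => inner ℝ e w) h1
      simp only [hT'x, inner_sub_right, hsym, inner_smul_right, hee] at h3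
      have : lam * inner ℝ e z = 0 := by linarith
      exact (mul_eq_zero.1 this).resolve_left hlam
    rw [hT'x, h2, mul_zero, zero_smul, sub_zero] at h1
    obtain ⟨c, rfl⟩ := hsimple z h1
    rw [inner_smul_right, hee, mul_one] at h2
    exact hz.2 (by rw [h2, zero_smul])
  have hres := (hT'c.hasEigenvalue_or_mem_resolventSet hlam).resolve_left hne
  rw [spectrum.mem_resolventSet_iff] at hres
  obtain ⟨U, hU⟩ := hres
  have hUx : ∀ x, (U : E →L[ℝ] E) x = lam • x - T' x := fun x => by
    rw [hU]
    simp [Algebra.algebraMap_eq_smul_one]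
  let R : E →L[ℝ] E := ↑U⁻¹
  have hRU : ∀ x, R (lam • x - T' x) = x := fun x => by
    rw [← hUx]
    exact congrArg (fun f : E →L[ℝ] E => f x) U.inv_mul
  have hUR : ∀ x, lam • R x - T' (R x) = x := fun x => by
    rw [← hUx]
    exact congrArg (fun f : E →L[ℝ] E => f x) U.mul_inv
  let S : E →L[ℝ] E := lam • (R ∘L (ContinuousLinearMap.id ℝ E - P))
  have hS : ∀ g, S g = lam • R (g - (inner ℝ e g : ℝ) • e) := fun g => rfl
  refine ⟨S, ?_, fun z hz => ?_, fun g => ?_⟩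
  · rw [hS, hee, one_smul, sub_self, map_zero, smul_zero]
  · have h1 : inner ℝ e (z - lam⁻¹ • T z) = 0 := by
      rw [inner_sub_right, inner_smul_right, hsym, hz]; simp
    have h2 : lam • (z - lam⁻¹ • T z) = lam • z - T' z := by
      rw [smul_sub, smul_inv_smul₀ hlam, hT'x, hz, mul_zero, zero_smul, sub_zero]
    rw [hS, h1, zero_smul, sub_zero, ← map_smul, h2, hRU]
  · set k := g - (inner ℝ e g : ℝ) • e with hk
    have hek : inner ℝ e k = 0 := by
      rw [hk, inner_sub_right, inner_smul_right, hee]; ring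
    have h1 : inner ℝ e (R k) = 0 := by
      have h3 := congrArg (fun w => inner ℝ e w) (hUR k)
      simp only [hT'x, inner_sub_right, hsym, inner_smul_right, hee, hek] at h3
      have : lam * inner ℝ e (R k) = 0 := by linarith
      exact (mul_eq_zero.1 this).resolve_left hlam
    have h4 := hUR k
    rw [hT'x, h1, mul_zero, zero_smul, sub_zero] at h4
    rw [hS, ← hk]
    refine ⟨by rw [inner_smul_right, h1, mul_zero], ?_⟩
    rw [map_smul, inv_smul_smul₀ hlam, h4]

/-- Bifurcation from a simple eigenvalue of a compact symmetric operator for an equation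
`u = α T u - N u` with `N` homogeneous of degree five: close to the trivial solution and for `α`
slightly above the inverse of the eigenvalue, the nontrivial solutions are a pair `± s (e + y)`. -/
theorem exists_bifurcation {T : E →L[ℝ] E} (hT : IsCompactOperator T) (hT' : T.IsSymmetric)
    {e : E} (he : ‖e‖ = 1) {lam : ℝ} (hlam : 0 < lam) (hTe : T e = lam • e)
    (hsimple : ∀ z, T z = lam • z → ∃ c : ℝ, z = c • e) {N : E → E}
    (hhom : ∀ (s : ℝ) u, N (s • u) = s ^ 5 • N u) {C : ℝ} (hC : 0 ≤ C)
    (hlip : ∀ u v, ‖N u - N v‖ ≤ C * (‖u‖ + ‖v‖) ^ 4 * ‖u - v‖) (hpos : 0 < inner ℝ (N e) e) :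
    ∃ ε₀ : ℝ, 0 < ε₀ ∧ ∀ η : ℝ, 0 < η → ∃ δ : ℝ, 0 < δ ∧ ∀ α : ℝ, 1 / lam < α →
      α < 1 / lam + δ → ∃ (s : ℝ) (y : E), 0 < s ∧ ‖y‖ < η ∧ s • (e + y) ≠ 0 ∧
        ‖s • (e + y)‖ < η ∧ s • (e + y) = α • T (s • (e + y)) - N (s • (e + y)) ∧
        ∀ u, u ≠ 0 → ‖u‖ < ε₀ → u = α • T u - N u → u = s • (e + y) ∨ u = -(s • (e + y)) := by
  obtain ⟨S, hSe, hS1, hS2⟩ := exists_reducedResolvent hT hT' he hlam.ne' hTe hsimple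
  have hee : inner ℝ e e = 1 := by rw [real_inner_self_eq_norm_sq, he, one_pow]
  have hsym : ∀ x, inner ℝ e (T x) = lam * inner ℝ e x := fun x => by
    have h := hT' e x
    change inner ℝ (T e) x = inner ℝ e (T x) at h
    rw [← h, hTe, real_inner_smul_left]
  have hN0 : N 0 = 0 := by simpa using hhom 0 0
  have hNn : ∀ u, ‖N u‖ ≤ C * ‖u‖ ^ 5 := fun u => by
    have h := hlip u 0
    rw [hN0, sub_zero, sub_zero, norm_zero, add_zero] at h
    calc _ ≤ _ := h
      _ = _ := by ring
  set c : E → ℝ := fun y => inner ℝ (N (e + y)) e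
  set c₀ : ℝ := inner ℝ (N e) e
  set D := C * 4 ^ 4
  have hD : 0 ≤ D := by positivity
  have hball : ∀ y : E, ‖y‖ ≤ 1 → ‖e + y‖ ≤ 2 := fun y hy =>
    (norm_add_le _ _).trans (by rw [he]; linarith)
  have hNlip : ∀ y y' : E, ‖y‖ ≤ 1 → ‖y'‖ ≤ 1 → ‖N (e + y) - N (e + y')‖ ≤ D * ‖y - y'‖ := by
    intro y y' hy hy'
    have h := hlip (e + y) (e + y')
    rw [add_sub_add_left_eq_sub] at h
    refine h.trans ?_
    exact mul_le_mul_of_nonneg_right (mul_le_mul_of_nonneg_left (pow_le_pow_left₀ (by positivity)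
      (by linarith [hball y hy, hball y' hy']) 4) hC) (norm_nonneg _)
  have hNb : ∀ y : E, ‖y‖ ≤ 1 → ‖N (e + y)‖ ≤ C * 2 ^ 5 := fun y hy =>
    (hNn _).trans (by gcongr; exact hball y hy)
  have hclip : ∀ y y' : E, ‖y‖ ≤ 1 → ‖y'‖ ≤ 1 → |c y - c y'| ≤ D * ‖y - y'‖ := by
    intro y y' hy hy'
    simp only [c]
    rw [← inner_sub_left]
    refine (abs_real_inner_le_norm _ _).trans ?_
    rw [he, mul_one]
    exact hNlip y y' hy hy'
  -- On this ball `c` stays above `c₀ / 2`, since its Lipschitz constant is `D`.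
  set r := min 1 (c₀ / (2 * (D + 1)))
  have hr : 0 < r := by positivity
  have hr1 : ∀ y : E, ‖y‖ ≤ r → ‖y‖ ≤ 1 := fun y hy => hy.trans (min_le_left _ _)
  have hc : ∀ y : E, ‖y‖ ≤ r → c₀ / 2 ≤ c y := by
    intro y hy
    have h1 := hclip y 0 (hr1 y hy) (by simp)
    rw [sub_zero] at h1
    have h2 : c 0 = c₀ := by simp [c, c₀]
    have h3 : (D + 1) * ‖y‖ ≤ c₀ / 2 := by
      have := hy.trans (min_le_right _ _)
      rw [le_div_iff₀ (by positivity)] at this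
      linarith
    rw [h2] at h1
    have := (abs_le.1 h1).1
    nlinarith [norm_nonneg y]
  have hcpos : ∀ y : E, ‖y‖ ≤ r → 0 < c y := fun y hy => (half_pos hpos).trans_le (hc y hy)
  have hcinv : ∀ y : E, ‖y‖ ≤ r → (c y)⁻¹ ≤ 2 / c₀ := fun y hy => by
    rw [← inv_div]
    exact inv_anti₀ (half_pos hpos) (hc y hy)
  -- For `u = t(e + y)` the component along `e` says `t⁴ = σ / c y`. Substituting this in the
  -- orthogonal component eliminates `t` and, after inversion by `S`, leaves `y = σ • H y`.
  set H : E → E := fun y => S (lam⁻¹ • T y - (c y)⁻¹ • N (e + y))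
  set M := ‖S‖ * (lam⁻¹ * (‖T‖ * 1) + 2 / c₀ * (C * 2 ^ 5))
  have hM0 : 0 ≤ M := by positivity
  have hHM : ∀ y, ‖y‖ ≤ r → ‖H y‖ ≤ M := by
    intro y hy
    refine (S.le_opNorm _).trans (mul_le_mul_of_nonneg_left ?_ (norm_nonneg S))
    refine (norm_sub_le _ _).trans (add_le_add ?_ ?_)
    · rw [norm_smul, Real.norm_of_nonneg (by positivity)]
      gcongr
      exact (T.le_opNorm y).trans (mul_le_mul_of_nonneg_left (hr1 y hy) (norm_nonneg T))
    · rw [norm_smul, Real.norm_of_nonneg (inv_nonneg.2 (hcpos y hy).le)]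
      exact mul_le_mul (hcinv y hy) (hNb y (hr1 y hy)) (norm_nonneg _) (by positivity)
  set L := ‖S‖ * (lam⁻¹ * ‖T‖ + (2 / c₀ * D + 2 / c₀ * (2 / c₀) * D * (C * 2 ^ 5)))
  have hHL : ∀ y y', ‖y‖ ≤ r → ‖y'‖ ≤ r → ‖H y - H y'‖ ≤ L * ‖y - y'‖ := by
    intro y y' hy hy'
    have e1 : H y - H y' = S (lam⁻¹ • T (y - y') - ((c y)⁻¹ • (N (e + y) - N (e + y')) +
        ((c y)⁻¹ - (c y')⁻¹) • N (e + y'))) := by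
      simp only [H]
      rw [← map_sub, map_sub T]
      congr 1
      module
    have e2 : |(c y)⁻¹ - (c y')⁻¹| ≤ 2 / c₀ * (2 / c₀) * (D * ‖y - y'‖) := by
      rw [inv_sub_inv (hcpos y hy).ne' (hcpos y' hy').ne', abs_div, abs_sub_comm,
        abs_of_pos (mul_pos (hcpos y hy) (hcpos y' hy')), div_eq_mul_inv, mul_inv, mul_comm]
      refine mul_le_mul (mul_le_mul (hcinv y hy) (hcinv y' hy')
        (inv_nonneg.2 (hcpos y' hy').le) (by positivity))
        (hclip y y' (hr1 y hy) (hr1 y' hy')) (abs_nonneg _) (by positivity)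
    rw [e1]
    refine (S.le_opNorm _).trans ?_
    simp only [L]
    rw [mul_assoc]
    refine mul_le_mul_of_nonneg_left ?_ (norm_nonneg S)
    rw [add_mul]
    refine (norm_sub_le _ _).trans (add_le_add ?_ ?_)
    · rw [norm_smul, Real.norm_of_nonneg (by positivity), mul_assoc]
      gcongr
      exact T.le_opNorm _
    · rw [add_mul]
      refine (norm_add_le _ _).trans (add_le_add ?_ ?_)
      · rw [norm_smul, Real.norm_of_nonneg (inv_nonneg.2 (hcpos y hy).le), mul_assoc]
        exact mul_le_mul (hcinv y hy) (hNlip y y' (hr1 y hy) (hr1 y' hy')) (norm_nonneg _)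
          (by positivity)
      · rw [norm_smul, Real.norm_eq_abs]
        calc _ ≤ 2 / c₀ * (2 / c₀) * (D * ‖y - y'‖) * (C * 2 ^ 5) :=
              mul_le_mul e2 (hNb y' (hr1 y' hy')) (norm_nonneg _) (by positivity)
          _ = _ := by ring
  -- Chosen so that `‖z‖ ≤ ‖z‖/4 + θ(|t| + ‖z‖)` forces `‖z‖ ≤ r|t|`.
  set θ := min (1 / 4) (r / 4)
  have hθ : 0 < θ := by positivity
  -- The uniqueness radius depends only on `S`, `C` and `θ`, so it is fixed before `η` and `α`.
  obtain ⟨ε₀, hε₀, hε₀θ⟩ : ∃ ε₀ : ℝ, 0 < ε₀ ∧ ‖S‖ * C * ε₀ ^ 4 < θ := by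
    have hct : Filter.Tendsto (fun t : ℝ => ‖S‖ * C * t ^ 4) (nhds 0) (nhds 0) := by
      have : Continuous fun t : ℝ => ‖S‖ * C * t ^ 4 := by fun_prop
      simpa using this.tendsto 0
    obtain ⟨d, hd, hd'⟩ := Metric.eventually_nhds_iff.1 (hct.eventually_lt_const hθ)
    refine ⟨d / 2, half_pos hd, hd' ?_⟩
    rw [dist_zero_right, Real.norm_of_nonneg (half_pos hd).le]
    exact half_lt_self hd
  refine ⟨ε₀, hε₀, fun η hη => ?_⟩
  have hev : ∀ K a : ℝ, 0 < a → ∀ᶠ σ in nhds (0 : ℝ), σ * K < a := by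
    intro K a ha
    have hct : Filter.Tendsto (fun t : ℝ => t * K) (nhds 0) (nhds 0) := by
      have : Continuous fun t : ℝ => t * K := by fun_prop
      simpa using this.tendsto 0
    exact hct.eventually_lt_const ha
  -- The five conditions serve, in order: invariance of the ball, `‖y‖ < η`, contraction, absorption
  -- of the linear term in the a priori bound, and `s < η / 2`, which suffices as `‖e + y‖ ≤ 2`.
  obtain ⟨d, hd, hd'⟩ := Metric.eventually_nhds_iff.1 ((hev M r hr).and ((hev M η hη).and
    ((hev L (1 / 2) (by norm_num)).and ((hev (‖S‖ * (lam⁻¹ * ‖T‖)) (1 / 4) (by norm_num)).and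
      (hev (2 / c₀) ((η / 2) ^ 4) (by positivity))))))
  refine ⟨d / lam, by positivity, fun α hα hα' => ?_⟩
  obtain ⟨σ, hσdef⟩ : ∃ σ, σ = α * lam - 1 := ⟨_, rfl⟩
  have hσ : 0 < σ := by
    rw [div_lt_iff₀ hlam] at hα
    linarith
  have hσd : σ < d := by
    rw [← add_div, lt_div_iff₀ hlam] at hα'
    linarith
  have hαlam : α = lam⁻¹ + σ * lam⁻¹ := by rw [hσdef]; field_simp; ring
  obtain ⟨k1, k2, k3, k4, k5⟩ := hd' (y := σ) (by
    rwa [dist_zero_right, Real.norm_of_nonneg hσ.le])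
  obtain ⟨y, hyr, hyM, hyfix, hyuniq⟩ := exists_fixedPoint_smul hr.le hHM hHL hσ.le k1.le k3.le
  have hcy := hcpos y hyr
  have hey : inner ℝ e y = 0 := by
    rw [hyfix, inner_smul_right, (hS2 _).1, mul_zero]
  set s := √(√(σ / c y))
  have hs : 0 < s := Real.sqrt_pos.2 (Real.sqrt_pos.2 (div_pos hσ hcy))
  have hs4 : s ^ 4 = σ / c y := by
    have : s ^ 4 = (s ^ 2) ^ 2 := by ring
    rw [this, Real.sq_sqrt (Real.sqrt_nonneg _), Real.sq_sqrt (div_pos hσ hcy).le]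
  -- The normalization by `(c y)⁻¹` makes `⟨e, g⟩ = -1`, so the projection error of `S g` supplies
  -- exactly the missing term `σ e`.
  have hmain : e + y = α • T (e + y) - s ^ 4 • N (e + y) := by
    set g := lam⁻¹ • T y - (c y)⁻¹ • N (e + y) with hg
    have h1 : inner ℝ e g = -1 := by
      rw [hg, inner_sub_right, inner_smul_right, inner_smul_right, hsym, hey,
        real_inner_comm (N (e + y)) e, inv_mul_cancel₀ hcy.ne']
      simp
    have h2 := (hS2 g).2
    have h3 : y - lam⁻¹ • T y = σ • (g + e) := by
      have h4 : y = σ • S g := hyfix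
      rw [h1, neg_one_smul, sub_neg_eq_add] at h2
      rw [← h2]
      conv_lhs => rw [h4]
      rw [map_smul, smul_sub, smul_comm σ lam⁻¹]
    have h5 : y = lam⁻¹ • T y + σ • (g + e) := by rw [← h3]; abel
    have h6 : (lam⁻¹ + σ * lam⁻¹) • lam • e = e + σ • e := by
      rw [smul_smul, add_mul, inv_mul_cancel₀ hlam.ne', mul_assoc, inv_mul_cancel₀ hlam.ne']
      module
    rw [hs4, map_add, hTe, hαlam, smul_add, h6]
    conv_lhs => rw [h5, hg]
    rw [div_eq_mul_inv]
    module
  have hey1 : 1 ≤ ‖e + y‖ := by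
    have h1 : inner ℝ e (e + y) = 1 := by rw [inner_add_right, hee, hey, add_zero]
    have h2 := real_inner_le_norm e (e + y)
    rwa [h1, he, one_mul] at h2
  refine ⟨s, y, hs, hyM.trans_lt k2, ?_, ?_, ?_, fun u hu0 hu hueq => ?_⟩
  · exact smul_ne_zero hs.ne' (norm_pos_iff.1 (zero_lt_one.trans_le hey1))
  · rw [norm_smul, Real.norm_of_nonneg hs.le]
    have h1 : s ^ 4 < (η / 2) ^ 4 := by
      refine lt_of_le_of_lt ?_ k5
      rw [hs4, div_eq_mul_inv]
      gcongr
      exact hcinv y hyr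
    have h2 : s < η / 2 := lt_of_pow_lt_pow_left₀ 4 (by positivity) h1
    have h3 := hball y (hr1 y hyr)
    nlinarith
  · rw [hhom, map_smul, smul_comm α s, pow_succ', mul_smul, ← smul_sub, ← hmain]
  -- Any small solution is split as `t e + z` with `z ⊥ e`. The a priori bound gives `‖z‖ ≤ r|t|`,
  -- so `t ≠ 0` and `y' = z / t` lies in the ball; it solves the same fixed point equation, whence
  -- `y' = y` and `t⁴ = s⁴`.
  · set t := inner ℝ e u with ht
    set z := u - t • e with hz
    have hez : inner ℝ e z = 0 := by rw [hz, inner_sub_right, inner_smul_right, hee]; simp [ht]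
    have huz : u = t • e + z := by rw [hz]; abel
    have hzn : ‖u‖ ≤ |t| + ‖z‖ := by
      rw [huz]
      refine (norm_add_le _ _).trans ?_
      rw [norm_smul, he, mul_one, Real.norm_eq_abs]
    have h1 : σ * t = inner ℝ e (N u) := by
      have h2 := congrArg (fun w => inner ℝ e w) hueq
      simp only [inner_sub_right, inner_smul_right, hsym] at h2
      rw [← ht] at h2
      rw [hσdef]
      linear_combination -h2
    set g := (σ * lam⁻¹) • T z - N u with hg
    have hzg : z = S g := by
      have h3 : z - lam⁻¹ • T z = g + (σ * t) • e := by
        have h4 : z = α • T u - N u - t • e := by rw [← hueq]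
        have h5 : T u = t • lam • e + T z := by
          conv_lhs => rw [huz]
          rw [map_add, map_smul, hTe]
        have h6 : (lam⁻¹ + σ * lam⁻¹) • t • lam • e = t • e + (σ * t) • e := by
          rw [smul_comm t lam, smul_smul, add_mul, inv_mul_cancel₀ hlam.ne', mul_assoc σ,
            inv_mul_cancel₀ hlam.ne']
          module
        refine (congrArg (fun w => w - lam⁻¹ • T z) h4).trans ?_
        rw [h5, hαlam, smul_add, h6]
        rw [hg]
        module
      rw [← hS1 z hez, h3, map_add, map_smul, hSe, smul_zero, add_zero]
    have hzb : ‖z‖ ≤ 1 / 4 * ‖z‖ + θ * (|t| + ‖z‖) := by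
      have h3 : ‖g‖ ≤ (σ * lam⁻¹) * (‖T‖ * ‖z‖) + C * ε₀ ^ 4 * (|t| + ‖z‖) := by
        refine (norm_sub_le _ _).trans (add_le_add ?_ ?_)
        · rw [norm_smul, Real.norm_of_nonneg (by positivity)]
          gcongr
          exact T.le_opNorm z
        · calc ‖N u‖ ≤ C * ‖u‖ ^ 4 * ‖u‖ := (hNn u).trans (by rw [pow_succ, mul_assoc])
            _ ≤ _ := by gcongr
      have h4 : ‖z‖ ≤ ‖S‖ * ‖g‖ := by
        conv_lhs => rw [hzg]
        exact S.le_opNorm g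
      have h5 := h4.trans (mul_le_mul_of_nonneg_left h3 (norm_nonneg S))
      have h6 := mul_le_mul_of_nonneg_right k4.le (norm_nonneg z)
      have h7 := mul_le_mul_of_nonneg_right hε₀θ.le (by positivity : 0 ≤ |t| + ‖z‖)
      calc _ ≤ _ := h5
        _ = σ * (‖S‖ * (lam⁻¹ * ‖T‖)) * ‖z‖ + ‖S‖ * C * ε₀ ^ 4 * (|t| + ‖z‖) := by ring
        _ ≤ _ := add_le_add h6 h7
    have hzt : ‖z‖ ≤ r * |t| := by
      have h3 : θ ≤ 1 / 4 := min_le_left _ _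
      have h4 : θ ≤ r / 4 := min_le_right _ _
      have h5 := mul_le_mul_of_nonneg_right h3 (norm_nonneg z)
      have h6 := mul_le_mul_of_nonneg_right h4 (abs_nonneg t)
      nlinarith [mul_nonneg hr.le (abs_nonneg t)]
    have ht0 : t ≠ 0 := by
      intro h
      rw [h, abs_zero, mul_zero] at hzt
      have hz0 := norm_le_zero_iff.1 hzt
      rw [h, hz0, zero_smul, add_zero] at huz
      exact hu0 huz
    set y' := t⁻¹ • z with hy'
    have hty' : t • y' = z := smul_inv_smul₀ ht0 z
    have hy'r : ‖y'‖ ≤ r := by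
      rw [hy', norm_smul, norm_inv, Real.norm_eq_abs, inv_mul_le_iff₀ (abs_pos.2 ht0), mul_comm]
      exact hzt
    have hut : u = t • (e + y') := by rw [smul_add, hty']; exact huz
    have hcy' := hcpos y' hy'r
    have ht4 : t ^ 4 = σ / c y' := by
      rw [eq_div_iff hcy'.ne']
      rw [hut, hhom, inner_smul_right, real_inner_comm (N (e + y')) e] at h1
      have h3 : t * (t ^ 4 * c y') = t * σ := by
        calc _ = t ^ 5 * c y' := by ring
          _ = σ * t := h1.symm
          _ = _ := by ring
      exact mul_left_cancel₀ ht0 h3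
    have hfix' : y' = σ • H y' := by
      have h3 : t⁻¹ • g = σ • (lam⁻¹ • T y' - (c y')⁻¹ • N (e + y')) := by
        have h4 : t⁻¹ • t ^ 5 • N (e + y') = (σ * (c y')⁻¹) • N (e + y') := by
          rw [smul_smul, ← div_eq_mul_inv, ← ht4]
          congr 1
          field_simp
        have h5 : t⁻¹ • T z = T y' := by rw [hy', map_smul]
        rw [hg, hut, hhom, smul_sub, h4, smul_comm, h5]
        module
      conv_lhs => rw [hy', hzg, ← map_smul, h3, map_smul]
    have hyy := hyuniq y' hy'r hfix'
    rw [hyy] at hut ht4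
    have h8 : t ^ 4 = s ^ 4 := by rw [ht4, hs4]
    have h9 : |t| = s := by
      rw [← abs_of_pos hs]
      exact (pow_left_inj₀ (abs_nonneg t) (abs_nonneg s) four_ne_zero).1 (by
        rw [← abs_pow, ← abs_pow, h8])
    rcases abs_choice t with h | h
    · left; rw [hut, ← h9, h]
    · right; rw [hut, ← h9, h, neg_smul, neg_neg]

end Bifurcation

/-! ### The space `X` and the energy space -/

lemma inner_energy_smul_left (c : ℝ) (G H : Energy) : inner ℝ (c • G) H = c * inner ℝ G H :=
  real_inner_smul_left G H c

lemma hasWeakPartial_fn (u : SpaceX) (i : Fin 3) :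
    HasWeakPartial i (fn u) (weakPartial i (fn u)) := by
  obtain ⟨g, -, hug, -⟩ := u.2.2 i
  exact hug.weakPartial

lemma memLp_weakPartial_fn (u : SpaceX) (i : Fin 3) :
    MemLp (weakPartial i (fn u)) 2 volume := by
  obtain ⟨g, hg, hug, -⟩ := u.2.2 i
  exact hg.ae_eq (HasWeakPartial.ae_eq hug).symm

lemma hasWeakPartial_weakPartial_fn (u : SpaceX) (i j : Fin 3) :
    HasWeakPartial j (weakPartial i (fn u)) (weakPartial j (weakPartial i (fn u))) := by
  obtain ⟨g, -, hug, H⟩ := u.2.2 i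
  obtain ⟨h, -, hgh⟩ := H j
  exact (hgh.congr (HasWeakPartial.ae_eq hug).symm .rfl).weakPartial

lemma exists_energy (u : SpaceX) : ∃ G : Energy, embL6 G = (u : L6) ∧
    ∀ i, gradE i G =ᵐ[volume] weakPartial i (fn u) := by
  obtain ⟨G, h1, h2⟩ := exists_energy_of_hasWeakPartial u.2.1 (memLp_weakPartial_fn u)
    (hasWeakPartial_fn u)
  exact ⟨G, Lp.ext h1, h2⟩

lemma embL6_injective : Function.Injective embL6 := fun G H h =>
  energy_eq_of_embL6_ae_eq (by rw [h])

lemma gradE_ae_eq {u : SpaceX} {G : Energy} (h : embL6 G = (u : L6)) (i : Fin 3) :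
    gradE i G =ᵐ[volume] weakPartial i (fn u) := by
  obtain ⟨H, h1, h2⟩ := exists_energy u
  rw [embL6_injective (h.trans h1.symm)]
  exact h2 i

lemma norm_energy_eq {u : SpaceX} {G : Energy} (h : embL6 G = (u : L6)) :
    √(∑ i, (eLpNorm (weakPartial i (fn u)) 2 volume).toReal ^ 2) = ‖G‖ := by
  rw [← Real.sqrt_sq (norm_nonneg G), norm_sq_energy]
  congr 1
  refine Finset.sum_congr rfl fun i _ => ?_
  rw [Lp.norm_def, eLpNorm_congr_ae (gradE_ae_eq h i)]

lemma norm_le_normX {u : SpaceX} {G : Energy} (h : embL6 G = (u : L6)) : ‖G‖ ≤ normX u := by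
  rw [← norm_energy_eq h]
  exact le_add_of_nonneg_right (Real.sqrt_nonneg _)

lemma inner_testToEnergy {u : SpaceX} {G : Energy} (h : embL6 G = (u : L6)) (η : TestFn) :
    inner ℝ G (testToEnergy η) = ∫ x, -weakLaplacian (fn u) x * (η : R3 → ℝ) x := by
  rw [inner_energy_eq_integral]
  have h1 : ∀ i, ∫ x, gradE i G x * gradE i (testToEnergy η) x =
      -∫ x, weakPartial i (weakPartial i (fn u)) x * (η : R3 → ℝ) x := fun i => by
    rw [← (hasWeakPartial_weakPartial_fn u i i).integral_eq _ η.2.1 η.2.2]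
    refine integral_congr_ae ?_
    filter_upwards [gradE_ae_eq h i, coeFn_gradE_test i η] with x h1 h2
    rw [h1, h2]
  simp only [h1, weakLaplacian, neg_mul, Finset.sum_mul, integral_neg, Finset.sum_neg_distrib]
  rw [integral_finsetSum]
  exact fun i _ => integrable_mul_test (hasWeakPartial_weakPartial_fn u i i).right
    η.2.1.continuous η.2.2

lemma inner_eq_of_weakLaplacian_ae_eq {u : SpaceX} {G : Energy} (h : embL6 G = (u : L6))
    {f : R3 → ℝ} (hf : MemLp f (6 / 5) volume) (hu : ∀ᵐ x, -weakLaplacian (fn u) x = f x)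
    (Φ : Energy) : inner ℝ G Φ = ∫ x, f x * embL6 Φ x := by
  have h1 : innerSL ℝ G = (integralCLM (6 / 5) 6 hf) ∘L embL6 := energy_clm_ext fun η => by
    rw [innerSL_apply_apply, inner_testToEnergy h, ContinuousLinearMap.comp_apply,
      integralCLM_apply]
    refine integral_congr_ae ?_
    filter_upwards [hu, coeFn_embL6_test η] with x h1 h2
    rw [h1, h2]
  exact DFunLike.congr_fun h1 Φ

lemma weakLaplacian_ae_eq_of_inner_eq {u : SpaceX} {G : Energy} (h : embL6 G = (u : L6))
    {f : R3 → ℝ} (hf : MemLp f (6 / 5) volume)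
    (hG : ∀ Φ : Energy, inner ℝ G Φ = ∫ x, f x * embL6 Φ x) :
    ∀ᵐ x, -weakLaplacian (fn u) x = f x := by
  have hl : LocallyIntegrable (fun x => -weakLaplacian (fn u) x) volume := by
    have h1 : LocallyIntegrable (fun x => ∑ i, weakPartial i (weakPartial i (fn u)) x) volume :=
      locallyIntegrable_finsetSum _ fun i _ => (hasWeakPartial_weakPartial_fn u i i).right
    exact h1.neg
  refine ae_eq_of_integral_contDiff_smul_eq hl
    (hf.locallyIntegrable factSixFifths.out) fun η h1 h2 => ?_
  have h3 := (inner_testToEnergy h ⟨η, h1, h2⟩).symm.trans (hG _)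
  simp only [smul_eq_mul, mul_comm (η _)]
  rw [h3]
  refine integral_congr_ae ?_
  filter_upwards [coeFn_embL6_test ⟨η, h1, h2⟩] with x h4
  rw [h4]

/-- Weak solutions in the energy space belong to `X`. -/
lemma exists_spaceX_of_inner_eq {G : Energy} {g : R3 → ℝ} (hg : MemLp g 2 volume)
    (hg' : MemLp g (6 / 5) volume) {κ : ℝ} (hκ : 0 ≤ κ)
    (h : ∀ Φ : Energy, inner ℝ G Φ =
      (∫ x, g x * embL6 Φ x) - κ * ∫ x, embL6 G x ^ 5 * embL6 Φ x) :
    ∃ u : SpaceX, embL6 G = (u : L6) ∧ normX u ≤ ‖G‖ + 9 * (eLpNorm g 2 volume).toReal := by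
  choose k hk hGk hkn using exists_hasWeakPartial_gradE hg hg' hκ h
  let u : SpaceX := ⟨embL6 G, memLp_embL6 G, fun i => ⟨gradE i G, memLp_gradE i G,
    hasWeakPartial_embL6 i G, fun j => ⟨k i j, hk i j, hGk i j⟩⟩⟩
  have hu : embL6 G = (u : L6) := rfl
  refine ⟨u, hu, ?_⟩
  rw [normX, norm_energy_eq hu]
  refine add_le_add_right (Real.sqrt_le_iff.2 ⟨by positivity, ?_⟩) _
  -- Nine second derivatives, each at most `3‖g‖`, have Euclidean norm at most `9‖g‖`.
  have h1 : ∀ i j, (eLpNorm (weakPartial j (weakPartial i (fn u))) 2 volume).toReal ^ 2 ≤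
      (3 * (eLpNorm g 2 volume).toReal) ^ 2 := fun i j => by
    rw [eLpNorm_congr_ae ((hGk i j).congr (gradE_ae_eq hu i) .rfl).ae_eq]
    exact pow_le_pow_left₀ ENNReal.toReal_nonneg (hkn i j) 2
  calc _ ≤ ∑ _i : Fin 3, ∑ _j : Fin 3, (3 * (eLpNorm g 2 volume).toReal) ^ 2 :=
        Finset.sum_le_sum fun i _ => Finset.sum_le_sum fun j _ => h1 i j
    _ = _ := by
      simp only [Finset.sum_const, Finset.card_univ, Fintype.card_fin, nsmul_eq_mul]
      push_cast
      ring

/-! ### Birman–Schwinger eigenspaces and the energy space -/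

section Spectral

variable {V : R3 → ℝ} (hV : Admissible V)

lemma Admissible.sqrt_mul_sqrt_mul {V : R3 → ℝ} (hV : Admissible V) (x : R3) (a : ℝ) : √(V x) * (√(V x) * a) = V x * a := by
  rw [← mul_assoc, Real.mul_self_sqrt (hV.nonneg x)]

lemma norm_sqrtMul_sq (G : Energy) : ‖sqrtMul hV G‖ ^ 2 = inner ℝ (newtonMul hV G) G := by
  rw [inner_newtonMul', real_inner_self_eq_norm_sq]

/-- The correspondence between the nonzero eigenspaces of `AA*` and `A*A`: from `f` one takes
`μ⁻¹A*f`, and back one applies `A`. Regularity places the eigenfunctions of `A*A` in `X`, as the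
definition of the graph demands. -/
lemma mem_birmanSchwingerEigenspace_iff {μ : ℝ} (hμ : μ ≠ 0) {f : L2} :
    f ∈ birmanSchwingerEigenspace V μ ↔
      ∃ G : Energy, newtonMul hV G = μ • G ∧ sqrtMul hV G = f := by
  rw [mem_birmanSchwingerEigenspace]
  constructor
  · rintro ⟨w, h1, h2⟩
    obtain ⟨G, hG, -⟩ := exists_energy w
    have h3 := inner_eq_of_weakLaplacian_ae_eq hG (hV.memLp_sqrt_mul_two (Lp.memLp f)) h1
    have h4 : ∀ᵐ x, √(V x) * embL6 G x = μ * f x := by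
      filter_upwards [h2, Lp.coeFn_smul μ f] with x h5 h6
      rw [hG]
      change _ = √(V x) * ((w : L6) : R3 → ℝ) x at h5
      rw [← h5]
      exact h6
    have h5 : newtonMul hV G = μ • G := ext_inner_right ℝ fun Φ => by
      rw [inner_newtonMul, inner_energy_smul_left, h3, ← integral_const_mul]
      refine integral_congr_ae ?_
      filter_upwards [h4] with x h5
      rw [← hV.sqrt_mul_sqrt_mul, h5]
      ring
    refine ⟨μ⁻¹ • G, by rw [map_smul, h5, smul_comm], ?_⟩
    rw [map_smul, inv_smul_eq_iff₀ hμ]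
    refine Lp.ext ?_
    filter_upwards [h4, coeFn_sqrtMul hV G, Lp.coeFn_smul μ f] with x h5 h6 h7
    rw [h6, h5, h7]
    rfl
  · rintro ⟨G, h1, rfl⟩
    have h2 : ∀ Φ : Energy, inner ℝ (μ • G) Φ = ∫ x, (V x * embL6 G x) * embL6 Φ x := fun Φ => by
      rw [← h1, inner_newtonMul]
    obtain ⟨w, h3, -⟩ := exists_spaceX_of_inner_eq (hV.memLp_mul_two (memLp_embL6 G))
      (hV.memLp_mul_six (memLp_embL6 G)) le_rfl (fun Φ => by rw [h2, zero_mul, sub_zero])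
    refine ⟨w, ?_, ?_⟩
    · filter_upwards [weakLaplacian_ae_eq_of_inner_eq h3 (hV.memLp_mul_six (memLp_embL6 G)) h2,
        coeFn_sqrtMul hV G] with x h4 h5
      rw [h4, h5, hV.sqrt_mul_sqrt_mul]
    · rw [map_smul] at h3
      have h6 : ∀ᵐ x, fn w x = μ * embL6 G x := by
        filter_upwards [Lp.coeFn_smul μ (embL6 G)] with x h7
        rw [fn, ← h3, h7]
        rfl
      filter_upwards [h6, coeFn_sqrtMul hV G, Lp.coeFn_smul μ (sqrtMul hV G)] with x h7 h8 h9
      rw [h9, h7, Pi.smul_apply, h8, smul_eq_mul]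
      ring

/-- On the eigenspace `‖A G‖² = μ‖G‖²`, so `A` is injective there. This is how simplicity passes
from `L²` to the energy space. -/
lemma eq_zero_of_sqrtMul_eq_zero {μ : ℝ} (hμ : μ ≠ 0) {G : Energy}
    (hG : newtonMul hV G = μ • G) (h : sqrtMul hV G = 0) : G = 0 := by
  have h1 := norm_sqrtMul_sq hV G
  rw [h, hG, inner_energy_smul_left, real_inner_self_eq_norm_sq, norm_zero] at h1
  have h2 : ‖G‖ ^ 2 = 0 := by
    refine (mul_eq_zero.1 (?_ : μ * ‖G‖ ^ 2 = 0)).resolve_left hμ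
    simpa using h1.symm
  exact norm_eq_zero.1 (pow_eq_zero_iff two_ne_zero |>.1 h2)

lemma mem_birmanSchwingerEigenvalues_iff {μ : ℝ} (hμ : μ ≠ 0) :
    μ ∈ birmanSchwingerEigenvalues V ↔ ∃ G : Energy, G ≠ 0 ∧ newtonMul hV G = μ • G := by
  rw [birmanSchwingerEigenvalues, Set.mem_ofPred_eq, Submodule.ne_bot_iff]
  constructor
  · rintro ⟨f, hf, hf0⟩
    obtain ⟨G, h1, h2⟩ := (mem_birmanSchwingerEigenspace_iff hV hμ).1 hf
    refine ⟨G, ?_, h1⟩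
    rintro rfl
    exact hf0 (by rw [← h2, map_zero])
  · rintro ⟨G, h0, h1⟩
    exact ⟨_, (mem_birmanSchwingerEigenspace_iff hV hμ).2 ⟨G, h1, rfl⟩,
      fun h => h0 (eq_zero_of_sqrtMul_eq_zero hV hμ h1 h)⟩

lemma exists_eq_smul_of_finrank_eq_one {μ : ℝ} (hμ : μ ≠ 0)
    (h : Module.finrank ℝ (birmanSchwingerEigenspace V μ) = 1) {e : Energy} (he : e ≠ 0)
    (hTe : newtonMul hV e = μ • e) {z : Energy} (hTz : newtonMul hV z = μ • z) :
    ∃ c : ℝ, z = c • e := by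
  let v : birmanSchwingerEigenspace V μ :=
    ⟨sqrtMul hV e, (mem_birmanSchwingerEigenspace_iff hV hμ).2 ⟨e, hTe, rfl⟩⟩
  let w : birmanSchwingerEigenspace V μ :=
    ⟨sqrtMul hV z, (mem_birmanSchwingerEigenspace_iff hV hμ).2 ⟨z, hTz, rfl⟩⟩
  have hv : v ≠ 0 := fun h0 =>
    he (eq_zero_of_sqrtMul_eq_zero hV hμ hTe (congrArg Subtype.val h0))
  obtain ⟨c, hc⟩ := (finrank_eq_one_iff_of_nonzero' v hv).1 h w
  have hc' : c • sqrtMul hV e = sqrtMul hV z := congrArg Subtype.val hc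
  refine ⟨c, sub_eq_zero.1 (eq_zero_of_sqrtMul_eq_zero hV hμ ?_ ?_)⟩
  · rw [map_sub, map_smul, hTe, hTz, smul_sub, smul_comm c]
  · rw [map_sub, map_smul, hc', sub_self]

lemma pos_of_newtonMul_eq_smul {μ : ℝ} (hμ : μ ≠ 0) {G : Energy} (hG : G ≠ 0)
    (h : newtonMul hV G = μ • G) : 0 < μ := by
  have h1 := norm_sqrtMul_sq hV G
  rw [h, inner_energy_smul_left, real_inner_self_eq_norm_sq] at h1
  refine lt_of_le_of_ne ?_ hμ.symm
  have h2 : 0 < ‖G‖ ^ 2 := by positivity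
  exact nonneg_of_mul_nonneg_left (h1 ▸ sq_nonneg _) h2

end Spectral

/-! ### The first two eigenvalues -/

section Compact

variable {E : Type*} [NormedAddCommGroup E] [InnerProductSpace ℝ E] [CompleteSpace E]

/-- The norm of a symmetric operator is its spectral radius, and the nonzero spectrum of a compact
operator consists of eigenvalues. -/
lemma norm_le_of_forall_eigenvalue {T : E →L[ℝ] E} (hT : IsCompactOperator T)
    (hT' : T.IsSymmetric) {M : ℝ} (hM : 0 ≤ M)
    (h : ∀ (μ : ℝ) (z : E), μ ≠ 0 → z ≠ 0 → T z = μ • z → |μ| ≤ M) : ‖T‖ ≤ M := by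
  have h1 : (‖T‖₊ : ℝ≥0∞) ≤ ENNReal.ofReal M := by
    rw [← T.spectralRadius_eq_nnnorm hT'.isSelfAdjoint, spectralRadius]
    refine iSup₂_le fun k hk => ?_
    rcases eq_or_ne k 0 with rfl | hk0
    · simp
    obtain ⟨z, hz⟩ := ((hT.hasEigenvalue_iff_mem_spectrum hk0).2 hk).exists_hasEigenvector
    have h2 := h k z hk0 hz.2 hz.apply_eq_smul
    rw [← enorm_eq_nnnorm, ← ofReal_norm]
    exact ENNReal.ofReal_le_ofReal h2
  rwa [← enorm_eq_nnnorm, ← ofReal_norm, ENNReal.ofReal_le_ofReal_iff hM] at h1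

/-- A compact symmetric operator whose only nonzero eigenvalue is simple has rank one. -/
lemma apply_eq_of_unique_eigenvalue {T : E →L[ℝ] E} (hT : IsCompactOperator T)
    (hT' : T.IsSymmetric) {e : E} (he : ‖e‖ = 1) {lam : ℝ} (hTe : T e = lam • e)
    (h : ∀ (μ : ℝ) (z : E), μ ≠ 0 → T z = μ • z → ∃ c : ℝ, z = c • e) (x : E) :
    T x = (lam * inner ℝ e x) • e := by
  have hee : inner ℝ e e = 1 := by rw [real_inner_self_eq_norm_sq, he, one_pow]
  have hsym : ∀ x, inner ℝ e (T x) = lam * inner ℝ e x := fun x => by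
    have h := hT' e x
    change inner ℝ (T e) x = inner ℝ e (T x) at h
    rw [← h, hTe, real_inner_smul_left]
  let P : E →L[ℝ] E := (ContinuousLinearMap.toSpanSingleton ℝ e) ∘L (innerSL ℝ e)
  have hP : ∀ x, P x = (inner ℝ e x : ℝ) • e := fun x => rfl
  have hPc : IsCompactOperator P :=
    IsCompactOperator.clm_comp (f := innerSL ℝ e)
      (isCompactOperator_of_locallyCompactSpace_dom (innerSL ℝ e : E →L[ℝ] ℝ))
      (ContinuousLinearMap.toSpanSingleton ℝ e)
  let T' : E →L[ℝ] E := T - lam • P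
  have hT'x : ∀ x, T' x = T x - (lam * inner ℝ e x) • e := fun x => by
    change T x - lam • P x = _
    rw [hP, smul_smul]
  have hT'c : IsCompactOperator T' := hT.sub (hPc.smul lam)
  have hT's : T'.IsSymmetric := fun x y => by
    change inner ℝ (T' x) y = inner ℝ x (T' y)
    have h1 : inner ℝ (T x) y = inner ℝ x (T y) := hT' x y
    rw [hT'x, hT'x, inner_sub_left, inner_sub_right, h1, real_inner_smul_left,
      inner_smul_right, real_inner_comm e x]
    ring
  have h0 : ‖T'‖ ≤ 0 := by
    -- The deflated operator has no nonzero eigenvalue: an eigenvector would be orthogonal to `e`,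
    -- hence an eigenvector of `T`, hence a multiple of `e`.
    refine norm_le_of_forall_eigenvalue hT'c hT's le_rfl fun μ z hμ hz hTz => ?_
    exfalso
    have h1 : inner ℝ e z = 0 := by
      have h3 := congrArg (fun w => inner ℝ e w) hTz
      simp only [hT'x, inner_sub_right, hsym, inner_smul_right, hee] at h3
      have : μ * inner ℝ e z = 0 := by linarith
      exact (mul_eq_zero.1 this).resolve_left hμ
    rw [hT'x, h1, mul_zero, zero_smul, sub_zero] at hTz
    obtain ⟨c, rfl⟩ := h μ z hμ hTz
    rw [inner_smul_right, hee, mul_one] at h1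
    exact hz (by rw [h1, zero_smul])
  have h1 : T' x = 0 := by rw [norm_le_zero_iff.1 h0]; rfl
  rw [hT'x] at h1
  exact sub_eq_zero.1 h1

end Compact

section Spectral

variable {V : R3 → ℝ} (hV : Admissible V)

/-- A bump near a point at which the potential is positive. -/
lemma exists_testFn_integral_pos {x : R3} (hx : 0 < V x) {ρ : ℝ} (hρ : 0 < ρ) :
    ∃ η : TestFn, Function.support (η : R3 → ℝ) ⊆ Metric.ball x ρ ∧
      0 < inner ℝ (newtonMul hV (testToEnergy η)) (testToEnergy η) := by
  let b : ContDiffBump x := ⟨ρ / 2, ρ, half_pos hρ, half_lt_self hρ⟩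
  let η : TestFn := ⟨b, b.contDiff, b.hasCompactSupport⟩
  refine ⟨η, b.support_eq.subset, ?_⟩
  have h1 : inner ℝ (newtonMul hV (testToEnergy η)) (testToEnergy η) =
      ∫ y, (V y * b y) * b y := by
    rw [inner_newtonMul]
    refine integral_congr_ae ?_
    filter_upwards [coeFn_embL6_test η] with y hy
    rw [hy]
  rw [h1]
  refine Continuous.integral_pos_of_hasCompactSupport_nonneg_nonzero (x := x)
    ((hV.continuous.mul b.continuous).mul b.continuous) b.hasCompactSupport.mul_left
    (fun y => mul_nonneg (mul_nonneg (hV.nonneg y) b.nonneg) b.nonneg) ?_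
  have h2 : b x = 1 := b.one_of_mem_closedBall (Metric.mem_closedBall_self (half_pos hρ).le)
  change (V x * b x) * b x ≠ 0
  rw [h2]
  simpa using hx.ne'

/-- The operator `newtonMul` of a nonzero potential does not have rank one. -/
lemma not_forall_newtonMul_eq (hV0 : ∃ x, V x ≠ 0) (e : Energy) (lam : ℝ) :
    ¬ ∀ G, newtonMul hV G = (lam * inner ℝ e G) • e := by
  intro h
  obtain ⟨x, hx⟩ := hV0
  have hx0 : 0 < V x := lt_of_le_of_ne (hV.nonneg x) hx.symm
  have h1 : ∀ᶠ y in nhdsWithin x {x}ᶜ, 0 < V y :=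
    (hV.continuous.continuousAt.eventually_const_lt hx0).filter_mono nhdsWithin_le_nhds
  have : (nhdsWithin x {x}ᶜ).NeBot := Module.punctured_nhds_neBot ℝ R3 x
  obtain ⟨y, hy0, hyx⟩ := (h1.and self_mem_nhdsWithin).exists
  have hd : 0 < dist x y / 2 := half_pos (dist_pos.2 (Ne.symm hyx))
  obtain ⟨η, h2, h3⟩ := exists_testFn_integral_pos hV hx0 hd
  obtain ⟨ζ, h4, h5⟩ := exists_testFn_integral_pos hV hy0 hd
  -- Bumps with disjoint supports are orthogonal for the form `∫ V u v`; for a rank one form this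
  -- would make one of the two diagonal values vanish.
  have h6 : inner ℝ (newtonMul hV (testToEnergy η)) (testToEnergy ζ) = 0 := by
    rw [inner_newtonMul]
    refine integral_eq_zero_of_ae ?_
    filter_upwards [coeFn_embL6_test η, coeFn_embL6_test ζ] with z h7 h8
    rw [h7, h8]
    by_cases h9 : z ∈ Metric.ball x (dist x y / 2)
    · have h10 : (ζ : R3 → ℝ) z = 0 := by
        by_contra h11
        have h12 := h4 h11
        have h13 := dist_triangle_left x y z
        rw [Metric.mem_ball] at h9 h12
        linarith
      rw [h10, mul_zero]
      rfl
    · have h10 : (η : R3 → ℝ) z = 0 := by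
        by_contra h11
        exact h9 (h2 h11)
      rw [h10, mul_zero, zero_mul]
      rfl
  rw [h, inner_energy_smul_left] at h3 h5 h6
  rcases mul_eq_zero.1 h6 with h7 | h7
  · rw [h7, zero_mul] at h3
    exact lt_irrefl _ h3
  · rw [h7, mul_zero] at h5
    exact lt_irrefl _ h5

/-- Nonzero eigenvalues are positive, so `λ₂ ≤ 0` would leave `λ₁` as the only possible nonzero one.
Being simple, it would make `newtonMul` of rank at most one, which `not_forall_newtonMul_eq`
excludes. -/
lemma pos_of_isGreatest_diff {V : R3 → ℝ} (hV : Admissible V) (hV0 : ∃ x, V x ≠ 0)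
    (hsimple : ∀ μ ∈ birmanSchwingerEigenvalues V, μ ≠ 0 →
      Module.finrank ℝ (birmanSchwingerEigenspace V μ) = 1) {lam₁ lam₂ : ℝ}
    (h₁ : lam₁ ∈ upperBounds (birmanSchwingerEigenvalues V))
    (h₂ : lam₂ ∈ upperBounds (birmanSchwingerEigenvalues V \ {lam₁})) : 0 < lam₂ := by
  by_contra! hneg
  have key : ∀ (μ : ℝ) (z : Energy), μ ≠ 0 → z ≠ 0 → newtonMul hV z = μ • z → μ = lam₁ := by
    intro μ z hμ hz hTz
    by_contra hne
    have h3 := h₂ ⟨(mem_birmanSchwingerEigenvalues_iff hV hμ).2 ⟨z, hz, hTz⟩, hne⟩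
    exact (pos_of_newtonMul_eq_smul hV hμ hz hTz).not_ge (h3.trans hneg)
  by_cases hex : ∃ e : Energy, e ≠ 0 ∧ lam₁ ≠ 0 ∧ newtonMul hV e = lam₁ • e
  · obtain ⟨e, he, hl, hTe⟩ := hex
    have hTe' : newtonMul hV (‖e‖⁻¹ • e) = lam₁ • ‖e‖⁻¹ • e := by
      rw [map_smul, hTe, smul_comm]
    have he' : ‖e‖⁻¹ • e ≠ 0 := smul_ne_zero (inv_ne_zero (norm_ne_zero_iff.2 he)) he
    refine not_forall_newtonMul_eq hV hV0 _ lam₁ (apply_eq_of_unique_eigenvalue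
      (isCompactOperator_newtonMul hV) (isSymmetric_newtonMul hV) (norm_smul_inv_norm he) hTe'
      fun μ z hμ hTz => ?_)
    rcases eq_or_ne z 0 with rfl | hz
    · exact ⟨0, (zero_smul ℝ _).symm⟩
    obtain rfl := key μ z hμ hz hTz
    exact exists_eq_smul_of_finrank_eq_one hV hμ
      (hsimple _ ((mem_birmanSchwingerEigenvalues_iff hV hμ).2 ⟨z, hz, hTz⟩) hμ) he' hTe' hTz
  · have h0 : ‖newtonMul hV‖ ≤ 0 :=
      norm_le_of_forall_eigenvalue (isCompactOperator_newtonMul hV) (isSymmetric_newtonMul hV)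
        le_rfl fun μ z hμ hz hTz => by
          obtain rfl := key μ z hμ hz hTz
          exact absurd ⟨z, hz, hμ, hTz⟩ hex
    refine not_forall_newtonMul_eq hV hV0 0 0 fun G => ?_
    rw [(norm_le_zero_iff (a := newtonMul hV)).1 h0, smul_zero]
    rfl

lemma norm_newtonMul_le {lam₁ : ℝ} (h0 : 0 ≤ lam₁)
    (h₁ : lam₁ ∈ upperBounds (birmanSchwingerEigenvalues V)) : ‖newtonMul hV‖ ≤ lam₁ :=
  norm_le_of_forall_eigenvalue (isCompactOperator_newtonMul hV) (isSymmetric_newtonMul hV) h0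
    fun μ z hμ hz hTz => by
      rw [abs_of_pos (pos_of_newtonMul_eq_smul hV hμ hz hTz)]
      exact h₁ ((mem_birmanSchwingerEigenvalues_iff hV hμ).2 ⟨z, hz, hTz⟩)

/-- The energy of the Newtonian potential of `√V f`. -/
lemma norm_sq_le_of_inner_eq {lam : ℝ} (hT : ‖newtonMul hV‖ ≤ lam) {K : Energy} {f : R3 → ℝ}
    (hf : MemLp f 2 volume)
    (hK : ∀ Φ : Energy, inner ℝ K Φ = ∫ x, (√(V x) * f x) * embL6 Φ x) :
    ‖K‖ ^ 2 ≤ lam * ∫ x, f x * f x := by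
  -- That is, `K = A*f`. Then `‖K‖⁴ = ⟨f, AK⟩² ≤ ‖f‖² ‖AK‖² ≤ λ ‖f‖² ‖K‖²`.
  have h1 : ∀ Φ : Energy, inner ℝ K Φ = inner ℝ (hf.toLp f) (sqrtMul hV Φ) := fun Φ => by
    rw [hK, inner_L2_eq_integral]
    refine integral_congr_ae ?_
    filter_upwards [hf.coeFn_toLp, coeFn_sqrtMul hV Φ] with x h2 h3
    rw [h2, h3]
    ring
  have h2 : ∫ x, f x * f x = ‖hf.toLp f‖ ^ 2 := by
    rw [← real_inner_self_eq_norm_sq, inner_L2_eq_integral]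
    refine integral_congr_ae ?_
    filter_upwards [hf.coeFn_toLp] with x h2
    rw [h2]
  have h3 : ‖sqrtMul hV K‖ ^ 2 ≤ lam * ‖K‖ ^ 2 := by
    rw [norm_sqrtMul_sq]
    refine (real_inner_le_norm _ _).trans ?_
    rw [sq, ← mul_assoc]
    refine mul_le_mul_of_nonneg_right (((newtonMul hV).le_opNorm K).trans ?_) (norm_nonneg K)
    exact mul_le_mul_of_nonneg_right hT (norm_nonneg K)
  have h4 : ‖K‖ ^ 2 ≤ ‖hf.toLp f‖ * ‖sqrtMul hV K‖ := by
    rw [← real_inner_self_eq_norm_sq, h1]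
    exact real_inner_le_norm _ _
  rw [h2]
  rcases eq_or_ne ‖K‖ 0 with h5 | h5
  · rw [h5, zero_pow two_ne_zero]
    exact mul_nonneg ((norm_nonneg (newtonMul hV)).trans hT) (sq_nonneg _)
  have h6 : 0 < ‖K‖ ^ 2 := by positivity
  have h7 : ‖K‖ ^ 2 * ‖K‖ ^ 2 ≤ lam * ‖hf.toLp f‖ ^ 2 * ‖K‖ ^ 2 := by
    calc _ ≤ (‖hf.toLp f‖ * ‖sqrtMul hV K‖) * (‖hf.toLp f‖ * ‖sqrtMul hV K‖) :=
          mul_self_le_mul_self h6.le h4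
      _ = ‖hf.toLp f‖ ^ 2 * ‖sqrtMul hV K‖ ^ 2 := by ring
      _ ≤ ‖hf.toLp f‖ ^ 2 * (lam * ‖K‖ ^ 2) := mul_le_mul_of_nonneg_left h3 (sq_nonneg _)
      _ = _ := by ring
  exact le_of_mul_le_mul_right h7 h6

end Spectral

/-! ### Signs of the first two eigenfunctions -/

lemma exists_inner_eq_integral {f : R3 → ℝ} (hf : MemLp f (6 / 5) volume) :
    ∃ K : Energy, ∀ Φ : Energy, inner ℝ K Φ = ∫ x, f x * embL6 Φ x :=
  ⟨(InnerProductSpace.toDual ℝ Energy).symm ((integralCLM (6 / 5) 6 hf) ∘L embL6), fun Φ => by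
    rw [InnerProductSpace.toDual_symm_apply]
    rfl⟩

lemma integrable_mul_embL6 {f : R3 → ℝ} (hf : MemLp f (6 / 5) volume) (Φ : Energy) :
    Integrable (fun x => f x * embL6 Φ x) volume :=
  integrable_mul_of_memLp (6 / 5) 6 hf (memLp_embL6 Φ)

lemma embL6_neg_ae (G : Energy) : ∀ᵐ x, embL6 (-G) x = -embL6 G x := by
  rw [map_neg]
  exact Lp.coeFn_neg _

section Sign

variable {V : R3 → ℝ} (hV : Admissible V)

/-- An eigenfunction for the norm of `newtonMul` has a sign where the potential is positive. -/
lemma posPart_or_negPart_ae_eq_zero {lam : ℝ} (hT : ‖newtonMul hV‖ ≤ lam) {G : Energy}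
    (hG : newtonMul hV G = lam • G) :
    (fun x => V x * max (embL6 G x) 0) =ᵐ[volume] 0 ∨
      (fun x => V x * max (-embL6 G x) 0) =ᵐ[volume] 0 := by
  -- Let `P` and `M` be the potentials of `V u⁺` and `V u⁻`. Then `‖P + M‖² ≤ λ ∫ V u² = λ²‖G‖² = ‖P
  -- - M‖²`, so `⟨P, M⟩ ≤ 0`, against strict positivity of `(-Δ)⁻¹`.
  by_contra! hcon
  have hp := (memLp_embL6 G).pos_part
  have hm := (memLp_embL6 G).neg_part
  obtain ⟨P, hP⟩ := exists_inner_eq_integral (hV.memLp_mul_six hp)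
  obtain ⟨M, hM⟩ := exists_inner_eq_integral (hV.memLp_mul_six hm)
  have h1 : 0 < inner ℝ P M := by
    rw [hP]
    exact integral_mul_embL6_pos hM (hV.memLp_mul_six hm)
      (.of_forall fun x => mul_nonneg (hV.nonneg x) (le_max_right _ _)) hcon.2
      (hV.memLp_mul_two hp) (hV.memLp_mul_six hp)
      (.of_forall fun x => mul_nonneg (hV.nonneg x) (le_max_right _ _)) hcon.1
  have h2 : P - M = lam • G := by
    rw [← hG]
    refine ext_inner_right ℝ fun Φ => ?_
    rw [inner_sub_left, hP, hM, inner_newtonMul,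
      ← integral_sub (integrable_mul_embL6 (hV.memLp_mul_six hp) Φ)
        (integrable_mul_embL6 (hV.memLp_mul_six hm) Φ)]
    refine integral_congr_ae (.of_forall fun x => ?_)
    have h3 : max (embL6 G x) 0 - max (-embL6 G x) 0 = embL6 G x := by
      rcases le_total 0 (embL6 G x) with h | h
      · rw [max_eq_left h, max_eq_right (neg_nonpos.2 h), sub_zero]
      · rw [max_eq_right h, max_eq_left (neg_nonneg.2 h), zero_sub, neg_neg]
    simp only []
    conv_rhs => rw [← h3]
    ring
  have h4 : ∀ Φ : Energy, inner ℝ (P + M) Φ =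
      ∫ x, (√(V x) * (√(V x) * |embL6 G x|)) * embL6 Φ x := fun Φ => by
    rw [inner_add_left, hP, hM,
      ← integral_add (integrable_mul_embL6 (hV.memLp_mul_six hp) Φ)
        (integrable_mul_embL6 (hV.memLp_mul_six hm) Φ)]
    refine integral_congr_ae (.of_forall fun x => ?_)
    have h3 : max (embL6 G x) 0 + max (-embL6 G x) 0 = |embL6 G x| := by
      rcases le_total 0 (embL6 G x) with h | h
      · rw [max_eq_left h, max_eq_right (neg_nonpos.2 h), abs_of_nonneg h, add_zero]
      · rw [max_eq_right h, max_eq_left (neg_nonneg.2 h), abs_of_nonpos h, zero_add]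
    simp only []
    rw [hV.sqrt_mul_sqrt_mul, ← h3]
    ring
  have h5 := norm_sq_le_of_inner_eq (f := fun x => √(V x) * |embL6 G x|) hV hT
    (hV.memLp_sqrt_mul_six (memLp_embL6 G).abs) h4
  have h6 : ∫ x, (√(V x) * |embL6 G x|) * (√(V x) * |embL6 G x|) = lam * ‖G‖ ^ 2 := by
    rw [← real_inner_self_eq_norm_sq, ← inner_energy_smul_left, ← hG, inner_newtonMul]
    refine integral_congr_ae (.of_forall fun x => ?_)
    simp only []
    rw [mul_mul_mul_comm, Real.mul_self_sqrt (hV.nonneg x), abs_mul_abs_self, mul_assoc]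
  have h7 : ‖P - M‖ ^ 2 = lam * (lam * ‖G‖ ^ 2) := by
    rw [h2, norm_smul, mul_pow, Real.norm_eq_abs, sq_abs]
    ring
  rw [h6, ← h7, norm_add_sq_real, norm_sub_sq_real] at h5
  linarith

lemma exists_nonneg_eigenfunction {lam : ℝ} (hT : ‖newtonMul hV‖ ≤ lam) {G : Energy}
    (hG0 : G ≠ 0) (hG : newtonMul hV G = lam • G) :
    ∃ H : Energy, H ≠ 0 ∧ newtonMul hV H = lam • H ∧
      0 ≤ᵐ[volume] fun x => V x * embL6 H x := by
  rcases posPart_or_negPart_ae_eq_zero hV hT hG with h | h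
  · refine ⟨-G, neg_ne_zero.2 hG0, by rw [map_neg, hG, smul_neg], ?_⟩
    filter_upwards [h, embL6_neg_ae G] with x h1 h2
    have h3 := mul_le_mul_of_nonneg_left (le_max_left (embL6 G x) 0) (hV.nonneg x)
    rw [h2, mul_neg]
    simp only [Pi.zero_apply] at h1 ⊢
    linarith
  · refine ⟨G, hG0, hG, ?_⟩
    filter_upwards [h] with x h1
    have h3 := mul_le_mul_of_nonneg_left (le_max_left (-embL6 G x) 0) (hV.nonneg x)
    simp only [Pi.zero_apply] at h1 ⊢
    linarith

lemma not_mul_embL6_ae_eq_zero {lam : ℝ} (hl : lam ≠ 0) {G : Energy} (hG0 : G ≠ 0)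
    (hG : newtonMul hV G = lam • G) : ¬ (fun x => V x * embL6 G x) =ᵐ[volume] 0 := by
  intro h
  have h1 : newtonMul hV G = 0 := ext_inner_right ℝ fun Φ => by
    rw [inner_newtonMul, inner_zero_left]
    refine integral_eq_zero_of_ae ?_
    filter_upwards [h] with x hx
    simp only [hx, Pi.zero_apply, zero_mul]
  rw [hG] at h1
  exact hG0 ((smul_eq_zero.1 h1).resolve_left hl)

/-- An eigenfunction orthogonal to a nonnegative one is negative somewhere. -/
lemma not_embL6_nonneg {lam₁ lam₂ : ℝ} (h1 : lam₁ ≠ 0) (h2 : lam₂ ≠ 0) (hne : lam₂ ≠ lam₁)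
    {G e : Energy} (hG0 : G ≠ 0) (hG : newtonMul hV G = lam₁ • G)
    (hGs : 0 ≤ᵐ[volume] fun x => V x * embL6 G x) (he0 : e ≠ 0)
    (he : newtonMul hV e = lam₂ • e) : ¬ (0 ≤ᵐ[volume] (embL6 e : R3 → ℝ)) := by
  intro hes
  -- Were `e` nonnegative, positivity improvement would make this inner product positive; but it is
  -- `λ₁λ₂⟨G, e⟩`, which vanishes as the eigenvalues differ.
  have h3 : 0 < inner ℝ (newtonMul hV G) (newtonMul hV e) := by
    rw [inner_newtonMul]
    refine integral_mul_embL6_pos (fun Φ => inner_newtonMul hV e Φ)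
      (hV.memLp_mul_six (memLp_embL6 e)) ?_ (not_mul_embL6_ae_eq_zero hV h2 he0 he)
      (hV.memLp_mul_two (memLp_embL6 G)) (hV.memLp_mul_six (memLp_embL6 G)) hGs
      (not_mul_embL6_ae_eq_zero hV h1 hG0 hG)
    filter_upwards [hes] with x hx
    exact mul_nonneg (hV.nonneg x) hx
  have h4 : inner ℝ (newtonMul hV G) e = inner ℝ G (newtonMul hV e) :=
    isSymmetric_newtonMul hV G e
  have h5 : inner ℝ G e = 0 := by
    rw [he, hG, inner_energy_smul_left, real_inner_comm (lam₂ • e), inner_energy_smul_left,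
      real_inner_comm G e] at h4
    have : (lam₂ - lam₁) * inner ℝ G e = 0 := by linarith
    exact (mul_eq_zero.1 this).resolve_left (sub_ne_zero.2 hne)
  rw [hG, he, inner_energy_smul_left, real_inner_comm (lam₂ • e), inner_energy_smul_left,
    real_inner_comm G e, h5, mul_zero, mul_zero] at h3
  exact lt_irrefl _ h3

end Sign

/-- The nonnegative cone is closed in `L⁶` and the embedding is continuous, so failing to be
nonnegative is an open condition. -/
lemma exists_forall_not_embL6_nonneg {e : Energy} (he : ¬ (0 ≤ᵐ[volume] (embL6 e : R3 → ℝ))) :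
    ∃ c : ℝ, 0 < c ∧ ∀ y : Energy, ‖y‖ < c → ¬ (0 ≤ᵐ[volume] (embL6 (e + y) : R3 → ℝ)) := by
  have h1 : IsOpen (embL6 ⁻¹' Ici 0)ᶜ := (isClosed_Ici.preimage embL6.continuous).isOpen_compl
  obtain ⟨c, hc, hc'⟩ := Metric.isOpen_iff.1 h1 e fun h => he ((Lp.coeFn_nonneg _).2 h)
  refine ⟨c, hc, fun y hy h => ?_⟩
  have h2 : e + y ∈ Metric.ball e c := by
    rwa [Metric.mem_ball, dist_eq_norm, add_sub_cancel_left]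
  exact hc' h2 ((Lp.coeFn_nonneg _).1 h)

lemma volume_neg_pos {G : Energy} {s : ℝ} (hs : 0 < s)
    (hG : ¬ (0 ≤ᵐ[volume] (embL6 G : R3 → ℝ))) : 0 < volume {x | embL6 (s • G) x < 0} := by
  rw [pos_iff_ne_zero]
  intro h
  refine hG ?_
  have h1 : ∀ᵐ x, 0 ≤ embL6 (s • G) x := by
    rw [ae_iff]
    simpa only [not_le] using h
  rw [map_smul] at h1
  filter_upwards [h1, Lp.coeFn_smul s (embL6 G)] with x h2 h3
  rw [h3] at h2
  exact nonneg_of_mul_nonneg_right h2 hs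

lemma volume_pos_pos {G : Energy} {s : ℝ} (hs : 0 < s)
    (hG : ¬ (0 ≤ᵐ[volume] (embL6 (-G) : R3 → ℝ))) : 0 < volume {x | 0 < embL6 (s • G) x} := by
  refine (volume_neg_pos hs hG).trans_le (le_of_eq (measure_congr ?_))
  rw [smul_neg]
  filter_upwards [embL6_neg_ae (s • G)] with x hx
  refine propext ?_
  change embL6 (-(s • G)) x < 0 ↔ 0 < embL6 (s • G) x
  rw [hx, neg_lt_zero]

/-! ### Solutions in `X` and in the energy space -/

section Solutions

variable {V : R3 → ℝ} (hV : Admissible V)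

lemma solves_iff {u : SpaceX} {G : Energy} (h : embL6 G = (u : L6)) (α : ℝ) :
    F u (fun x => α * V x) =ᵐ[volume] 0 ↔ G = α • newtonMul hV G - newtonPow G := by
  have hf1 : MemLp (fun x => α * (V x * embL6 G x)) (6 / 5) volume :=
    (hV.memLp_mul_six (memLp_embL6 G)).const_mul α
  have hf2 := memLp_pow_five (memLp_embL6 G)
  have hf := hf1.sub hf2
  have h1 : ∀ Φ : Energy, inner ℝ (α • newtonMul hV G - newtonPow G) Φ =
      ∫ x, (α * (V x * embL6 G x) - embL6 G x ^ 5) * embL6 Φ x := fun Φ => by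
    rw [inner_sub_left, inner_energy_smul_left, inner_newtonMul, inner_newtonPow,
      ← integral_const_mul]
    simp only [← mul_assoc α]
    rw [← integral_sub]
    · refine integral_congr_ae (.of_forall fun x => ?_)
      simp only []
      ring
    · simpa only [mul_assoc] using integrable_mul_embL6 hf1 Φ
    · exact integrable_mul_embL6 hf2 Φ
  have h2 : F u (fun x => α * V x) =ᵐ[volume] 0 ↔
      ∀ᵐ x, -weakLaplacian (fn u) x = α * (V x * embL6 G x) - embL6 G x ^ 5 := by
    refine Filter.eventually_congr (.of_forall fun x => ?_)
    rw [h]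
    change -weakLaplacian (fn u) x - α * V x * fn u x + fn u x ^ 5 = 0 ↔
      -weakLaplacian (fn u) x = α * (V x * fn u x) - fn u x ^ 5
    constructor <;> intro h <;> linear_combination h
  rw [h2]
  constructor
  · intro h3
    refine ext_inner_right ℝ fun Φ => ?_
    rw [h1]
    exact inner_eq_of_weakLaplacian_ae_eq h hf h3 Φ
  · intro h3
    refine weakLaplacian_ae_eq_of_inner_eq h hf fun Φ => ?_
    conv_lhs => rw [h3]
    exact h1 Φ

/-- Only `αVu` is treated as a source, while `u⁵` stays on the monotone side with `κ = 1`. The bound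
is thus linear in `‖G‖` and uniform over `|α| ≤ A`, so small solutions in energy are small in `X`.
-/
lemma exists_spaceX_of_eq {A α : ℝ} (hα : |α| ≤ A) {G : Energy}
    (hG : G = α • newtonMul hV G - newtonPow G) :
    ∃ u : SpaceX, embL6 G = (u : L6) ∧
      normX u ≤ (1 + 9 * (eLpNorm V 3 volume).toReal * ‖embL6‖ * A) * ‖G‖ := by
  have hm := memLp_embL6 (α • G)
  obtain ⟨u, h1, h2⟩ := exists_spaceX_of_inner_eq (G := G) (hV.memLp_mul_two hm) (hV.memLp_mul_six hm)
    zero_le_one fun Φ => by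
      conv_lhs => rw [hG]
      rw [inner_sub_left, ← map_smul, inner_newtonMul, inner_newtonPow, one_mul]
  refine ⟨u, h1, h2.trans ?_⟩
  have h3 := toReal_eLpNorm_mul_le 3 6 2 hV.memLp_three hm
  have h4 : (eLpNorm (embL6 (α • G)) 6 volume).toReal ≤ ‖embL6‖ * (A * ‖G‖) := by
    rw [← Lp.norm_def]
    refine (embL6.le_opNorm _).trans (mul_le_mul_of_nonneg_left ?_ (norm_nonneg embL6))
    rw [norm_smul, Real.norm_eq_abs]
    exact mul_le_mul_of_nonneg_right hα (norm_nonneg G)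
  have h5 := h3.trans (mul_le_mul_of_nonneg_left h4 ENNReal.toReal_nonneg)
  linarith

end Solutions

end ExcitedStates

end

/-! ### The main theorem. -/

theorem mainTheorem7 (β : ℝ) (hβ : 2 < β) (V : ExcitedStates.R3 → ℝ)
    (hVY : ExcitedStates.MemY β V) (hV_nonneg : ∀ x, 0 ≤ V x) (hV_ne : ∃ x, V x ≠ 0)
    (h_simple : ∀ μ ∈ ExcitedStates.birmanSchwingerEigenvalues V, μ ≠ 0 →
      Module.finrank ℝ (ExcitedStates.birmanSchwingerEigenspace V μ) = 1)
    (lam₁ lam₂ : ℝ)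
    (h_first : IsGreatest (ExcitedStates.birmanSchwingerEigenvalues V) lam₁)
    (h_second : IsGreatest (ExcitedStates.birmanSchwingerEigenvalues V \ {lam₁}) lam₂) :
    ∃ ε₀ : ℝ, 0 < ε₀ ∧ ∀ ε : ℝ, 0 < ε → ε ≤ ε₀ →
      ∃ δ : ℝ, 0 < δ ∧ ∀ α : ℝ, 1 / lam₂ < α → α < 1 / lam₂ + δ →
        ∃ φ : ExcitedStates.SpaceX, φ ≠ -φ ∧
          ExcitedStates.smallSolutions (fun x => α * V x) ε = {φ, -φ} ∧
          ExcitedStates.ChangesSign φ := by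
  have hV := hVY.admissible hβ hV_nonneg
  have hl2 := ExcitedStates.pos_of_isGreatest_diff hV hV_ne h_simple h_first.2 h_second.2
  obtain ⟨hmem2, hne⟩ := h_second.1
  have hl12 : lam₂ ≤ lam₁ := h_first.2 hmem2
  have hl1 : 0 < lam₁ := hl2.trans_le hl12
  have hT := ExcitedStates.norm_newtonMul_le hV hl1.le h_first.2
  obtain ⟨G₁, hG₁, hTG₁⟩ :=
    (ExcitedStates.mem_birmanSchwingerEigenvalues_iff hV hl1.ne').1 h_first.1
  obtain ⟨G, hG0, hTG, hGs⟩ := ExcitedStates.exists_nonneg_eigenfunction hV hT hG₁ hTG₁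
  obtain ⟨e₂, he₂, hTe₂⟩ :=
    (ExcitedStates.mem_birmanSchwingerEigenvalues_iff hV hl2.ne').1 hmem2
  obtain ⟨e, he, he0, hTe⟩ : ∃ e : ExcitedStates.Energy, ‖e‖ = 1 ∧ e ≠ 0 ∧
      ExcitedStates.newtonMul hV e = lam₂ • e :=
    ⟨‖e₂‖⁻¹ • e₂, norm_smul_inv_norm he₂,
      smul_ne_zero (inv_ne_zero (norm_ne_zero_iff.2 he₂)) he₂,
      by rw [map_smul, hTe₂, smul_comm]⟩
  obtain ⟨c, hc, hcs⟩ := ExcitedStates.exists_forall_not_embL6_nonneg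
    (ExcitedStates.not_embL6_nonneg hV hl1.ne' hl2.ne' hne hG0 hTG hGs he0 hTe)
  -- The same argument for `-e` yields the positive values of the solution.
  obtain ⟨c', hc', hcs'⟩ := ExcitedStates.exists_forall_not_embL6_nonneg
    (ExcitedStates.not_embL6_nonneg hV hl1.ne' hl2.ne' hne hG0 hTG hGs (neg_ne_zero.2 he0)
      (by rw [map_neg, hTe, smul_neg]))
  obtain ⟨C, hC, hlip⟩ := ExcitedStates.exists_norm_newtonPow_sub_le
  obtain ⟨ε₀, hε₀, hbif⟩ := ExcitedStates.exists_bifurcation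
    (ExcitedStates.isCompactOperator_newtonMul hV) (ExcitedStates.isSymmetric_newtonMul hV)
    he hl2 hTe (fun z hz => ExcitedStates.exists_eq_smul_of_finrank_eq_one hV hl2.ne'
      (h_simple _ hmem2 hl2.ne') he0 hTe hz)
    ExcitedStates.newtonPow_smul hC hlip (ExcitedStates.inner_newtonPow_self_pos he0)
  have hK : 0 < 1 + 9 * (eLpNorm V 3 volume).toReal * ‖ExcitedStates.embL6‖ *
      (1 / lam₂ + 1) := by positivity
  refine ⟨ε₀, hε₀, fun ε hε hεε₀ => ?_⟩
  -- The bounds `c`, `c'` keep both signs of `e + y`, and the last entry turns smallness in energy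
  -- into `normX < ε`.
  obtain ⟨δ, hδ, hsol⟩ := hbif (min (min c c') (ε / (1 + 9 * (eLpNorm V 3 volume).toReal *
    ‖ExcitedStates.embL6‖ * (1 / lam₂ + 1)))) (lt_min (lt_min hc hc') (div_pos hε hK))
  -- The cap `1` gives `|α| ≤ 1 / lam₂ + 1`, the bound already built into the regularity constant.
  refine ⟨min δ 1, lt_min hδ one_pos, fun α hα hα' => ?_⟩
  have hαA : |α| ≤ 1 / lam₂ + 1 := by
    rw [abs_of_pos ((by positivity : 0 < 1 / lam₂).trans hα)]
    exact hα'.le.trans (by gcongr; exact min_le_right _ _)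
  obtain ⟨s, y, hs, hy, hne0, hsmall, heq, huniq⟩ :=
    hsol α hα (hα'.trans_le (by gcongr; exact min_le_left _ _))
  rw [lt_min_iff, lt_min_iff] at hy hsmall
  have hmem : ∀ H : ExcitedStates.Energy, H ≠ 0 → ‖H‖ = ‖s • (e + y)‖ →
      H = α • ExcitedStates.newtonMul hV H - ExcitedStates.newtonPow H →
      ∃ u ∈ ExcitedStates.smallSolutions (fun x => α * V x) ε,
        ExcitedStates.embL6 H = (u : ExcitedStates.L6) := by
    intro H hH0 hHn hH
    obtain ⟨u, hu, hun⟩ := ExcitedStates.exists_spaceX_of_eq hV hαA hH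
    refine ⟨u, ⟨?_, hun.trans_lt ?_, (ExcitedStates.solves_iff hV hu α).2 hH⟩, hu⟩
    · rintro rfl
      exact hH0 (ExcitedStates.embL6_injective (hu.trans (map_zero _).symm))
    · rw [hHn, mul_comm]
      exact (lt_div_iff₀ hK).1 hsmall.2
  have hneg : -(s • (e + y)) = α • ExcitedStates.newtonMul hV (-(s • (e + y))) -
      ExcitedStates.newtonPow (-(s • (e + y))) := by
    have h1 := ExcitedStates.newtonPow_smul (-1) (s • (e + y))
    rw [neg_one_smul] at h1
    rw [h1, map_neg, smul_neg, Odd.neg_one_pow (by decide), neg_one_smul, ← neg_sub_neg]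
    conv_lhs => rw [heq]
    abel
  obtain ⟨φ, hφ, hφe⟩ := hmem _ hne0 rfl heq
  obtain ⟨ψ, hψ, hψe⟩ := hmem _ (neg_ne_zero.2 hne0) (norm_neg _) hneg
  have hψφ : ψ = -φ := Subtype.ext (by rw [← hψe, map_neg, hφe]; rfl)
  refine ⟨φ, fun h => ?_, ?_, ?_⟩
  · have h1 : s • (e + y) = -(s • (e + y)) := ExcitedStates.embL6_injective
      (hφe.trans ((congrArg Subtype.val (h.trans hψφ.symm)).trans hψe.symm))
    have h2 : (2 : ℝ) • s • (e + y) = 0 := by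
      rw [two_smul]
      conv_lhs => enter [1]; rw [h1]
      exact neg_add_cancel _
    exact hne0 ((smul_eq_zero.1 h2).resolve_left two_ne_zero)
  · ext u
    constructor
    · rintro ⟨hu0, hun, hu⟩
      obtain ⟨H, hH, -⟩ := ExcitedStates.exists_energy u
      have hH0 : H ≠ 0 := by
        rintro rfl
        exact hu0 (Subtype.ext (hH.symm.trans (map_zero _)))
      -- The energy norm is at most `normX u < ε ≤ ε₀`, so uniqueness in the energy ball covers
      -- every solution in the `X` ball.
      rcases huniq H hH0 ((ExcitedStates.norm_le_normX hH).trans_lt (hun.trans_le hεε₀))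
        ((ExcitedStates.solves_iff hV hH α).1 hu) with rfl | rfl
      · exact Or.inl (Subtype.ext (hH.symm.trans hφe))
      · exact Or.inr ((Subtype.ext (hH.symm.trans hψe) : u = ψ).trans hψφ)
    · rintro (rfl | rfl)
      · exact hφ
      · rwa [hψφ] at hψ
  · change 0 < volume {x | 0 < (φ : ExcitedStates.L6) x} ∧
      0 < volume {x | (φ : ExcitedStates.L6) x < 0}
    rw [← hφe]
    refine ⟨ExcitedStates.volume_pos_pos hs ?_,
      ExcitedStates.volume_neg_pos hs (hcs y hy.1.1)⟩
    rw [neg_add]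
    exact hcs' (-y) (by rw [norm_neg]; exact hy.1.2)
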